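/- **Geometry.** Let $Y\subseteq\mathbb{R}^n$ be open and $\partial Y=\partial_NY\sqcup\partial_DY$ with $\partial_DY$ closed. Let $(\Omega_i)_{i\in I}$ be a finite partition of $Y\cup\partial_NY$ into pairwise disjoint connected submanifolds of dimensions $d_i$. Each is given by a bounded connected nonempty open set $X_i\subset\mathbb{R}^{d_i}$, whose closure $\overline X_i$ is a smooth manifold with boundary $\overline X_i\setminus X_i$, and by a smooth map $\varphi_{0,i}:\overline X_i\to\overline{\Omega_i}$ (smooth up to the boundary) that restricts to a diffeomorphism $X_i\to\Omega_i$. Each $\Omega_i$ carries an orientation. A *conforming forest* $\mathfrak F$ is a finite partially ordered set of nodes, where $\mathfrak S_l=\{j\le l\}$ is the (sub)tree of $l$ ($l$ and its descendants), such that: * the maximal nodes ("roots") correspond to the elements $i\in I$, and every node lies in the tree $\mathfrak S_i$ of exactly one root $i$; * every node $j$ represents a submanifold $\Omega_{s_j}$, $s_j\in I$, with $s_i=i$ for the root $i$; it has the reference domain $X_j:=X_{s_j}$, the coordinate map $\varphi_{0,j}:=\varphi_{0,s_j}$ and the dimension $d_j:=d_{s_j}$; * for $j\le l$ there is a smooth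 injective map $\varphi_{l,j}:\overline X_j\to\overline X_l$, an immersion on $X_j$, with $\varphi_{l,l}=\mathrm{id}$, $\varphi_{m,j}=\varphi_{m,l}\circ\varphi_{l,j}$ for $j\le l\le m$, and $\varphi_{0,j}=\varphi_{0,l}\circ\varphi_{l,j}$; * for every node $l$, the set $\overline X_l\setminus\varphi_{0,l}^{-1}(\partial_DY)$ is the disjoint union of the sets $\varphi_{l,j}(X_j)$, $j\in\mathfrak S_l$. If $l\in\mathfrak S_j$ ($j$ a root) has codimension one, $d_l=d_j-1$, then $\partial_l\Omega_j$ denotes $\Omega_{s_l}$ with the orientation as a part of the boundary of $\Omega_j$ (outward normal first, computed in $X_j$), and $\varepsilon(\Omega_{s_l},\partial_l\Omega_j)\in\{\pm1\}$ is its orientation relative to that of $\Omega_{s_l}$. **Forms.** A mixed-dimensional $k$-form $\mathfrak a$ has for every node $j$, in the tree of the root $i$, a component $a_j=\iota_j\mathfrak a$, which is a form on $\Omega_{s_j}$ (i.e. on $X_j$, through $\varphi_{0,j}$) of degree $k_j=k-(n-d_i)$, with $a_j=0$ if $k_j<0$. The trace $\mathrm{Tr}_{\partial_j\Omega_i}$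 is the pull-back by $\varphi_{i,j}$. Fix signs $\sigma_j\in\{\pm1\}$ for the nodes $j$, with $\sigma_i=1$ for every root $i$; they fix with which sign traces are recorded on the nodes (for instance $\sigma\equiv1$, or $\sigma_j=\varepsilon(\Omega_{s_j},\partial_j\Omega_i)$ for nodes of codimension one). The space $C\mathfrak L^k(\mathfrak F)$ consists of the $\mathfrak a$ such that every $a_j$ is smooth with bounded derivatives on $X_j$ (equivalently, smooth up to the boundary of $X_j$) and $$a_j=\sigma_j\,\mathrm{Tr}_{\partial_j\Omega_i}a_i\qquad\text{for all } i\in I,\ j\in\mathfrak S_i .$$ **Mixed-dimensional exterior derivative.** For $\mathfrak a\in C\mathfrak L^k(\mathfrak F)$ let $\iota_j(\mathfrak d\mathfrak a)=\mathrm da_j+\iota_j(\mathbb d\mathfrak a)$ for all nodes $j$, where the jump operator $\mathbb d$ is given on the roots $i\in I$ by $$\iota_i(\mathbb d\mathfrak a)=(-1)^{n-k}\sum_{j\in I,\ d_j=d_i+1}\ \sum_{l\in\mathfrak S_j,\ s_l=i}\varepsilon(\Omega_i,\partial_l\Omega_j)\,\mathrm{Tr}_{\partial_l\Omega_j}a_j,\qquad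 \mathrm{Tr}_{\partial_l\Omega_j}a_j=\sigma_l a_l,$$ and on the other nodes $j\in\mathfrak S_i$ by $\iota_j(\mathbb d\mathfrak a)=\sigma_j\,\mathrm{Tr}_{\partial_j\Omega_i}\,\iota_i(\mathbb d\mathfrak a)$. **Lemma.** For every $k\ge 0$ the operator $\mathfrak d$ is a linear map $C\mathfrak L^k(\mathfrak F)\to C\mathfrak L^{k+1}(\mathfrak F)$, and $\mathfrak d\mathfrak d\mathfrak a=0$ for all $\mathfrak a\in C\mathfrak L^k(\mathfrak F)$. Thus $(C\mathfrak L^\bullet(\mathfrak F),\mathfrak d)$ is a cochain complex. -/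

import Mathlib

open scoped ContDiff Topology
open Set

noncomputable section

namespace MixedDim

/-- The Euclidean space of dimension `d`. -/
abbrev Euc (d : ℕ) : Type := EuclideanSpace ℝ (Fin d)

/-- (Not necessarily smooth) differential `q`-forms on the Euclidean space of dimension `d`. -/
abbrev Form (d q : ℕ) : Type := Euc d → Euc d [⋀^Fin q]→L[ℝ] ℝ

/-- A reference domain: a bounded, connected, nonempty open set `X` whose closure is a smooth
manifold with boundary `closure X \ X`. The last condition is expressed by local defining
functions of the boundary. -/
structure IsReferenceDomain {d : ℕ} (X : Set (Euc d)) : Prop where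
  isOpen : IsOpen X
  isBounded : Bornology.IsBounded X
  isConnected : IsConnected X
  smooth_boundary : ∀ p ∈ closure X \ X, ∃ (U : Set (Euc d)) (ρ : Euc d → ℝ),
    IsOpen U ∧ p ∈ U ∧ ContDiffOn ℝ ∞ ρ U ∧ fderiv ℝ ρ p ≠ 0 ∧ X ∩ U = {x ∈ U | ρ x < 0}

/-- The vector `v` points out of `X` at the boundary point `p`. -/
def IsOutward {d : ℕ} (X : Set (Euc d)) (p v : Euc d) : Prop :=
  ∀ᶠ t in 𝓝[>] (0 : ℝ), p + t • v ∉ closure X ∧ p - t • v ∈ X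

/-- The map `f`, which parametrizes a hypersurface in the boundary of `X`, is orientation
preserving at `x`: an outward vector of `X` at `f x`, followed by the image of the standard basis
under the derivative of `f`, is a positively oriented basis (outward normal first). -/
def IsPositiveAt {a b : ℕ} (X : Set (Euc b)) (f : Euc a → Euc b) (x : Euc a) : Prop :=
  ∃ (h : b = a + 1) (v : Euc b), IsOutward X (f x) v ∧
    0 < (EuclideanSpace.basisFun (Fin b) ℝ).toBasis.det (fun k : Fin b =>
      (Fin.cons v (fun m : Fin a => fderiv ℝ f x (EuclideanSpace.single m 1)) :
        Fin (a + 1) → Euc b) (Fin.cast h k))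

/-- A partition of `Y ∪ ∂_N Y`, where `Y ⊆ ℝⁿ` is open, into oriented submanifolds
`Ω i = chart i '' X i` (`i : I`), together with a conforming forest with set of nodes `N`.

The nodes are ordered by descent: `j ≤ l` means that `j` is `l` or a descendant of `l`, so that
`{j | j ≤ l}` is the (sub)tree with root `l`. A node `j` belongs to the tree of `tree j : I`, whose
root is the node `root (tree j)`; it represents a part of the boundary of the reference domain of
that tree, which geometrically is the submanifold `Ω (s j)`, and it has the reference domain
`X (s j)` and the coordinate map `chart (s j)` of that submanifold. -/
structure ConformingForest (n : ℕ) (I N : Type*) [PartialOrder N] where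
  /-- the domain -/
  Y : Set (Euc n)
  isOpen_Y : IsOpen Y
  /-- the part `∂_N Y` of the boundary that is included in the partition -/
  neumann : Set (Euc n)
  neumann_subset : neumann ⊆ frontier Y
  /-- the remaining part `∂_D Y` of the boundary is closed -/
  isClosed_dirichlet : IsClosed (frontier Y \ neumann)
  /-- the dimension `d i` of `Ω i` -/
  dim : I → ℕ
  /-- the reference domains -/
  X : ∀ i, Set (Euc (dim i))
  isReferenceDomain : ∀ i, IsReferenceDomain (X i)
  /-- the coordinate maps `φ_{0,i}` of the submanifolds `Ω i` -/
  chart : ∀ i, Euc (dim i) → Euc n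
  chart_smooth : ∀ i, ContDiffOn ℝ ∞ (chart i) (closure (X i))
  chart_embedding : ∀ i, Topology.IsEmbedding ((X i).domRestrict (chart i))
  chart_immersion : ∀ i, ∀ x ∈ X i, Function.Injective (fderiv ℝ (chart i) x)
  chart_disjoint : Pairwise fun i j => Disjoint (chart i '' X i) (chart j '' X j)
  chart_cover : ⋃ i, chart i '' X i = Y ∪ neumann
  /-- the orientation of `Ω i`, relative to the one that `chart i` transports from the standard
  orientation of the Euclidean space -/
  orientation : I → ℤˣ
  /-- the root of the tree of `i` -/
  root : I → N
  /-- the tree to which a node belongs -/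
  tree : N → I
  le_root_iff : ∀ j i, j ≤ root i ↔ tree j = i
  /-- the submanifold that a node represents -/
  s : N → I
  s_root : ∀ i, s (root i) = i
  /-- the maps `φ_{l,j}`, of which only those with `j ≤ l` matter -/
  map : ∀ l j, Euc (dim (s j)) → Euc (dim (s l))
  map_self : ∀ l, EqOn (map l l) id (closure (X (s l)))
  map_smooth : ∀ l j, j ≤ l → ContDiffOn ℝ ∞ (map l j) (closure (X (s j)))
  map_injOn : ∀ l j, j ≤ l → InjOn (map l j) (closure (X (s j)))
  map_immersion : ∀ l j, j ≤ l → ∀ x ∈ X (s j), Function.Injective (fderiv ℝ (map l j) x)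
  /-- compound maps telescope -/
  map_comp : ∀ m l j, j ≤ l → l ≤ m →
    EqOn (map m j) (map m l ∘ map l j) (closure (X (s j)))
  chart_comp : ∀ l j, j ≤ l → EqOn (chart (s j)) (chart (s l) ∘ map l j) (closure (X (s j)))
  /-- every (sub)tree covers its root uniquely -/
  map_disjoint : ∀ l j j', j ≤ l → j' ≤ l → j ≠ j' →
    Disjoint (map l j '' X (s j)) (map l j' '' X (s j'))
  map_cover : ∀ l, ⋃ j ∈ {j | j ≤ l}, map l j '' X (s j) =
    closure (X (s l)) \ chart (s l) ⁻¹' (frontier Y \ neumann)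

namespace ConformingForest

variable {n : ℕ} {I N : Type*} [PartialOrder N] (F : ConformingForest n I N)

open Classical in
/-- The relative orientation `ε(Ω_{s l}, ∂_l Ω_j)`, where `l` is a node of codimension one in the
tree of `j` and `∂_l Ω_j` is oriented as a part of the boundary of `Ω_j`. -/
def relOrientation (l : N) : ℤˣ :=
  F.orientation (F.s l) * F.orientation (F.tree l) *
    if ∃ x ∈ F.X (F.s l),
        IsPositiveAt (F.X (F.s (F.root (F.tree l)))) (F.map (F.root (F.tree l)) l) x
    then 1 else -1

/-- Families of forms of all degrees on the submanifolds `Ω_{s j}`, where `j` runs through the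
nodes of the forest. A form on `Ω_{s j}` is given by its pull-back to the reference domain. -/
abbrev Forms : Type _ := ∀ (j : N) (q : ℕ), Form (F.dim (F.s j)) q

/-- The trace of a form from the node `l` to the node `j ≤ l`: the pull-back under `φ_{l,j}`. -/
def trace (l j : N) {q : ℕ} (α : Form (F.dim (F.s l)) q) : Form (F.dim (F.s j)) q :=
  (closure (F.X (F.s j))).indicator fun x =>
    (α (F.map l j x)).compContinuousLinearMap
      (fderivWithin ℝ (F.map l j) (closure (F.X (F.s j))) x)

theorem trace_add (l j : N) {q : ℕ} (α β : Form (F.dim (F.s l)) q) :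
    F.trace l j (α + β) = F.trace l j α + F.trace l j β := by
  funext x
  by_cases hx : x ∈ closure (F.X (F.s j))
  · simp only [trace, Pi.add_apply, indicator_of_mem hx]
    ext v
    simp
  · simp [trace, indicator_of_notMem hx]

theorem trace_smul (l j : N) {q : ℕ} (c : ℝ) (α : Form (F.dim (F.s l)) q) :
    F.trace l j (c • α) = c • F.trace l j α := by
  funext x
  by_cases hx : x ∈ closure (F.X (F.s j))
  · simp only [trace, Pi.smul_apply, indicator_of_mem hx]
    ext v
    simp
  · simp [trace, indicator_of_notMem hx]

/-- The space of locally continuous mixed-dimensional `k`-forms. The degree on the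
node `j` is `k - (n - d_{tree j})`, and there is no form if this number is negative. The forms are
smooth with bounded derivatives on the (bounded, smooth) reference domains, that is, smooth up to
the boundary; they are extended by zero to the Euclidean space. The form on a node is, up to the
sign `σ j`, the trace of the form on the root of its tree. -/
def smoothForms (σ : N → ℤˣ) (k : ℕ) : Submodule ℝ F.Forms where
  carrier := {a |
    (∀ j q, q + n ≠ k + F.dim (F.tree j) → a j q = 0) ∧
    (∀ j q, ContDiffOn ℝ ∞ (a j q) (closure (F.X (F.s j)))) ∧
    (∀ j q, ∀ x ∉ closure (F.X (F.s j)), a j q x = 0) ∧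
    (∀ j q, a j q = (((σ j : ℤˣ) : ℤ) : ℝ) • F.trace (F.root (F.tree j)) j
      (a (F.root (F.tree j)) q))}
  zero_mem' := by
    refine ⟨fun _ _ _ => rfl, fun _ _ => contDiffOn_const, fun _ _ _ _ => rfl, fun j q => ?_⟩
    have h := F.trace_smul (F.root (F.tree j)) j (0 : ℝ) (0 : Form _ q)
    rw [zero_smul, zero_smul] at h
    change (0 : Form _ q) = _ • F.trace _ j (0 : Form _ q)
    rw [h, smul_zero]
  add_mem' := by
    rintro a b ⟨ha₁, ha₂, ha₃, ha₄⟩ ⟨hb₁, hb₂, hb₃, hb₄⟩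
    refine ⟨fun j q h => ?_, fun j q => (ha₂ j q).add (hb₂ j q), fun j q x hx => ?_,
      fun j q => ?_⟩
    · simp [ha₁ j q h, hb₁ j q h]
    · simp [ha₃ j q x hx, hb₃ j q x hx]
    · change a j q + b j q = _ • F.trace _ j (a _ q + b _ q)
      rw [trace_add, smul_add, ← ha₄, ← hb₄]
  smul_mem' := by
    rintro c a ⟨ha₁, ha₂, ha₃, ha₄⟩
    refine ⟨fun j q h => ?_, fun j q => (ha₂ j q).const_smul c, fun j q x hx => ?_,
      fun j q => ?_⟩
    · simp [ha₁ j q h]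
    · simp [ha₃ j q x hx]
    · change c • a j q = _ • F.trace _ j (c • a _ q)
      rw [trace_smul, smul_comm, ← ha₄]

/-- The exterior derivative on every node. -/
def fixedDeriv (a : F.Forms) : F.Forms
  | _, 0 => 0
  | j, q + 1 => (closure (F.X (F.s j))).indicator
      (extDerivWithin (a j q) (closure (F.X (F.s j))))

/-- A form on `Ω i` as a form on `Ω i'`, where `i = i'`. -/
def castForm {i i' : I} (h : i = i') {q : ℕ} (α : Form (F.dim i) q) : Form (F.dim i') q :=
  h ▸ α

open Classical in
/-- The jump operator at a root node `r`: the signed sum of the traces on all nodes `l` that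
represent the same submanifold as `r` and lie in a tree of dimension one higher. The factor
`σ l` turns the form on `l` into the trace of the form on the root of its tree. -/
def rootJump [Fintype N] (σ : N → ℤˣ) (k : ℕ) (a : F.Forms) (r : N) (q : ℕ) :
    Form (F.dim (F.s r)) q :=
  (-1 : ℝ) ^ (n + k) • ∑ l : N,
    if h : F.s l = F.s r ∧ F.dim (F.tree l) = F.dim (F.s r) + 1 then
      (((F.relOrientation l * σ l : ℤˣ) : ℤ) : ℝ) • F.castForm h.1 (a l q)
    else 0

/-- The jump operator: it is given by `rootJump` on the roots and is extended to all nodes by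
traces, with the signs of the definition of `smoothForms`. -/
def jump [Fintype N] (σ : N → ℤˣ) (k : ℕ) (a : F.Forms) : F.Forms := fun j q =>
  (((σ j : ℤˣ) : ℤ) : ℝ) • F.trace (F.root (F.tree j)) j
    (F.rootJump σ k a (F.root (F.tree j)) q)

/-- The mixed-dimensional exterior derivative on mixed-dimensional `k`-forms. -/
def mixedDeriv [Fintype N] (σ : N → ℤˣ) (k : ℕ) (a : F.Forms) : F.Forms :=
  F.fixedDeriv a + F.jump σ k a

end ConformingForest

end MixedDim

end

/-!
All forms are determined by their components on the roots: the component on a node is, up to a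
sign, the trace of the form on its root (`spread_rootForms`, `mixedDeriv_eq_spread`). On the
roots, the mixed-dimensional exterior derivative is `d ± J`, where `J` (`traceSum`) sums the
traces from all trees of dimension one higher, with relative orientations. Traces are pull-backs,
so `d` commutes with `J`, and the sign `(-1) ^ (n + k)` makes `d` and `± J` anticommute. Since
`d ∘ d = 0`, it remains to see that `J ∘ J = 0` (`traceSum_traceSum`).

The value of `J (J β)` on `Ω i` is a sum over pairs of nodes `(l, m)`, where `l` represents `Ω i`
in a tree `b` and `m` represents `Ω b` in a tree `p`, both with codimension one. The partition of
the boundary of `Ω b` that the descendants of `m` provide is the same as the one that the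
descendants of the root of `b` provide, because a submanifold `Ω i` is connected and is mapped to
the ambient space injectively (`exists_nodeMap_eqOn`). Hence the sum may be taken over the chains
`j ≤ m` of nodes in the tree `p`, where `j` represents `Ω i` and has codimension two, and the
trace of `β p` that occurs only depends on `j`. The orientation of `Ω b` cancels, and it remains
to show that, for fixed `j`, the products of the boundary orientations of `m` in `p` and of `j` in
`m` sum up to zero (`sum_boundarySign_eq_zero`).

This is a local statement at a point of `j` in the boundary of the reference domain `X` of `p`. In
suitable coordinates (`BoundaryChart`), this boundary is the product of the submanifold `j` and a
real line. A hypersurface `m` that has `j` in its boundary covers exactly one of the two sides of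
`j` near the point: it is parametrized by a half-space (`IsBoundaryPiece.exists_collar`), and an
injective map of a half-space which fixes the bounding hyperplane maps the interior to one side
and covers that side (`exists_side`, `exists_halfBall_subset_image`). The product of the two
boundary orientations is the sign of a Jacobian determinant (`frameDet_mul_frameDet`), and it
changes with the side (`exists_det_pos`, `BoundaryChart.exists_side`). Different nodes `m` are
disjoint, so every side is taken at most once. It is taken at least once, because near the point
the boundary is covered by nodes, and those of lower dimension have too small a Hausdorff
dimension to cover an open subset. So there are exactly two nodes `m`, with opposite signs.
-/

noncomputable section

namespace MixedDim

open Filter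

/-! ### Reference domains and their boundaries -/

section DefiningFunction

variable {d : ℕ} {X U : Set (Euc d)} {ρ : Euc d → ℝ} {p v : Euc d}

theorem hasDerivAt_comp_line (hU : IsOpen U) (hρ : ContDiffOn ℝ ∞ ρ U) {q : Euc d} {v : Euc d}
    {t : ℝ} (hq : q + t • v ∈ U) :
    HasDerivAt (fun t : ℝ => ρ (q + t • v)) (fderiv ℝ ρ (q + t • v) v) t := by
  have h1 : HasFDerivAt ρ (fderiv ℝ ρ (q + t • v)) (q + t • v) :=
    ((hρ.contDiffAt (hU.mem_nhds hq)).differentiableAt (by simp)).hasFDerivAt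
  have h2 : HasDerivAt (fun t : ℝ => q + t • v) v t := by
    simpa using ((hasDerivAt_id t).smul_const v).const_add q
  exact h1.comp_hasDerivAt t h2

/-- A defining function is positive on one side and negative on the other side of a boundary point,
along every transversal line. -/
theorem eventually_sign_comp_line (hU : IsOpen U) (hρ : ContDiffOn ℝ ∞ ρ U) (hp : p ∈ U)
    (hp0 : ρ p = 0) (hv : 0 < fderiv ℝ ρ p v) :
    ∀ᶠ t in 𝓝[>] (0 : ℝ), 0 < ρ (p + t • v) ∧ ρ (p - t • v) < 0 := by
  have h1 := hasDerivAt_comp_line (t := 0) (v := v) hU hρ (q := p) (by simpa using hp)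
  have h2 := eventually_nhdsWithin_sign_eq_of_deriv_pos (x₀ := 0)
    (f := fun t : ℝ => ρ (p + t • v)) (by rw [h1.deriv]; simpa using hv) (by simpa using hp0)
  have h3 : ∀ᶠ t in 𝓝 (0 : ℝ), SignType.sign (ρ (p + -t • v)) = SignType.sign (-t) := by
    have : Tendsto (fun t : ℝ => -t) (𝓝 0) (𝓝 0) := by
      simpa using (continuous_neg (G := ℝ)).tendsto 0
    filter_upwards [this.eventually h2] with t ht
    simpa using ht
  filter_upwards [nhdsWithin_le_nhds h2, nhdsWithin_le_nhds h3, self_mem_nhdsWithin]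
    with t ht1 ht2 ht
  have ht : 0 < t := ht
  constructor
  · rw [sub_zero, sign_pos ht] at ht1
    exact sign_eq_one_iff.1 ht1
  · rw [sign_neg (neg_neg_of_pos ht), neg_smul, ← sub_eq_add_neg] at ht2
    exact sign_eq_neg_one_iff.1 ht2

theorem eventually_line_mem (hU : IsOpen U) (hp : p ∈ U) (v : Euc d) :
    ∀ᶠ t in 𝓝[>] (0 : ℝ), p + t • v ∈ U ∧ p - t • v ∈ U := by
  have h1 : Tendsto (fun t : ℝ => p + t • v) (𝓝 0) (𝓝 p) := by
    have : Continuous fun t : ℝ => p + t • v := by fun_prop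
    simpa using this.tendsto 0
  have h2 : Tendsto (fun t : ℝ => p - t • v) (𝓝 0) (𝓝 p) := by
    have : Continuous fun t : ℝ => p - t • v := by fun_prop
    simpa using this.tendsto 0
  exact nhdsWithin_le_nhds
    ((h1.eventually (hU.mem_nhds hp)).and (h2.eventually (hU.mem_nhds hp)))

theorem nonpos_of_mem_closure (hU : IsOpen U) (hρ : ContDiffOn ℝ ∞ ρ U)
    (hX : X ∩ U = {x ∈ U | ρ x < 0}) (hp : p ∈ U) (hpX : p ∈ closure X) : ρ p ≤ 0 := by
  by_contra! h
  have hc : ContinuousAt ρ p := (hρ.continuousOn).continuousAt (hU.mem_nhds hp)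
  obtain ⟨x, ⟨hx1, hx2⟩, hx3⟩ := mem_closure_iff_nhds.1 hpX _
    (inter_mem (hc (Ioi_mem_nhds h)) (hU.mem_nhds hp))
  have : x ∈ X ∩ U := ⟨hx3, hx2⟩
  rw [hX] at this
  exact absurd this.2 (not_lt.2 (le_of_lt hx1))

theorem eq_zero_of_mem_boundary (hU : IsOpen U) (hρ : ContDiffOn ℝ ∞ ρ U)
    (hX : X ∩ U = {x ∈ U | ρ x < 0}) (hp : p ∈ U) (hpX : p ∈ closure X \ X) : ρ p = 0 := by
  refine le_antisymm (nonpos_of_mem_closure hU hρ hX hp hpX.1) ?_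
  by_contra! h
  have : p ∈ X ∩ U := by rw [hX]; exact ⟨hp, h⟩
  exact hpX.2 this.1

theorem mem_boundary_of_eq_zero (hU : IsOpen U) (hρ : ContDiffOn ℝ ∞ ρ U)
    (hX : X ∩ U = {x ∈ U | ρ x < 0}) (hp : p ∈ U) (hp0 : ρ p = 0) (hd : 0 < fderiv ℝ ρ p v) :
    p ∈ closure X \ X := by
  refine ⟨?_, fun h => ?_⟩
  · have h2 : Tendsto (fun t : ℝ => p - t • v) (𝓝[>] 0) (𝓝 p) := by
      have : Continuous fun t : ℝ => p - t • v := by fun_prop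
      simpa using (this.tendsto 0).mono_left (nhdsWithin_le_nhds (s := Ioi 0))
    refine mem_closure_of_tendsto h2 ?_
    filter_upwards [eventually_sign_comp_line hU hρ hp hp0 hd, eventually_line_mem hU hp v]
      with t h3 h4
    have : p - t • v ∈ X ∩ U := by rw [hX]; exact ⟨h4.2, h3.2⟩
    exact this.1
  · have : p ∈ X ∩ U := ⟨h, hp⟩
    rw [hX] at this
    exact absurd this.2 (by simp [hp0])

theorem isOutward_of_fderiv_pos (hU : IsOpen U) (hρ : ContDiffOn ℝ ∞ ρ U)
    (hX : X ∩ U = {x ∈ U | ρ x < 0}) (hp : p ∈ U) (hpX : p ∈ closure X \ X)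
    (hv : 0 < fderiv ℝ ρ p v) : IsOutward X p v := by
  have hp0 := eq_zero_of_mem_boundary hU hρ hX hp hpX
  filter_upwards [eventually_sign_comp_line hU hρ hp hp0 hv, eventually_line_mem hU hp v]
    with t h3 h4
  refine ⟨fun h => ?_, ?_⟩
  · exact absurd (nonpos_of_mem_closure hU hρ hX h4.1 h) (not_le.2 h3.1)
  · have : p - t • v ∈ X ∩ U := by rw [hX]; exact ⟨h4.2, h3.2⟩
    exact this.1

/-- An outward vector may be tangent to the boundary, but it does not point into the domain to
first order. -/
theorem IsOutward.fderiv_nonneg (hU : IsOpen U) (hρ : ContDiffOn ℝ ∞ ρ U)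
    (hX : X ∩ U = {x ∈ U | ρ x < 0}) (hp : p ∈ U) (hpX : p ∈ closure X \ X)
    (hv : IsOutward X p v) : 0 ≤ fderiv ℝ ρ p v := by
  by_contra! h
  have h' : 0 < fderiv ℝ ρ p (-v) := by simpa using h
  have h2 := isOutward_of_fderiv_pos hU hρ hX hp hpX h'
  obtain ⟨t, ht, ht'⟩ := (hv.and h2).exists
  exact ht.1 (subset_closure (by simpa using ht'.2))

end DefiningFunction

namespace IsReferenceDomain

variable {d : ℕ} {X : Set (Euc d)} (hX : IsReferenceDomain X)
include hX

theorem isCompact_closure : IsCompact (closure X) := hX.isBounded.isCompact_closure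

theorem uniqueDiffOn_closure : UniqueDiffOn ℝ (closure X) := by
  intro p hp
  rw [uniqueDiffWithinAt_closure]
  by_cases hpX : p ∈ X
  · exact hX.isOpen.uniqueDiffWithinAt hpX
  obtain ⟨U, ρ, hU, hpU, hρ, hd, hXU⟩ := hX.smooth_boundary p ⟨hp, hpX⟩
  have hp0 := eq_zero_of_mem_boundary hU hρ hXU hpU ⟨hp, hpX⟩
  -- all vectors of an open half-space are tangent vectors
  have hsub : {v | fderiv ℝ ρ p v < 0} ⊆ tangentConeAt ℝ X p := by
    intro v hv
    have hv' : 0 < fderiv ℝ ρ p (-v) := by simpa using hv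
    refine mem_tangentConeAt_of_add_smul_mem (l := 𝓝[>] (0 : ℝ)) (c := id)
      (tendsto_id'.mpr <| nhdsGT_le_nhdsNE 0) ?_
    filter_upwards [eventually_sign_comp_line hU hρ hpU hp0 hv', eventually_line_mem hU hpU (-v)]
      with t h3 h4
    have : p - t • (-v) ∈ X ∩ U := by rw [hXU]; exact ⟨h4.2, h3.2⟩
    simpa using this.1
  have hopen : IsOpen {v | fderiv ℝ ρ p v < 0} :=
    isOpen_lt (fderiv ℝ ρ p).continuous continuous_const
  obtain ⟨w, hw⟩ : ∃ w, fderiv ℝ ρ p w ≠ 0 := by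
    by_contra! h
    exact hd (ContinuousLinearMap.ext h)
  obtain ⟨v, hv⟩ : ∃ v, fderiv ℝ ρ p v < 0 := by
    rcases lt_or_gt_of_ne hw with h | h
    · exact ⟨w, h⟩
    · exact ⟨-w, by simpa using h⟩
  refine ⟨?_, hp⟩
  have : Submodule.span ℝ (tangentConeAt ℝ X p) = ⊤ := by
    apply (Submodule.span ℝ (tangentConeAt ℝ X p)).eq_top_of_nonempty_interior'
    exact ⟨v, mem_interior.2 ⟨_, hsub.trans Submodule.subset_span, hopen, hv⟩⟩
  rw [this]
  exact dense_univ

theorem closure_subset_closure_interior : closure X ⊆ closure (interior (closure X)) :=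
  closure_mono (interior_maximal subset_closure hX.isOpen)

theorem fderivWithin_closure {E : Type*} [NormedAddCommGroup E] [NormedSpace ℝ E] (f : Euc d → E)
    {x : Euc d} (hx : x ∈ X) : fderivWithin ℝ f (closure X) x = fderiv ℝ f x :=
  fderivWithin_of_mem_nhds (mem_of_superset (hX.isOpen.mem_nhds hx) subset_closure)

end IsReferenceDomain

/-! ### Pull-backs of differential forms -/

/-- A family of alternating forms is smooth if it is smooth on all tuples of vectors. -/
theorem contDiffOn_alternating_of_apply {E : Type*} [NormedAddCommGroup E] [NormedSpace ℝ E]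
    {d q : ℕ} {f : E → Euc d [⋀^Fin q]→L[ℝ] ℝ} {s : Set E} {k : WithTop ℕ∞}
    (h : ∀ v, ContDiffOn ℝ k (fun x => f x v) s) : ContDiffOn ℝ k f s := by
  let b := (EuclideanSpace.basisFun (Fin d) ℝ).toBasis
  -- the evaluation on tuples of basis vectors has a linear left inverse
  let Φ : (Euc d [⋀^Fin q]→L[ℝ] ℝ) →ₗ[ℝ] ((Fin q → Fin d) → ℝ) :=
    { toFun := fun α J => α fun i => b (J i)
      map_add' := fun _ _ => rfl
      map_smul' := fun _ _ => rfl }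
  have hΦ : LinearMap.ker Φ = ⊥ := by
    rw [LinearMap.ker_eq_bot]
    intro α β hαβ
    have : α.toAlternatingMap = β.toAlternatingMap := by
      refine Module.Basis.ext_alternating b fun J _ => ?_
      exact congrFun hαβ J
    exact ContinuousAlternatingMap.toAlternatingMap_injective this
  obtain ⟨Ψ, hΨ⟩ := LinearMap.exists_leftInverse_of_injective Φ hΦ
  have h1 : ContDiffOn ℝ k (fun x => Φ (f x)) s := contDiffOn_pi.2 fun J => h _
  have h2 : ContDiffOn ℝ k (fun x => LinearMap.toContinuousLinearMap Ψ (Φ (f x))) s :=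
    (LinearMap.toContinuousLinearMap Ψ).contDiff.comp_contDiffOn h1
  refine h2.congr fun x _ => ?_
  exact (LinearMap.congr_fun hΨ (f x)).symm

theorem _root_.ContDiffOn.alternating_compContinuousLinearMap
    {E : Type*} [NormedAddCommGroup E] [NormedSpace ℝ E]
    {a b q : ℕ} {s : Set E} {k : WithTop ℕ∞} {α : E → Euc b [⋀^Fin q]→L[ℝ] ℝ}
    {L : E → Euc a →L[ℝ] Euc b} (hα : ContDiffOn ℝ k α s) (hL : ContDiffOn ℝ k L s) :
    ContDiffOn ℝ k (fun x => (α x).compContinuousLinearMap (L x)) s := by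
  refine contDiffOn_alternating_of_apply fun v => ?_
  have h1 : ContDiff ℝ k (fun p : (Fin q → Euc a →L[ℝ] Euc b) ×
      ContinuousMultilinearMap ℝ (fun _ : Fin q => Euc b) ℝ => p.2.compContinuousLinearMap p.1) :=
    contDiff_iff_contDiffAt.2 fun p =>
      ContinuousMultilinearMap.analyticAt_uncurry_compContinuousLinearMap.contDiffAt
  have h2 : ContDiffOn ℝ k (fun x => (ContinuousAlternatingMap.toContinuousMultilinearMapCLM ℝ :
      (Euc b [⋀^Fin q]→L[ℝ] ℝ) →L[ℝ] _) (α x)) s :=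
    (ContinuousLinearMap.contDiff _).comp_contDiffOn hα
  have h3 : ContDiffOn ℝ k (fun x => fun _ : Fin q => L x) s := contDiffOn_pi.2 fun _ => hL
  exact (ContinuousMultilinearMap.apply ℝ (fun _ : Fin q => Euc a) ℝ v).contDiff.comp_contDiffOn
    (h1.comp_contDiffOn (h3.prodMk h2))

/-- The pull-back of a form by `f`, as a form on the closure of `X`, extended by zero. -/
def pullback {a b : ℕ} (X : Set (Euc a)) (f : Euc a → Euc b) {q : ℕ} (α : Form b q) : Form a q :=
  (closure X).indicator fun x =>
    (α (f x)).compContinuousLinearMap (fderivWithin ℝ f (closure X) x)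

section Pullback

variable {a b c q : ℕ} {X : Set (Euc a)} {Y : Set (Euc b)} {f : Euc a → Euc b}

theorem pullback_apply {x : Euc a} (hx : x ∈ closure X) (α : Form b q) :
    pullback X f α x =
      (α (f x)).compContinuousLinearMap (fderivWithin ℝ f (closure X) x) :=
  indicator_of_mem hx _

theorem pullback_apply_of_notMem {x : Euc a} (hx : x ∉ closure X) (α : Form b q) :
    pullback X f α x = 0 :=
  indicator_of_notMem hx _

theorem pullback_add (α β : Form b q) :
    pullback X f (α + β) = pullback X f α + pullback X f β := by
  funext x
  by_cases hx : x ∈ closure X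
  · simp only [Pi.add_apply, pullback_apply hx]
    ext v
    simp
  · simp [pullback_apply_of_notMem hx]

theorem pullback_smul (r : ℝ) (α : Form b q) : pullback X f (r • α) = r • pullback X f α := by
  funext x
  by_cases hx : x ∈ closure X
  · simp only [Pi.smul_apply, pullback_apply hx]
    ext v
    simp
  · simp [pullback_apply_of_notMem hx]

theorem pullback_zero : pullback X f (0 : Form b q) = 0 := by
  simpa using pullback_smul (X := X) (f := f) 0 (0 : Form b q)

theorem pullback_sum {ι : Type*} (s : Finset ι) (α : ι → Form b q) :
    pullback X f (∑ i ∈ s, α i) = ∑ i ∈ s, pullback X f (α i) := by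
  classical
  induction s using Finset.induction_on with
  | empty => simp [pullback_zero]
  | insert i s hi ih => rw [Finset.sum_insert hi, Finset.sum_insert hi, pullback_add, ih]

theorem pullback_congr {f' : Euc a → Euc b} (h : EqOn f f' (closure X)) (α : Form b q) :
    pullback X f α = pullback X f' α := by
  funext x
  by_cases hx : x ∈ closure X
  · rw [pullback_apply hx, pullback_apply hx, h hx, fderivWithin_congr h (h hx)]
  · rw [pullback_apply_of_notMem hx, pullback_apply_of_notMem hx]

theorem pullback_id (hX : IsReferenceDomain X) {α : Form a q} (hα : ∀ x ∉ closure X, α x = 0)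
    {f : Euc a → Euc a} (hf : EqOn f id (closure X)) : pullback X f α = α := by
  rw [pullback_congr hf]
  funext x
  by_cases hx : x ∈ closure X
  · rw [pullback_apply hx, fderivWithin_id (hX.uniqueDiffOn_closure x hx)]
    ext v
    simp
  · rw [pullback_apply_of_notMem hx, hα x hx]

theorem pullback_comp (hX : IsReferenceDomain X) {g : Euc b → Euc c}
    (hf : ContDiffOn ℝ ∞ f (closure X)) (hg : ContDiffOn ℝ ∞ g (closure Y))
    (hmaps : MapsTo f (closure X) (closure Y)) (α : Form c q) :
    pullback X f (pullback Y g α) = pullback X (g ∘ f) α := by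
  funext x
  by_cases hx : x ∈ closure X
  · rw [pullback_apply hx, pullback_apply hx, pullback_apply (hmaps hx),
      fderivWithin_comp x (hg.differentiableOn (by simp) _ (hmaps hx))
        (hf.differentiableOn (by simp) _ hx) hmaps (hX.uniqueDiffOn_closure x hx)]
    ext v
    rfl
  · rw [pullback_apply_of_notMem hx, pullback_apply_of_notMem hx]

theorem contDiffOn_pullback (hX : IsReferenceDomain X) {α : Form b q}
    (hf : ContDiffOn ℝ ∞ f (closure X)) (hα : ContDiffOn ℝ ∞ α (closure Y))
    (hmaps : MapsTo f (closure X) (closure Y)) :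
    ContDiffOn ℝ ∞ (pullback X f α) (closure X) := by
  have h1 : ContDiffOn ℝ ∞ (fun x => α (f x)) (closure X) := hα.comp hf hmaps
  have h2 : ContDiffOn ℝ ∞ (fderivWithin ℝ f (closure X)) (closure X) :=
    hf.fderivWithin hX.uniqueDiffOn_closure (by simp)
  exact (h1.alternating_compContinuousLinearMap h2).congr fun x hx => pullback_apply hx α

/-- The exterior derivative of a form on the closure of `X`, extended by zero. -/
def extD (X : Set (Euc a)) (α : Form a q) : Form a (q + 1) :=
  (closure X).indicator (extDerivWithin α (closure X))

theorem extD_apply {x : Euc a} (hx : x ∈ closure X) (α : Form a q) :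
    extD X α x = extDerivWithin α (closure X) x :=
  indicator_of_mem hx _

theorem extD_apply_of_notMem {x : Euc a} (hx : x ∉ closure X) (α : Form a q) :
    extD X α x = 0 :=
  indicator_of_notMem hx _

theorem contDiffOn_extD (hX : IsReferenceDomain X) {α : Form a q}
    (hα : ContDiffOn ℝ ∞ α (closure X)) : ContDiffOn ℝ ∞ (extD X α) (closure X) := by
  have h2 : ContDiffOn ℝ ∞ (fderivWithin ℝ α (closure X)) (closure X) :=
    hα.fderivWithin hX.uniqueDiffOn_closure (by simp)
  let A : (Euc a →L[ℝ] Euc a [⋀^Fin q]→L[ℝ] ℝ) →L[ℝ] Euc a [⋀^Fin (q + 1)]→L[ℝ] ℝ :=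
    ContinuousAlternatingMap.alternatizeUncurryFinCLM ℝ (Euc a) ℝ
  have hA : ContDiff ℝ ∞ A := ContinuousLinearMap.contDiff (𝕜 := ℝ)
    (E := (Euc a →L[ℝ] Euc a [⋀^Fin q]→L[ℝ] ℝ)) (F := Euc a [⋀^Fin (q + 1)]→L[ℝ] ℝ) A
  have h3 : ContDiffOn ℝ ∞ (extDerivWithin α (closure X)) (closure X) := hA.comp_contDiffOn h2
  exact h3.congr fun x hx => extD_apply hx α

theorem extD_add (hX : IsReferenceDomain X) {α β : Form a q}
    (hα : ContDiffOn ℝ ∞ α (closure X)) (hβ : ContDiffOn ℝ ∞ β (closure X)) :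
    extD X (α + β) = extD X α + extD X β := by
  funext x
  by_cases hx : x ∈ closure X
  · rw [Pi.add_apply, extD_apply hx, extD_apply hx, extD_apply hx,
      extDerivWithin_add (hX.uniqueDiffOn_closure x hx)
        (hα.differentiableOn (by simp) x hx) (hβ.differentiableOn (by simp) x hx)]
  · simp [extD_apply_of_notMem hx]

theorem extD_smul (hX : IsReferenceDomain X) (r : ℝ) (α : Form a q) :
    extD X (r • α) = r • extD X α := by
  funext x
  by_cases hx : x ∈ closure X
  · rw [Pi.smul_apply, extD_apply hx, extD_apply hx,
      extDerivWithin_smul r α (hX.uniqueDiffOn_closure x hx)]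
  · simp [extD_apply_of_notMem hx]

theorem extD_zero (hX : IsReferenceDomain X) : extD X (0 : Form a q) = 0 := by
  simpa using extD_smul hX 0 (0 : Form a q)

theorem extD_sum (hX : IsReferenceDomain X) {ι : Type*} (s : Finset ι) {α : ι → Form a q}
    (hα : ∀ i ∈ s, ContDiffOn ℝ ∞ (α i) (closure X)) :
    extD X (∑ i ∈ s, α i) = ∑ i ∈ s, extD X (α i) := by
  classical
  induction s using Finset.induction_on with
  | empty => simp [extD_zero hX]
  | insert i s hi ih =>
    have h2 : ∀ j ∈ s, ContDiffOn ℝ ∞ (α j) (closure X) :=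
      fun j hj => hα j (Finset.mem_insert_of_mem hj)
    have h3 : ContDiffOn ℝ ∞ (∑ j ∈ s, α j) (closure X) := by
      have := ContDiffOn.sum (s := s) h2
      convert this using 1
      funext x
      simp
    rw [Finset.sum_insert hi, Finset.sum_insert hi,
      extD_add hX (hα i (Finset.mem_insert_self _ _)) h3, ih h2]

theorem extD_extD (hX : IsReferenceDomain X) {α : Form a q}
    (hα : ContDiffOn ℝ ∞ α (closure X)) : extD X (extD X α) = 0 := by
  funext x
  by_cases hx : x ∈ closure X
  · rw [extD_apply hx]
    rw [extDerivWithin_congr' (ω₂ := extDerivWithin α (closure X))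
      (fun y hy => extD_apply hy α) hx]
    exact extDerivWithin_extDerivWithin_apply (hα x hx) (by simp; norm_cast)
      hX.uniqueDiffOn_closure (hX.closure_subset_closure_interior hx) hx
  · rw [extD_apply_of_notMem hx]
    rfl

theorem extD_pullback (hX : IsReferenceDomain X) {α : Form b q}
    (hf : ContDiffOn ℝ ∞ f (closure X)) (hα : ContDiffOn ℝ ∞ α (closure Y))
    (hmaps : MapsTo f (closure X) (closure Y)) :
    extD X (pullback X f α) = pullback X f (extD Y α) := by
  funext x
  by_cases hx : x ∈ closure X
  · rw [extD_apply hx, pullback_apply hx, extD_apply (hmaps hx),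
      extDerivWithin_congr' (fun y hy => pullback_apply hy α) hx]
    exact extDerivWithin_pullback (hα.differentiableOn (by simp) _ (hmaps hx)) (hf x hx)
      (r := ∞) (by simp; norm_cast) hX.uniqueDiffOn_closure
      (hX.closure_subset_closure_interior hx) hx hmaps
  · rw [extD_apply_of_notMem hx, pullback_apply_of_notMem hx]

end Pullback

/-! ### Determinants of block triangular maps and orientations -/

section BlockDet

variable {E : Type*} [AddCommGroup E] [Module ℝ E] [FiniteDimensional ℝ E]

theorem toMatrix_prod_singleton (T : E × ℝ →ₗ[ℝ] E × ℝ) :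
    LinearMap.toMatrix ((Module.finBasis ℝ E).prod (Module.Basis.singleton Unit ℝ))
      ((Module.finBasis ℝ E).prod (Module.Basis.singleton Unit ℝ)) T =
    Matrix.fromBlocks
      (LinearMap.toMatrix (Module.finBasis ℝ E) (Module.finBasis ℝ E)
        (LinearMap.fst ℝ E ℝ ∘ₗ T ∘ₗ LinearMap.inl ℝ E ℝ))
      (Matrix.of fun i _ => (Module.finBasis ℝ E).repr (T (0, 1)).1 i)
      (Matrix.of fun _ j => (T (Module.finBasis ℝ E j, 0)).2)
      (Matrix.of fun _ _ => (T (0, 1)).2) := by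
  ext i j
  rcases i with i | i <;> rcases j with j | j <;>
    simp [LinearMap.toMatrix_apply]

/-- The determinant of a block lower triangular map. -/
theorem det_of_map_inr {T : E × ℝ →ₗ[ℝ] E × ℝ} (h : (T (0, 1)).1 = 0) :
    LinearMap.det T =
      LinearMap.det (LinearMap.fst ℝ E ℝ ∘ₗ T ∘ₗ LinearMap.inl ℝ E ℝ) * (T (0, 1)).2 := by
  rw [← LinearMap.det_toMatrix ((Module.finBasis ℝ E).prod (Module.Basis.singleton Unit ℝ)),
    toMatrix_prod_singleton]
  have : (Matrix.of fun i (_ : Unit) => (Module.finBasis ℝ E).repr (T (0, 1)).1 i) = 0 := by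
    ext i j
    simp [h]
  rw [this, Matrix.det_fromBlocks_zero₁₂, LinearMap.det_toMatrix]
  simp

/-- The determinant of a block upper triangular map. -/
theorem det_of_map_inl {T : E × ℝ →ₗ[ℝ] E × ℝ} (h : ∀ u, (T (u, 0)).2 = 0) :
    LinearMap.det T =
      LinearMap.det (LinearMap.fst ℝ E ℝ ∘ₗ T ∘ₗ LinearMap.inl ℝ E ℝ) * (T (0, 1)).2 := by
  rw [← LinearMap.det_toMatrix ((Module.finBasis ℝ E).prod (Module.Basis.singleton Unit ℝ)),
    toMatrix_prod_singleton]
  have : (Matrix.of fun (_ : Unit) j => (T (Module.finBasis ℝ E j, 0)).2) = 0 := by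
    ext i j
    simp [h]
  rw [this, Matrix.det_fromBlocks_zero₂₁, LinearMap.det_toMatrix]
  simp

/-- If `T` maps a vector with last component `ξ.2` to the vector `(0, c)`, then Cramer's rule
expresses `ξ.2` by determinants. -/
theorem det_mul_snd_of_apply_eq {T : E × ℝ →ₗ[ℝ] E × ℝ} {ξ : E × ℝ} {c : ℝ} (h : T ξ = (0, c)) :
    LinearMap.det T * ξ.2 =
      LinearMap.det (LinearMap.fst ℝ E ℝ ∘ₗ T ∘ₗ LinearMap.inl ℝ E ℝ) * c := by
  let S : E × ℝ →ₗ[ℝ] E × ℝ := (LinearMap.inl ℝ E ℝ).coprod (LinearMap.toSpanSingleton ℝ _ ξ)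
  have hS1 : S (0, 1) = ξ := by simp [S]
  have hS : LinearMap.det S = ξ.2 := by
    rw [det_of_map_inl (by simp [S]), hS1]
    have : LinearMap.fst ℝ E ℝ ∘ₗ S ∘ₗ LinearMap.inl ℝ E ℝ = LinearMap.id := by
      ext u
      simp [S]
    rw [this]
    simp
  have hTS : (T ∘ₗ S) (0, 1) = (0, c) := by
    rw [LinearMap.comp_apply, hS1, h]
  rw [← hS, ← LinearMap.det_comp, det_of_map_inr (by rw [hTS]), hTS]
  congr 2
  ext u
  simp [S]

end BlockDet

/-- The splitting of the first coordinate off a Euclidean space. It becomes the last component. -/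
def splitFirst (a : ℕ) : Euc (a + 1) ≃ₗ[ℝ] Euc a × ℝ where
  toFun x := (WithLp.toLp 2 fun i => x i.succ, x 0)
  invFun p := WithLp.toLp 2 (Fin.cons p.2 p.1 : Fin (a + 1) → ℝ)
  map_add' _ _ := rfl
  map_smul' _ _ := rfl
  left_inv x := by
    ext i
    refine Fin.cases ?_ (fun j => ?_) i <;> simp
  right_inv p := by
    ext i <;> simp

theorem splitFirst_apply (a : ℕ) (x : Euc (a + 1)) :
    splitFirst a x = (WithLp.toLp 2 fun i => x i.succ, x 0) := rfl

theorem splitFirst_zero (a : ℕ) : splitFirst a (EuclideanSpace.single 0 1) = (0, 1) := by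
  rw [splitFirst_apply]
  ext i <;> simp

theorem splitFirst_succ (a : ℕ) (i : Fin a) :
    splitFirst a (EuclideanSpace.single i.succ 1) = (EuclideanSpace.single i 1, 0) := by
  rw [splitFirst_apply]
  ext j
  · simp
  · simp

/-- The determinant of the vector `v` followed by the columns of `A`. -/
def frameDet {a : ℕ} (v : Euc (a + 1)) (A : Euc a →L[ℝ] Euc (a + 1)) : ℝ :=
  (EuclideanSpace.basisFun (Fin (a + 1)) ℝ).toBasis.det
    (Fin.cons v fun m : Fin a => A (EuclideanSpace.single m 1) : Fin (a + 1) → Euc (a + 1))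

/-- The map `(u, t) ↦ A u + t v`. -/
def frameMap {a b : ℕ} (v : Euc b) (A : Euc a →L[ℝ] Euc b) : Euc a × ℝ →ₗ[ℝ] Euc b :=
  A.toLinearMap.coprod (LinearMap.toSpanSingleton ℝ _ v)

theorem frameMap_apply {a b : ℕ} (v : Euc b) (A : Euc a →L[ℝ] Euc b) (q : Euc a × ℝ) :
    frameMap v A q = A q.1 + q.2 • v := by
  simp [frameMap]

theorem frameDet_eq_det {a : ℕ} (v : Euc (a + 1)) (A : Euc a →L[ℝ] Euc (a + 1)) :
    frameDet v A = LinearMap.det ((splitFirst a).toLinearMap ∘ₗ frameMap v A) := by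
  have h1 : (Fin.cons v fun m : Fin a => A (EuclideanSpace.single m 1) :
      Fin (a + 1) → Euc (a + 1)) = (frameMap v A ∘ₗ (splitFirst a).toLinearMap) ∘
        (EuclideanSpace.basisFun (Fin (a + 1)) ℝ).toBasis := by
    funext i
    refine Fin.cases ?_ (fun j => ?_) i
    · simp [frameMap_apply, splitFirst_zero]
    · simp [frameMap_apply, splitFirst_succ]
  rw [frameDet, h1, Module.Basis.det_comp, Module.Basis.det_self, mul_one,
    ← LinearMap.det_conj _ (splitFirst a)]
  congr 1

theorem continuous_frameDet {a : ℕ} (v : Euc (a + 1)) :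
    Continuous fun A : Euc a →L[ℝ] Euc (a + 1) => frameDet v A := by
  unfold frameDet
  simp only [Module.Basis.det_apply]
  refine Continuous.matrix_det ?_
  refine continuous_matrix fun i j => ?_
  refine Fin.cases ?_ (fun k => ?_) j
  · simp [Module.Basis.toMatrix_apply, continuous_const]
  · simp only [Module.Basis.toMatrix_apply, Fin.cons_succ]
    have : Continuous fun A : Euc a →L[ℝ] Euc (a + 1) => A (EuclideanSpace.single k 1) :=
      (ContinuousLinearMap.apply ℝ (Euc (a + 1)) (EuclideanSpace.single k 1)).continuous
    have h2 : Continuous fun w : Euc (a + 1) => w i := by fun_prop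
    exact h2.comp this

theorem frameDet_ne_zero {a : ℕ} {v : Euc (a + 1)} {A : Euc a →L[ℝ] Euc (a + 1)}
    (hA : Function.Injective A) (ℓ : Euc (a + 1) →L[ℝ] ℝ) (hℓA : ∀ u, ℓ (A u) = 0)
    (hv : ℓ v ≠ 0) : frameDet v A ≠ 0 := by
  rw [frameDet_eq_det]
  intro h0
  have := LinearMap.bot_lt_ker_of_det_eq_zero h0
  rw [bot_lt_iff_ne_bot, Ne, LinearMap.ker_eq_bot'] at this
  refine this fun q hq => ?_
  have hq' : A q.1 + q.2 • v = 0 := by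
    rw [← frameMap_apply]
    simpa using hq
  have h2 : q.2 = 0 := by
    have := congrArg ℓ hq'
    simpa [hℓA, hv] using this
  rw [h2, zero_smul, add_zero] at hq'
  have h1 : q.1 = 0 := hA (by rw [hq', map_zero])
  exact Prod.ext h1 h2

/-- For fixed `A`, the determinant `frameDet v A` depends on `v` only through a linear functional
that vanishes on the range of `A`. -/
theorem frameDet_mul_comm {a : ℕ} (v w : Euc (a + 1)) {A : Euc a →L[ℝ] Euc (a + 1)}
    (hA : Function.Injective A) (ℓ : Euc (a + 1) →L[ℝ] ℝ) (hℓA : ∀ u, ℓ (A u) = 0)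
    (hv : ℓ v ≠ 0) : frameDet w A * ℓ v = frameDet v A * ℓ w := by
  -- write `w = A u + t v`
  have h0 : frameDet v A ≠ 0 := frameDet_ne_zero hA ℓ hℓA hv
  rw [frameDet_eq_det] at h0
  have hs : Function.Surjective ((splitFirst a).toLinearMap ∘ₗ frameMap v A) := by
    rw [← LinearMap.injective_iff_surjective, ← LinearMap.ker_eq_bot]
    by_contra h
    exact h0 (LinearMap.det_eq_zero_iff_ker_ne_bot.2 h)
  obtain ⟨q, hq⟩ := hs (splitFirst a w)
  have hq' : w = A q.1 + q.2 • v := by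
    rw [← frameMap_apply]
    exact ((splitFirst a).injective (by simpa using hq)).symm
  have hw : ℓ w = q.2 * ℓ v := by
    rw [hq']
    simp [hℓA]
  let S : Euc a × ℝ →ₗ[ℝ] Euc a × ℝ :=
    (LinearMap.inl ℝ (Euc a) ℝ).coprod (LinearMap.toSpanSingleton ℝ _ q)
  have hS : LinearMap.det S = q.2 := by
    rw [det_of_map_inl (by simp [S])]
    have : LinearMap.fst ℝ (Euc a) ℝ ∘ₗ S ∘ₗ LinearMap.inl ℝ (Euc a) ℝ = LinearMap.id := by
      ext u
      simp [S]
    rw [this]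
    simp [S]
  have hfm : frameMap w A = frameMap v A ∘ₗ S := by
    refine LinearMap.ext fun p => ?_
    have hSp : S p = (p.1 + p.2 • q.1, p.2 * q.2) := by
      refine Prod.ext ?_ ?_ <;> simp [S]
    rw [LinearMap.comp_apply, hSp, frameMap_apply, frameMap_apply, hq', map_add, map_smul,
      smul_add, smul_smul, add_assoc]
  rw [frameDet_eq_det w, hfm, ← LinearMap.comp_assoc, LinearMap.det_comp, hS, ← frameDet_eq_det,
    hw]
  ring

/-- The determinant of a linear map from `(Euc a × ℝ) × ℝ` to the Euclidean space, in the standard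
coordinates. -/
def flagDet {a : ℕ} (P : (Euc a × ℝ) × ℝ →ₗ[ℝ] Euc (a + 1 + 1)) : ℝ :=
  LinearMap.det (((splitFirst a).prodCongr (LinearEquiv.refl ℝ ℝ)).toLinearMap ∘ₗ
    (splitFirst (a + 1)).toLinearMap ∘ₗ P)

theorem flagDet_ne_zero {a : ℕ} (P : ((Euc a × ℝ) × ℝ) ≃L[ℝ] Euc (a + 1 + 1)) :
    flagDet P.toLinearEquiv.toLinearMap ≠ 0 :=
  (LinearEquiv.isUnit_det' (P.toLinearEquiv.trans ((splitFirst (a + 1)).trans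
    ((splitFirst a).prodCongr (LinearEquiv.refl ℝ ℝ))))).ne_zero

theorem continuous_flagDet {a : ℕ} :
    Continuous fun P : (Euc a × ℝ) × ℝ →L[ℝ] Euc (a + 1 + 1) => flagDet P.toLinearMap := by
  let C : Euc (a + 1 + 1) →L[ℝ] (Euc a × ℝ) × ℝ := LinearMap.toContinuousLinearMap
    (((splitFirst a).prodCongr (LinearEquiv.refl ℝ ℝ)).toLinearMap ∘ₗ
    (splitFirst (a + 1)).toLinearMap)
  have h : Continuous fun P : (Euc a × ℝ) × ℝ →L[ℝ] Euc (a + 1 + 1) => C.comp P :=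
    (ContinuousLinearMap.compL ℝ _ _ _ C).continuous
  exact ContinuousLinearMap.continuous_det.comp h

/-- The product formula for orientations: in a flag of two hypersurfaces, the product of the two
determinants that describe the boundary orientations is, up to a sign and a factor that only
depends on the coordinates `P` of the ambient space, the Jacobian of the coordinate change. -/
theorem frameDet_mul_frameDet {a : ℕ} (A : Euc (a + 1) →L[ℝ] Euc (a + 1 + 1))
    (v : Euc (a + 1 + 1)) (B : Euc a →L[ℝ] Euc (a + 1)) (w : Euc (a + 1))
    (P : ((Euc a × ℝ) × ℝ) ≃L[ℝ] Euc (a + 1 + 1)) (hP : P (0, 1) = v)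
    (D : Euc a × ℝ →L[ℝ] Euc a × ℝ)
    (hD : ∀ q, D q = (P.symm (A (B q.1 - q.2 • w))).1) :
    frameDet v A * frameDet w B =
      -(flagDet P.toLinearEquiv.toLinearMap * LinearMap.det D.toLinearMap) := by
  set J := splitFirst a
  set J' := splitFirst (a + 1)
  set Q : (Euc (a + 1) × ℝ) ≃ₗ[ℝ] (Euc a × ℝ) × ℝ := J.prodCongr (LinearEquiv.refl ℝ ℝ)
  have h1 : frameDet (-w) B = - frameDet w B := by
    have : frameMap (-w) B = frameMap w B ∘ₗ
        LinearMap.prodMap (LinearMap.id : Euc a →ₗ[ℝ] Euc a) (-LinearMap.id : ℝ →ₗ[ℝ] ℝ) := by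
      refine LinearMap.ext fun q => ?_
      simp [frameMap_apply]
    rw [frameDet_eq_det, this, ← LinearMap.comp_assoc, LinearMap.det_comp, LinearMap.det_prodMap,
      ← frameDet_eq_det]
    simp
  have h2 : frameDet v A = LinearMap.det (Q.toLinearMap ∘ₗ (J'.toLinearMap ∘ₗ frameMap v A) ∘ₗ
      Q.symm.toLinearMap) := by
    rw [frameDet_eq_det]
    exact (LinearMap.det_conj _ Q).symm
  have h3 : frameDet (-w) B = LinearMap.det (LinearMap.prodMap
      (J.toLinearMap ∘ₗ frameMap (-w) B) (LinearMap.id : ℝ →ₗ[ℝ] ℝ)) := by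
    rw [LinearMap.det_prodMap, ← frameDet_eq_det]
    simp
  -- the coordinate change of the flag
  set T : (Euc a × ℝ) × ℝ →ₗ[ℝ] (Euc a × ℝ) × ℝ := P.symm.toLinearEquiv.toLinearMap ∘ₗ
    frameMap v A ∘ₗ LinearMap.prodMap (frameMap (-w) B) (LinearMap.id : ℝ →ₗ[ℝ] ℝ)
  have hT1 : T (0, 1) = (0, 1) := by
    have : P.symm v = (0, 1) := by rw [← hP, P.symm_apply_apply]
    simp [T, frameMap_apply, this]
  have hT2 : LinearMap.fst ℝ (Euc a × ℝ) ℝ ∘ₗ T ∘ₗ LinearMap.inl ℝ (Euc a × ℝ) ℝ =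
      D.toLinearMap := by
    refine LinearMap.ext fun q => ?_
    simp [T, frameMap_apply, hD, sub_eq_add_neg]
  have hT : LinearMap.det T = LinearMap.det D.toLinearMap := by
    rw [det_of_map_inr (by rw [hT1]), hT1, hT2, mul_one]
  have h4 : Q.toLinearMap ∘ₗ (J'.toLinearMap ∘ₗ frameMap v A) ∘ₗ Q.symm.toLinearMap ∘ₗ
      LinearMap.prodMap (J.toLinearMap ∘ₗ frameMap (-w) B) (LinearMap.id : ℝ →ₗ[ℝ] ℝ) =
      (Q.toLinearMap ∘ₗ J'.toLinearMap ∘ₗ P.toLinearEquiv.toLinearMap) ∘ₗ T := by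
    refine LinearMap.ext fun q => ?_
    have : Q.symm ((LinearMap.prodMap (J.toLinearMap ∘ₗ frameMap (-w) B)
        (LinearMap.id : ℝ →ₗ[ℝ] ℝ)) q) =
        (LinearMap.prodMap (frameMap (-w) B) (LinearMap.id : ℝ →ₗ[ℝ] ℝ)) q := by
      rw [LinearEquiv.symm_apply_eq]
      simp [Q]
    simp only [LinearMap.comp_apply, LinearEquiv.coe_coe, this, T]
    simp
  have h5 : frameDet v A * frameDet (-w) B =
      flagDet P.toLinearEquiv.toLinearMap * LinearMap.det D.toLinearMap := by
    rw [h2, h3, ← LinearMap.det_comp, LinearMap.comp_assoc, LinearMap.comp_assoc, h4,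
      LinearMap.det_comp, hT]
    rfl
  rw [← h5, h1]
  ring

/-! ### Maps of a half-space that fix the bounding hyperplane -/

section HalfSpace

variable {E : Type*} [NormedAddCommGroup E] [NormedSpace ℝ E]

theorem convex_halfSpace_inter {s : Set (E × ℝ)} (hs : Convex ℝ s) (τ : ℝ) :
    Convex ℝ (s ∩ {q | 0 < τ * q.2}) := by
  refine hs.inter ?_
  have h := convex_halfSpace_gt (𝕜 := ℝ) (E := E × ℝ) (f := fun q => τ * q.2)
    ⟨fun p q => by simp [mul_add], fun c p => by simp; ring⟩ 0
  exact h

variable {y : E} {r : ℝ} {F : E × ℝ → E × ℝ}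

/-- An injective map of a half-ball that fixes the points of the bounding hyperplane maps the
interior of a smaller half-ball to one side of the hyperplane. -/
theorem exists_side (hr : 0 < r)
    (hc : ContinuousOn F (Metric.closedBall (y, 0) r ∩ {q | 0 ≤ q.2}))
    (hinj : InjOn F (Metric.closedBall (y, 0) r ∩ {q | 0 ≤ q.2}))
    (hflat : ∀ u, (u, (0 : ℝ)) ∈ Metric.closedBall (y, (0 : ℝ)) r → F (u, 0) = (u, 0)) :
    ∃ τ : ℤˣ, ∃ r', 0 < r' ∧ r' ≤ r ∧
      ∀ q ∈ Metric.closedBall (y, (0 : ℝ)) r', 0 < q.2 → 0 < ((τ : ℤ) : ℝ) * (F q).2 := by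
  have hp0 : (y, (0 : ℝ)) ∈ Metric.closedBall (y, (0 : ℝ)) r ∩ {q | 0 ≤ q.2} :=
    ⟨Metric.mem_closedBall_self hr.le, le_refl (0 : ℝ)⟩
  have hF0 : F (y, 0) = (y, 0) := hflat y hp0.1
  have h1 : F ⁻¹' Metric.closedBall (y, 0) r ∈
      𝓝[Metric.closedBall (y, (0 : ℝ)) r ∩ {q | 0 ≤ q.2}] (y, 0) := by
    refine hc _ hp0 ?_
    rw [hF0]
    exact Metric.closedBall_mem_nhds _ hr
  obtain ⟨ε, hε, hε'⟩ := Metric.mem_nhdsWithin_iff.1 h1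
  set r' := min (ε / 2) r
  have hr' : 0 < r' := lt_min (half_pos hε) hr
  have hsub : Metric.closedBall (y, (0 : ℝ)) r' ⊆ Metric.closedBall (y, 0) r :=
    Metric.closedBall_subset_closedBall (min_le_right _ _)
  have hsub' : Metric.closedBall (y, (0 : ℝ)) r' ⊆ Metric.ball (y, 0) ε :=
    Metric.closedBall_subset_ball (lt_of_le_of_lt (min_le_left _ _) (half_lt_self hε))
  have hne : ∀ q ∈ Metric.closedBall (y, (0 : ℝ)) r', 0 < q.2 → (F q).2 ≠ 0 := by
    intro q hq hq2 h0
    have hFq : F q ∈ Metric.closedBall (y, (0 : ℝ)) r := hε' ⟨hsub' hq, hsub hq, hq2.le⟩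
    have e : F q = ((F q).1, 0) := Prod.ext rfl h0
    have h2 := hflat (F q).1 (by rw [← e]; exact hFq)
    rw [← e] at h2
    have h3 := hinj ⟨hFq, h0.ge⟩ ⟨hsub hq, hq2.le⟩ h2
    rw [h3] at h0
    exact hq2.ne' h0
  set S := Metric.closedBall (y, (0 : ℝ)) r' ∩ {q | 0 < 1 * q.2}
  have hS : IsPreconnected S := (convex_halfSpace_inter (convex_closedBall _ _) 1).isPreconnected
  have hcS : ContinuousOn (fun q => (F q).2) S :=
    (continuous_snd.comp_continuousOn hc).mono fun q hq =>
      ⟨hsub hq.1, le_of_lt (by simpa using hq.2)⟩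
  have hq0 : (y, r') ∈ S := by
    refine ⟨?_, by simpa using hr'⟩
    simp [Prod.dist_eq, abs_of_pos hr', hr'.le]
  -- the sign of the last component of `F` cannot change
  have key : ∀ q ∈ S, ∀ q' ∈ S, 0 < (F q).2 → 0 < (F q').2 := by
    intro q hq q' hq' h
    by_contra! h'
    obtain ⟨p, hp, hp'⟩ := hS.intermediate_value hq' hq hcS ⟨h', h.le⟩
    exact hne p hp.1 (by simpa using hp.2) hp'
  rcases lt_or_gt_of_ne (hne _ hq0.1 hr') with h | h
  · refine ⟨-1, r', hr', min_le_right _ _, fun q hq hq2 => ?_⟩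
    have h2 : ¬ 0 < (F q).2 := fun h3 =>
      absurd (key q ⟨hq, by simpa using hq2⟩ _ hq0 h3) (not_lt.2 h.le)
    have := lt_of_le_of_ne (not_lt.1 h2) (hne q hq hq2)
    simpa using this
  · refine ⟨1, r', hr', min_le_right _ _, fun q hq hq2 => ?_⟩
    simpa using key _ hq0 q ⟨hq, by simpa using hq2⟩ h

variable [FiniteDimensional ℝ E] {τ : ℤˣ}

theorem units_coe_mul_self (τ : ℤˣ) : ((τ : ℤ) : ℝ) * ((τ : ℤ) : ℝ) = 1 := by
  rcases Int.units_eq_one_or τ with rfl | rfl <;> simp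

/-- If moreover the map is open on the interior, then it covers a half-ball on its side of the
hyperplane. -/
theorem exists_halfBall_subset_image (hr : 0 < r)
    (hc : ContinuousOn F (Metric.closedBall (y, 0) r ∩ {q | 0 ≤ q.2}))
    (hinj : InjOn F (Metric.closedBall (y, 0) r ∩ {q | 0 ≤ q.2}))
    (hflat : ∀ u, (u, (0 : ℝ)) ∈ Metric.closedBall (y, (0 : ℝ)) r → F (u, 0) = (u, 0))
    (hopen : ∀ q ∈ Metric.closedBall (y, (0 : ℝ)) r, 0 < q.2 → map F (𝓝 q) = 𝓝 (F q))
    (hτ : ∀ q ∈ Metric.closedBall (y, (0 : ℝ)) r, 0 < q.2 → 0 < ((τ : ℤ) : ℝ) * (F q).2) :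
    ∃ δ, 0 < δ ∧ ∀ P ∈ Metric.ball (y, (0 : ℝ)) δ, 0 < ((τ : ℤ) : ℝ) * P.2 →
      ∃ q ∈ Metric.ball (y, (0 : ℝ)) r, 0 < q.2 ∧ F q = P := by
  set H := Metric.closedBall (y, (0 : ℝ)) r ∩ {q | 0 ≤ q.2} with hH
  have hHc : IsCompact H :=
    (isCompact_closedBall _ _).inter_right (isClosed_le continuous_const continuous_snd)
  have hp0 : (y, (0 : ℝ)) ∈ H := ⟨Metric.mem_closedBall_self hr.le, le_refl (0 : ℝ)⟩
  have hF0 : F (y, 0) = (y, 0) := hflat y hp0.1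
  set K := Metric.sphere (y, (0 : ℝ)) r ∩ {q | 0 ≤ q.2}
  have hKH : K ⊆ H := fun q hq => ⟨Metric.sphere_subset_closedBall hq.1, hq.2⟩
  have hKc : IsCompact K :=
    (isCompact_sphere _ _).inter_right (isClosed_le continuous_const continuous_snd)
  have hp0K : (y, (0 : ℝ)) ∉ F '' K := by
    rintro ⟨q, hq, hq'⟩
    rw [← hF0] at hq'
    have := hinj (hKH hq) hp0 hq'
    rw [this] at hq
    have := hq.1
    rw [Metric.mem_sphere, dist_self] at this
    exact hr.ne this
  obtain ⟨δ, hδ, hδK⟩ := Metric.isOpen_iff.1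
    (hKc.image_of_continuousOn (hc.mono hKH)).isClosed.isOpen_compl _ hp0K
  refine ⟨δ, hδ, ?_⟩
  set O := F '' (Metric.ball (y, (0 : ℝ)) r ∩ {q | 0 < q.2}) with hO
  have hOo : IsOpen O := by
    rw [isOpen_iff_mem_nhds]
    rintro _ ⟨q, hq, rfl⟩
    rw [← hopen q (Metric.ball_subset_closedBall hq.1) hq.2]
    exact image_mem_map ((Metric.isOpen_ball.inter
      (isOpen_lt continuous_const continuous_snd)).mem_nhds hq)
  have hCc : IsClosed (F '' H) := (hHc.image_of_continuousOn hc).isClosed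
  have hOH : O ⊆ F '' H := image_mono fun q hq =>
    ⟨Metric.ball_subset_closedBall hq.1, (show 0 < q.2 from hq.2).le⟩
  have hsub : Metric.ball (y, (0 : ℝ)) δ ∩ {P | 0 < ((τ : ℤ) : ℝ) * P.2} ⊆ O := by
    refine IsPreconnected.subset_left_of_subset_union hOo hCc.isOpen_compl
      (disjoint_compl_right.mono_left hOH) ?_ ?_
      (convex_halfSpace_inter (convex_ball _ _) _).isPreconnected
    · rintro P ⟨hP, hP2⟩
      by_cases hPC : P ∈ F '' H
      · left
        obtain ⟨q, hq, rfl⟩ := hPC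
        have hq2 : 0 < q.2 := by
          refine lt_of_le_of_ne hq.2 fun h0 => ?_
          have e : q = (q.1, 0) := Prod.ext rfl h0.symm
          rw [e, mem_ofPred_eq, hflat q.1 (by rw [← e]; exact hq.1)] at hP2
          simp at hP2
        refine ⟨q, ⟨?_, hq2⟩, rfl⟩
        refine lt_of_le_of_ne (Metric.mem_closedBall.1 hq.1) fun h => ?_
        exact hδK hP ⟨q, ⟨h, hq.2⟩, rfl⟩
      · exact Or.inr hPC
    · have h1 : F ⁻¹' Metric.ball (y, 0) δ ∈ 𝓝[H] (y, 0) := by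
        refine hc _ hp0 ?_
        rw [hF0]
        exact Metric.ball_mem_nhds _ hδ
      obtain ⟨ε, hε, hε'⟩ := Metric.mem_nhdsWithin_iff.1 h1
      set t := min (ε / 2) (r / 2)
      have ht : 0 < t := lt_min (half_pos hε) (half_pos hr)
      have hd : dist (y, t) (y, (0 : ℝ)) = t := by simp [Prod.dist_eq, abs_of_pos ht, ht.le]
      have ht1 : t < ε := lt_of_le_of_lt (min_le_left _ _) (half_lt_self hε)
      have ht2 : t < r := lt_of_le_of_lt (min_le_right _ _) (half_lt_self hr)
      have hq1 : (y, t) ∈ Metric.ball (y, (0 : ℝ)) r := by rw [Metric.mem_ball, hd]; exact ht2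
      have hq2 : (y, t) ∈ Metric.ball (y, (0 : ℝ)) ε := by rw [Metric.mem_ball, hd]; exact ht1
      refine ⟨F (y, t), ⟨hε' ⟨hq2, Metric.ball_subset_closedBall hq1, ht.le⟩,
        hτ _ (Metric.ball_subset_closedBall hq1) ht⟩, (y, t), ⟨hq1, ht⟩, rfl⟩
  intro P hP hP2
  obtain ⟨q, hq, hq'⟩ := hsub ⟨hP, hP2⟩
  exact ⟨q, hq.1, hq.2, hq'⟩

/-- If moreover the map is differentiable in the interior, with derivatives that are invertible and
preserve the orientation of the directions parallel to the hyperplane, then it preserves the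
orientation of the whole space somewhere if and only if it preserves the side of the hyperplane.
The point is found on the preimage of the normal line at `(y, 0)`. -/
theorem exists_det_pos (hr : 0 < r)
    (hc : ContinuousOn F (Metric.closedBall (y, 0) r ∩ {q | 0 ≤ q.2}))
    (hinj : InjOn F (Metric.closedBall (y, 0) r ∩ {q | 0 ≤ q.2}))
    (hflat : ∀ u, (u, (0 : ℝ)) ∈ Metric.closedBall (y, (0 : ℝ)) r → F (u, 0) = (u, 0))
    {F' : E × ℝ → (E × ℝ →L[ℝ] E × ℝ)}
    (hd : ∀ q ∈ Metric.closedBall (y, (0 : ℝ)) r, 0 < q.2 → HasFDerivAt F (F' q) q)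
    (hopen : ∀ q ∈ Metric.closedBall (y, (0 : ℝ)) r, 0 < q.2 → map F (𝓝 q) = 𝓝 (F q))
    (hdet : ∀ q ∈ Metric.closedBall (y, (0 : ℝ)) r, 0 < q.2 →
      LinearMap.det (F' q).toLinearMap ≠ 0)
    (hM : ∀ q ∈ Metric.closedBall (y, (0 : ℝ)) r, 0 < q.2 → 0 < LinearMap.det
      (LinearMap.fst ℝ E ℝ ∘ₗ (F' q).toLinearMap ∘ₗ LinearMap.inl ℝ E ℝ))
    (hτ : ∀ q ∈ Metric.closedBall (y, (0 : ℝ)) r, 0 < q.2 → 0 < ((τ : ℤ) : ℝ) * (F q).2) :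
    ∃ q ∈ Metric.closedBall (y, (0 : ℝ)) r, 0 < q.2 ∧
      0 < ((τ : ℤ) : ℝ) * LinearMap.det (F' q).toLinearMap := by
  obtain ⟨δ, hδ, hcov⟩ := exists_halfBall_subset_image hr hc hinj hflat hopen hτ
  set D := Metric.ball (y, (0 : ℝ)) r ∩ {q | 0 < q.2} with hD
  have hDo : IsOpen D := Metric.isOpen_ball.inter (isOpen_lt continuous_const continuous_snd)
  have hDH : D ⊆ Metric.closedBall (y, 0) r ∩ {q | 0 ≤ q.2} := fun q hq =>
    ⟨Metric.ball_subset_closedBall hq.1, (show 0 < q.2 from hq.2).le⟩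
  set G := Function.invFunOn F D
  have hline : ∀ s ∈ Ioo 0 δ, (y, ((τ : ℤ) : ℝ) * s) ∈ F '' D := by
    intro s hs
    have h1 : |((τ : ℤ) : ℝ)| = 1 := by
      rcases Int.units_eq_one_or τ with h | h <;> simp [h]
    have h2 : (y, ((τ : ℤ) : ℝ) * s) ∈ Metric.ball (y, (0 : ℝ)) δ := by
      rw [Metric.mem_ball, Prod.dist_eq, dist_self, Real.dist_eq, sub_zero, abs_mul, h1, one_mul,
        abs_of_pos hs.1]
      exact max_lt hδ hs.2
    have h3 : 0 < ((τ : ℤ) : ℝ) * (((τ : ℤ) : ℝ) * s) := by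
      rw [← mul_assoc, units_coe_mul_self, one_mul]
      exact hs.1
    obtain ⟨q, hq1, hq2, hq3⟩ := hcov _ h2 h3
    exact ⟨q, ⟨hq1, hq2⟩, hq3⟩
  have hGmem : ∀ P ∈ F '' D, G P ∈ D := fun P hP => Function.invFunOn_mem hP
  have hGeq : ∀ P ∈ F '' D, F (G P) = P := fun P hP => Function.invFunOn_eq hP
  have hGleft : ∀ q ∈ D, G (F q) = q := fun q hq =>
    hinj (hDH (hGmem _ ⟨q, hq, rfl⟩)) (hDH hq) (hGeq _ ⟨q, hq, rfl⟩)
  have hDnhds : ∀ V ⊆ D, IsOpen V → ∀ q ∈ V, F '' V ∈ 𝓝 (F q) := by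
    intro V hV hVo q hq
    rw [← hopen q (hDH (hV hq)).1 (hV hq).2]
    exact image_mem_map (hVo.mem_nhds hq)
  -- the derivative of the inverse map
  have hGd : ∀ P ∈ F '' D, ∃ e : (E × ℝ) ≃L[ℝ] (E × ℝ),
      (e : E × ℝ →L[ℝ] E × ℝ) = F' (G P) ∧
        HasFDerivAt G (e.symm : E × ℝ →L[ℝ] E × ℝ) P := by
    intro P hP
    have hq := hGmem P hP
    let e : (E × ℝ) ≃L[ℝ] (E × ℝ) :=
      (LinearMap.equivOfDetNeZero _ (hdet _ (hDH hq).1 hq.2)).toContinuousLinearEquiv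
    have he : (e : E × ℝ →L[ℝ] E × ℝ) = F' (G P) := by
      exact ContinuousLinearMap.ext fun x => rfl
    refine ⟨e, he, HasFDerivAt.of_local_left_inverse (f := F) ?_ ?_ ?_⟩
    · intro V hV
      obtain ⟨V', hV'V, hV'o, hV'm⟩ := mem_nhds_iff.1 (inter_mem hV (hDo.mem_nhds hq))
      have h1 : F '' V' ∈ 𝓝 P := by
        have := hDnhds V' (fun x hx => (hV'V hx).2) hV'o _ hV'm
        rwa [hGeq P hP] at this
      rw [mem_map]
      refine mem_of_superset h1 ?_
      rintro _ ⟨q, hq, rfl⟩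
      rw [mem_preimage, hGleft q (hV'V hq).2]
      exact (hV'V hq).1
    · rw [he]
      exact hd _ (hDH hq).1 hq.2
    · have h1 : F '' D ∈ 𝓝 P := by
        have := hDnhds D subset_rfl hDo _ hq
        rwa [hGeq P hP] at this
      filter_upwards [h1] with P' hP' using hGeq P' hP'
  -- the last component along the normal line
  set g : ℝ → ℝ := fun s => (G (y, ((τ : ℤ) : ℝ) * s)).2
  have hgd : ∀ s ∈ Ioo 0 δ, ∃ e : (E × ℝ) ≃L[ℝ] (E × ℝ),
      (e : E × ℝ →L[ℝ] E × ℝ) = F' (G (y, ((τ : ℤ) : ℝ) * s)) ∧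
        HasDerivAt g (e.symm (0, ((τ : ℤ) : ℝ))).2 s := by
    intro s hs
    obtain ⟨e, he, hG⟩ := hGd _ (hline s hs)
    refine ⟨e, he, ?_⟩
    have h1 : HasDerivAt (fun s : ℝ => (y, ((τ : ℤ) : ℝ) * s)) (0, ((τ : ℤ) : ℝ)) s := by
      refine (hasDerivAt_const s y).prodMk ?_
      simpa using (hasDerivAt_id s).const_mul ((τ : ℤ) : ℝ)
    have h2 := hG.comp_hasDerivAt s h1
    exact (ContinuousLinearMap.snd ℝ E ℝ).hasFDerivAt.comp_hasDerivAt s h2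
  set s₁ := δ / 2
  have hs₁ : s₁ ∈ Ioo 0 δ := ⟨half_pos hδ, half_lt_self hδ⟩
  have hg₁ : 0 < g s₁ := (hGmem _ (hline s₁ hs₁)).2
  -- by properness, `g` takes smaller values near `0`
  obtain ⟨s₀, hs₀, hs₀₁, hg₀⟩ : ∃ s₀ ∈ Ioo 0 δ, s₀ < s₁ ∧ g s₀ < g s₁ := by
    set K := Metric.closedBall (y, (0 : ℝ)) r ∩ {q | g s₁ ≤ q.2}
    have hKH : K ⊆ Metric.closedBall (y, (0 : ℝ)) r ∩ {q | 0 ≤ q.2} :=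
      fun q hq => ⟨hq.1, hg₁.le.trans hq.2⟩
    have hKc : IsCompact K :=
      (isCompact_closedBall _ _).inter_right (isClosed_le continuous_const continuous_snd)
    have hp0 : (y, (0 : ℝ)) ∈ Metric.closedBall (y, (0 : ℝ)) r ∩ {q | 0 ≤ q.2} :=
      ⟨Metric.mem_closedBall_self hr.le, le_refl (0 : ℝ)⟩
    have hF0 : F (y, 0) = (y, 0) := hflat y hp0.1
    have hp0K : (y, (0 : ℝ)) ∉ F '' K := by
      rintro ⟨q, hq, hq'⟩
      rw [← hF0] at hq'
      have := hinj (hKH hq) hp0 hq'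
      rw [this] at hq
      exact absurd hq.2 (not_le.2 hg₁)
    have hopenK : IsOpen (F '' K)ᶜ := (hKc.image_of_continuousOn (hc.mono hKH)).isClosed.isOpen_compl
    have hcont : Continuous fun s : ℝ => (y, ((τ : ℤ) : ℝ) * s) := by fun_prop
    have h1 : ∀ᶠ s in 𝓝[>] (0 : ℝ), (y, ((τ : ℤ) : ℝ) * s) ∈ (F '' K)ᶜ := by
      refine nhdsWithin_le_nhds ((hcont.tendsto 0).eventually (hopenK.mem_nhds ?_))
      simpa using hp0K
    obtain ⟨s, hs, hs'⟩ := (h1.and (Ioo_mem_nhdsGT hs₁.1)).exists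
    have hsδ : s ∈ Ioo 0 δ := ⟨hs'.1, hs'.2.trans hs₁.2⟩
    refine ⟨s, hsδ, hs'.2, ?_⟩
    by_contra! h
    exact hs ⟨_, ⟨(hDH (hGmem _ (hline s hsδ))).1, h⟩, hGeq _ (hline s hsδ)⟩
  have hIcc : ∀ s ∈ Icc s₀ s₁, s ∈ Ioo 0 δ := fun s hs =>
    ⟨hs₀.1.trans_le hs.1, hs.2.trans_lt hs₁.2⟩
  choose! e he hge using hgd
  obtain ⟨s, hs, hslope⟩ := exists_hasDerivAt_eq_slope g
    (fun s => ((e s).symm (0, ((τ : ℤ) : ℝ))).2) hs₀₁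
    (fun s hs => (hge s (hIcc s hs)).continuousAt.continuousWithinAt)
    (fun s hs => hge s (hIcc s (Ioo_subset_Icc_self hs)))
  have hsδ := hIcc s (Ioo_subset_Icc_self hs)
  have hpos : 0 < ((e s).symm (0, ((τ : ℤ) : ℝ))).2 := by
    rw [hslope]
    exact div_pos (sub_pos.2 hg₀) (sub_pos.2 hs₀₁)
  set q := G (y, ((τ : ℤ) : ℝ) * s)
  have hq := hGmem _ (hline s hsδ)
  refine ⟨q, (hDH hq).1, hq.2, ?_⟩
  have hξ : (F' q).toLinearMap ((e s).symm (0, ((τ : ℤ) : ℝ))) = (0, ((τ : ℤ) : ℝ)) := by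
    have h1 : F' q = (e s : E × ℝ →L[ℝ] E × ℝ) := (he s hsδ).symm
    rw [h1]
    exact (e s).apply_symm_apply _
  have hcr := det_mul_snd_of_apply_eq hξ
  have h3 : 0 < (((τ : ℤ) : ℝ) * LinearMap.det (F' q).toLinearMap) *
      ((e s).symm (0, ((τ : ℤ) : ℝ))).2 := by
    rw [mul_assoc, hcr, mul_comm, mul_assoc, units_coe_mul_self, mul_one]
    exact hM q (hDH hq).1 hq.2
  exact pos_of_mul_pos_left h3 hpos.le

end HalfSpace

/-! ### Boundary orientations -/

open Classical in
/-- The sign of the boundary orientation of `X` in the coordinates `f : Z → ∂X`: it is `1` if `f`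
is orientation preserving at some point of `Z`. If `Z` is connected, then it does not matter at
which point (`IsBoundaryPiece.isPositiveAt_iff_boundarySign`). -/
def boundarySign {a b : ℕ} (X : Set (Euc b)) (f : Euc a → Euc b) (Z : Set (Euc a)) : ℤˣ :=
  if ∃ x ∈ Z, IsPositiveAt X f x then 1 else -1

/-- `f` immerses the open, preconnected set `Z` into the boundary of `X`. -/
structure IsBoundaryPiece {a b : ℕ} (Z : Set (Euc a)) (X : Set (Euc b)) (f : Euc a → Euc b) :
    Prop where
  isOpen : IsOpen Z
  isPreconnected : IsPreconnected Z
  contDiffOn : ContDiffOn ℝ ∞ f Z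
  injective_fderiv : ∀ x ∈ Z, Function.Injective (fderiv ℝ f x)
  mapsTo : MapsTo f Z (closure X \ X)

namespace IsBoundaryPiece

variable {a b : ℕ} {Z : Set (Euc a)} {X : Set (Euc b)} {f : Euc a → Euc b}
  (hf : IsBoundaryPiece Z X f) {x : Euc a}
include hf

theorem contDiffAt (hx : x ∈ Z) : ContDiffAt ℝ ∞ f x :=
  hf.contDiffOn.contDiffAt (hf.isOpen.mem_nhds hx)

theorem hasFDerivAt (hx : x ∈ Z) : HasFDerivAt f (fderiv ℝ f x) x :=
  ((hf.contDiffAt hx).differentiableAt (by simp)).hasFDerivAt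

theorem continuousAt_fderiv (hx : x ∈ Z) : ContinuousAt (fderiv ℝ f) x :=
  ((hf.contDiffAt hx).fderiv_right (m := 0) (by simp)).continuousAt

theorem fderiv_comp_eq_zero {U : Set (Euc b)} {ρ : Euc b → ℝ} (hU : IsOpen U)
    (hρ : ContDiffOn ℝ ∞ ρ U) (hX : X ∩ U = {x ∈ U | ρ x < 0}) (hx : x ∈ Z) (hxU : f x ∈ U)
    (u : Euc a) : fderiv ℝ ρ (f x) (fderiv ℝ f x u) = 0 := by
  have h1 : HasFDerivAt ρ (fderiv ℝ ρ (f x)) (f x) :=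
    ((hρ.contDiffAt (hU.mem_nhds hxU)).differentiableAt (by simp)).hasFDerivAt
  have h2 := h1.comp x (hf.hasFDerivAt hx)
  have h3 : (ρ ∘ f) =ᶠ[𝓝 x] fun _ => 0 := by
    filter_upwards [hf.isOpen.mem_nhds hx,
      (hf.contDiffAt hx).continuousAt.preimage_mem_nhds (hU.mem_nhds hxU)] with x' hx' hx'U
    exact eq_zero_of_mem_boundary (p := f x') hU hρ hX hx'U (hf.mapsTo hx')
  have h4 := h2.unique ((hasFDerivAt_const (0 : ℝ) x).congr_of_eventuallyEq h3)
  exact congrArg (fun L : Euc a →L[ℝ] ℝ => L u) h4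

theorem dim_lt (hX : IsReferenceDomain X) (hx : x ∈ Z) : a < b := by
  obtain ⟨U, ρ, hU, hpU, hρ, hd, hXU⟩ := hX.smooth_boundary _ (hf.mapsTo hx)
  have h0 := hf.fderiv_comp_eq_zero hU hρ hXU hx hpU
  have hle : Module.finrank ℝ (Euc a) ≤ Module.finrank ℝ (Euc b) :=
    LinearMap.finrank_le_finrank_of_injective (f := (fderiv ℝ f x).toLinearMap)
      (hf.injective_fderiv x hx)
  simp only [finrank_euclideanSpace, Fintype.card_fin] at hle
  refine lt_of_le_of_ne hle fun hab => hd ?_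
  subst hab
  have hs : Function.Surjective (fderiv ℝ f x) :=
    (LinearMap.injective_iff_surjective (f := (fderiv ℝ f x).toLinearMap)).1
      (hf.injective_fderiv x hx)
  ext1 w
  obtain ⟨u, rfl⟩ := hs w
  exact h0 u

end IsBoundaryPiece

section Sign

variable {a : ℕ} {Z : Set (Euc a)} {X U : Set (Euc (a + 1))} {f : Euc a → Euc (a + 1)}
  {ρ : Euc (a + 1) → ℝ} {x : Euc a} {v : Euc (a + 1)}

/-- The boundary orientation can be tested with any vector that is transversal to the boundary. -/
theorem IsBoundaryPiece.isPositiveAt_iff (hf : IsBoundaryPiece Z X f) (hU : IsOpen U)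
    (hρ : ContDiffOn ℝ ∞ ρ U) (hX : X ∩ U = {x ∈ U | ρ x < 0}) (hx : x ∈ Z) (hxU : f x ∈ U)
    (hv : 0 < fderiv ℝ ρ (f x) v) : IsPositiveAt X f x ↔ 0 < frameDet v (fderiv ℝ f x) := by
  constructor
  · rintro ⟨_, w, hw, hdet⟩
    have hdet' : 0 < frameDet w (fderiv ℝ f x) := hdet
    have hw0 := hw.fderiv_nonneg hU hρ hX hxU (hf.mapsTo hx)
    have h1 := frameDet_mul_comm v w (hf.injective_fderiv x hx) (fderiv ℝ ρ (f x))
      (hf.fderiv_comp_eq_zero hU hρ hX hx hxU) hv.ne'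
    have h2 : 0 < frameDet v (fderiv ℝ f x) * fderiv ℝ ρ (f x) w := by
      rw [← h1]
      exact mul_pos hdet' hv
    exact pos_of_mul_pos_left h2 hw0
  · intro h
    exact ⟨rfl, v, isOutward_of_fderiv_pos hU hρ hX hxU (hf.mapsTo hx) hv, h⟩

theorem IsBoundaryPiece.frameDet_ne_zero (hf : IsBoundaryPiece Z X f) (hU : IsOpen U)
    (hρ : ContDiffOn ℝ ∞ ρ U) (hX : X ∩ U = {x ∈ U | ρ x < 0}) (hx : x ∈ Z) (hxU : f x ∈ U)
    (hv : 0 < fderiv ℝ ρ (f x) v) : frameDet v (fderiv ℝ f x) ≠ 0 :=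
  MixedDim.frameDet_ne_zero (hf.injective_fderiv x hx) (fderiv ℝ ρ (f x))
    (hf.fderiv_comp_eq_zero hU hρ hX hx hxU) hv.ne'

theorem continuousAt_fderiv_apply {d : ℕ} {U : Set (Euc d)} {ρ : Euc d → ℝ} (hU : IsOpen U)
    (hρ : ContDiffOn ℝ ∞ ρ U) {p : Euc d} (hp : p ∈ U) (v : Euc d) :
    ContinuousAt (fun p => fderiv ℝ ρ p v) p := by
  have h1 : ContinuousAt (fderiv ℝ ρ) p :=
    ((hρ.contDiffAt (hU.mem_nhds hp)).fderiv_right (m := 0) (by simp)).continuousAt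
  exact (ContinuousLinearMap.apply ℝ ℝ v).continuous.continuousAt.comp h1

theorem exists_fderiv_pos {d : ℕ} {ρ : Euc d → ℝ} {p : Euc d} (h : fderiv ℝ ρ p ≠ 0) :
    ∃ v, 0 < fderiv ℝ ρ p v := by
  obtain ⟨w, hw⟩ : ∃ w, fderiv ℝ ρ p w ≠ 0 := by
    by_contra! h'
    exact h (ContinuousLinearMap.ext h')
  rcases lt_or_gt_of_ne hw with h' | h'
  · exact ⟨-w, by simpa using h'⟩
  · exact ⟨w, h'⟩

/-- Positivity of the boundary orientation is locally constant. -/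
theorem IsBoundaryPiece.eventually_isPositiveAt_iff (hX : IsReferenceDomain X)
    (hf : IsBoundaryPiece Z X f) (hx : x ∈ Z) :
    ∀ᶠ x' in 𝓝 x, IsPositiveAt X f x' ↔ IsPositiveAt X f x := by
  obtain ⟨U, ρ, hU, hpU, hρ, hd, hXU⟩ := hX.smooth_boundary _ (hf.mapsTo hx)
  obtain ⟨v, hv⟩ := exists_fderiv_pos hd
  have hfc := (hf.contDiffAt hx).continuousAt
  have h1 : ∀ᶠ x' in 𝓝 x, 0 < fderiv ℝ ρ (f x') v :=
    ((continuousAt_fderiv_apply hU hρ hpU v).comp hfc).eventually (lt_mem_nhds hv)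
  have h2 : ∀ᶠ x' in 𝓝 x, f x' ∈ U := hfc.eventually (hU.mem_nhds hpU)
  have h3 : ContinuousAt (fun x' => frameDet v (fderiv ℝ f x')) x :=
    (continuous_frameDet v).continuousAt.comp (hf.continuousAt_fderiv hx)
  have h0 := hf.isPositiveAt_iff hU hρ hXU hx hpU hv
  rcases lt_or_gt_of_ne (hf.frameDet_ne_zero hU hρ hXU hx hpU hv) with h | h
  · filter_upwards [h1, h2, hf.isOpen.mem_nhds hx, h3.eventually (gt_mem_nhds h)]
      with x' h1 h2 hx' h3
    rw [hf.isPositiveAt_iff hU hρ hXU hx' h2 h1, h0]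
    exact iff_of_false (not_lt.2 h3.le) (not_lt.2 h.le)
  · filter_upwards [h1, h2, hf.isOpen.mem_nhds hx, h3.eventually (lt_mem_nhds h)]
      with x' h1 h2 hx' h3
    rw [hf.isPositiveAt_iff hU hρ hXU hx' h2 h1, h0]
    exact iff_of_true h3 h

theorem IsBoundaryPiece.isPositiveAt_iff_boundarySign (hX : IsReferenceDomain X)
    (hf : IsBoundaryPiece Z X f) (hx : x ∈ Z) :
    IsPositiveAt X f x ↔ boundarySign X f Z = 1 := by
  have key : ∀ x₁ ∈ Z, IsPositiveAt X f x₁ → IsPositiveAt X f x := by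
    intro x₁ hx₁ h₁
    have hopen : ∀ p : Prop, IsOpen (Z ∩ {x' | IsPositiveAt X f x' ↔ p}) := by
      intro p
      rw [isOpen_iff_mem_nhds]
      rintro x' ⟨hx', hp⟩
      filter_upwards [hf.isOpen.mem_nhds hx', hf.eventually_isPositiveAt_iff hX hx']
        with x'' h h'
      exact ⟨h, h'.trans hp⟩
    have hsub := hf.isPreconnected.subset_left_of_subset_union (hopen True) (hopen False)
      (Set.disjoint_left.2 fun x' h h' => h'.2.1 (h.2.2 trivial))
      (fun x' hx' => by
        by_cases h : IsPositiveAt X f x'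
        · exact Or.inl ⟨hx', iff_of_true h trivial⟩
        · exact Or.inr ⟨hx', iff_of_false h id⟩)
      ⟨x₁, hx₁, hx₁, iff_of_true h₁ trivial⟩
    exact (hsub hx).2.2 trivial
  unfold boundarySign
  constructor
  · intro h
    rw [if_pos ⟨x, hx, h⟩]
  · intro h
    by_contra h'
    rw [if_neg] at h
    · exact absurd h (by decide)
    · rintro ⟨x₁, hx₁, h₁⟩
      exact h' (key x₁ hx₁ h₁)

/-- The boundary orientation is computed at any point and with any transversal vector. -/
theorem IsBoundaryPiece.boundarySign_mul_frameDet_pos (hXr : IsReferenceDomain X)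
    (hf : IsBoundaryPiece Z X f) (hU : IsOpen U)
    (hρ : ContDiffOn ℝ ∞ ρ U) (hX : X ∩ U = {x ∈ U | ρ x < 0}) (hx : x ∈ Z) (hxU : f x ∈ U)
    (hv : 0 < fderiv ℝ ρ (f x) v) :
    0 < ((boundarySign X f Z : ℤ) : ℝ) * frameDet v (fderiv ℝ f x) := by
  have h1 := hf.isPositiveAt_iff hU hρ hX hx hxU hv
  have h2 := hf.isPositiveAt_iff_boundarySign hXr hx
  have h3 := hf.frameDet_ne_zero hU hρ hX hx hxU hv
  rcases Int.units_eq_one_or (boundarySign X f Z) with h | h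
  · rw [h]
    simpa using h1.1 (h2.2 h)
  · have h4 : ¬ 0 < frameDet v (fderiv ℝ f x) := fun h5 => by
      have := h2.1 (h1.2 h5)
      rw [h] at this
      exact absurd this (by decide)
    rw [h]
    simpa using lt_of_le_of_ne (not_lt.1 h4) h3

end Sign

/-! ### Straightening the boundary -/

theorem strictMonoOn_line {d : ℕ} {U : Set (Euc d)} {ρ : Euc d → ℝ} (hU : IsOpen U)
    (hρ : ContDiffOn ℝ ∞ ρ U) {q v : Euc d} {t₀ t₁ : ℝ} (ht : t₀ < t₁)
    (hmem : ∀ t ∈ Icc t₀ t₁, q + t • v ∈ U)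
    (hpos : ∀ t ∈ Icc t₀ t₁, 0 < fderiv ℝ ρ (q + t • v) v) : ρ (q + t₀ • v) < ρ (q + t₁ • v) := by
  have hd : ∀ t ∈ Icc t₀ t₁, HasDerivAt (fun t : ℝ => ρ (q + t • v))
      (fderiv ℝ ρ (q + t • v) v) t := fun t h => hasDerivAt_comp_line hU hρ (hmem t h)
  obtain ⟨t, ht', h⟩ := exists_hasDerivAt_eq_slope (fun t : ℝ => ρ (q + t • v)) _ ht
    (fun t h => (hd t h).continuousAt.continuousWithinAt)
    (fun t h => hd t (Ioo_subset_Icc_self h))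
  have h1 := hpos t (Ioo_subset_Icc_self ht')
  rw [h, div_pos_iff_of_pos_right (sub_pos.2 ht)] at h1
  exact sub_pos.1 h1

section Straightening

variable {a : ℕ} {Z : Set (Euc a)} {X : Set (Euc (a + 1))} {f : Euc a → Euc (a + 1)}

theorem hasStrictFDerivAt_collar {b : ℕ} {f : Euc a → Euc b} {v : Euc b} {q : Euc a × ℝ}
    (hf : ContDiffAt ℝ ∞ f q.1) :
    HasStrictFDerivAt (fun q : Euc a × ℝ => f q.1 - q.2 • v)
      ((fderiv ℝ f q.1).coprod (ContinuousLinearMap.toSpanSingleton ℝ (-v))) q := by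
  have h1 : HasStrictFDerivAt f (fderiv ℝ f q.1) q.1 := hf.hasStrictFDerivAt (by simp)
  have h2 := h1.comp q (hasStrictFDerivAt_fst (𝕜 := ℝ) (E := Euc a) (F := ℝ) (p := q))
  have h3 := (hasStrictFDerivAt_snd (𝕜 := ℝ) (E := Euc a) (F := ℝ) (p := q)).smul_const v
  refine (h2.sub h3).congr_fderiv ?_
  ext w <;> simp

/-- Near a point `f y` of its boundary, the domain `X` is parametrized by a half-space: the map
`(u, t) ↦ f u - t v`, where `v` is transversal to the boundary, is a local diffeomorphism, which
maps exactly the half-space `t > 0` into `X`. -/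
theorem IsBoundaryPiece.exists_collar (hX : IsReferenceDomain X) (hf : IsBoundaryPiece Z X f)
    {y : Euc a} (hy : y ∈ Z) :
    ∃ (v : Euc (a + 1)) (r : ℝ), 0 < r ∧
      (∀ q ∈ Metric.closedBall (y, (0 : ℝ)) r, q.1 ∈ Z) ∧
      (∀ q ∈ Metric.closedBall (y, (0 : ℝ)) r, f q.1 - q.2 • v ∈ X ↔ 0 < q.2) ∧
      InjOn (fun q : Euc a × ℝ => f q.1 - q.2 • v) (Metric.closedBall (y, (0 : ℝ)) r) ∧
      (∀ r', 0 < r' → ∀ᶠ x in 𝓝 (f y), ∃ q ∈ Metric.closedBall (y, (0 : ℝ)) r',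
        f q.1 - q.2 • v = x) ∧
      (∀ q ∈ Metric.closedBall (y, (0 : ℝ)) r,
        0 < ((boundarySign X f Z : ℤ) : ℝ) * frameDet v (fderiv ℝ f q.1)) := by
  obtain ⟨U, ρ, hU, hpU, hρ, hd, hXU⟩ := hX.smooth_boundary _ (hf.mapsTo hy)
  obtain ⟨v, hv⟩ := exists_fderiv_pos hd
  have hfc := (hf.contDiffAt hy).continuousAt
  set Φ : Euc a × ℝ → Euc (a + 1) := fun q => f q.1 - q.2 • v
  have hΦy : Φ (y, 0) = f y := by simp [Φ]
  have hΦd : HasStrictFDerivAt Φ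
      ((fderiv ℝ f y).coprod (ContinuousLinearMap.toSpanSingleton ℝ (-v))) (y, 0) :=
    hasStrictFDerivAt_collar (q := (y, (0 : ℝ))) (hf.contDiffAt hy)
  have hΦc : ContinuousAt Φ (y, 0) := hΦd.continuousAt
  -- the derivative is invertible
  obtain ⟨L, hL⟩ : ∃ L : (Euc a × ℝ) ≃L[ℝ] Euc (a + 1), (L : Euc a × ℝ →L[ℝ] Euc (a + 1)) =
      (fderiv ℝ f y).coprod (ContinuousLinearMap.toSpanSingleton ℝ (-v)) := by
    set M := (fderiv ℝ f y).coprod (ContinuousLinearMap.toSpanSingleton ℝ (-v))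
    have hinj : Function.Injective M.toLinearMap := by
      rw [← LinearMap.ker_eq_bot, LinearMap.ker_eq_bot']
      intro q hq
      have hq' : fderiv ℝ f y q.1 + q.2 • (-v) = 0 := by simpa [M] using hq
      have h2 : q.2 = 0 := by
        have := congrArg (fderiv ℝ ρ (f y)) hq'
        simpa [hf.fderiv_comp_eq_zero hU hρ hXU hy hpU, hv.ne'] using this
      rw [h2, zero_smul, add_zero] at hq'
      exact Prod.ext (hf.injective_fderiv y hy (hq'.trans (map_zero _).symm)) h2
    refine ⟨(LinearEquiv.ofInjectiveOfFinrankEq M.toLinearMap hinj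
      (by simp)).toContinuousLinearEquiv, ?_⟩
    exact ContinuousLinearMap.ext fun x => rfl
  rw [← hL] at hΦd
  have h1 : ∀ᶠ q in 𝓝 (y, (0 : ℝ)), q.1 ∈ Z :=
    continuousAt_fst.eventually (hf.isOpen.mem_nhds hy)
  have h2 : ∀ᶠ q in 𝓝 (y, (0 : ℝ)), Φ q ∈ U := hΦc.eventually (by
    rw [hΦy]; exact hU.mem_nhds hpU)
  have h3 : ∀ᶠ q in 𝓝 (y, (0 : ℝ)), 0 < fderiv ℝ ρ (Φ q) v := by
    have hpU' : Φ (y, 0) ∈ U := by rw [hΦy]; exact hpU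
    refine ((continuousAt_fderiv_apply hU hρ hpU' v).comp hΦc).eventually (lt_mem_nhds ?_)
    simpa [hΦy] using hv
  have h4 : ∀ᶠ q in 𝓝 (y, (0 : ℝ)), q ∈ (hΦd.toOpenPartialHomeomorph Φ).source :=
    (hΦd.toOpenPartialHomeomorph Φ).open_source.mem_nhds
      hΦd.mem_toOpenPartialHomeomorph_source
  obtain ⟨ε, hε, hεs⟩ := Metric.mem_nhds_iff.1 (h1.and (h2.and (h3.and h4)))
  set r := ε / 2
  have hr : 0 < r := half_pos hε
  have hrs : ∀ q ∈ Metric.closedBall (y, (0 : ℝ)) r, q.1 ∈ Z ∧ Φ q ∈ U ∧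
      0 < fderiv ℝ ρ (Φ q) v ∧ q ∈ (hΦd.toOpenPartialHomeomorph Φ).source := fun q hq =>
    hεs (Metric.closedBall_subset_ball (half_lt_self hε) hq)
  -- the vertical segments that join the points of the ball to the hyperplane lie in the ball
  have hseg : ∀ q ∈ Metric.closedBall (y, (0 : ℝ)) r, ∀ t : ℝ, |t| ≤ |q.2| →
      (q.1, t) ∈ Metric.closedBall (y, (0 : ℝ)) r := by
    intro q hq t ht
    rw [Metric.mem_closedBall, Prod.dist_eq, max_le_iff] at hq ⊢
    refine ⟨hq.1, le_trans ?_ hq.2⟩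
    simpa [Real.dist_eq] using ht
  have hflat : ∀ q ∈ Metric.closedBall (y, (0 : ℝ)) r, f q.1 ∈ U ∧ ρ (f q.1) = 0 ∧
      0 < fderiv ℝ ρ (f q.1) v := by
    intro q hq
    have hq0 := hrs _ (hseg q hq 0 (by simp))
    have e : Φ (q.1, 0) = f q.1 := by simp [Φ]
    rw [e] at hq0
    exact ⟨hq0.2.1, eq_zero_of_mem_boundary hU hρ hXU hq0.2.1 (hf.mapsTo hq0.1), hq0.2.2.1⟩
  refine ⟨v, r, hr, fun q hq => (hrs q hq).1, fun q hq => ?_, fun q hq q' hq' h => ?_,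
    fun r' hr' => ?_, fun q hq => ?_⟩
  · have hX' : Φ q ∈ X ↔ ρ (Φ q) < 0 := by
      have : Φ q ∈ X ∩ U ↔ Φ q ∈ {x ∈ U | ρ x < 0} := by rw [hXU]
      constructor
      · exact fun h => (this.1 ⟨h, (hrs q hq).2.1⟩).2
      · exact fun h => (this.2 ⟨(hrs q hq).2.1, h⟩).1
    have hline : ∀ t : ℝ, Φ (q.1, t) = f q.1 + (-t) • v := fun t => by
      simp [Φ, sub_eq_add_neg]
    have hmono : ∀ t₀ t₁ : ℝ, t₀ < t₁ → |t₀| ≤ |q.2| → |t₁| ≤ |q.2| →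
        ρ (f q.1 + t₀ • v) < ρ (f q.1 + t₁ • v) := by
      intro t₀ t₁ h01 h0 h1
      have hb : ∀ t ∈ Icc t₀ t₁, |-t| ≤ |q.2| := by
        intro t ht
        rw [abs_neg]
        rw [abs_le] at h0 h1 ⊢
        exact ⟨h0.1.trans ht.1, ht.2.trans h1.2⟩
      refine strictMonoOn_line hU hρ h01 (fun t ht => ?_) (fun t ht => ?_)
      · have := (hrs _ (hseg q hq (-t) (hb t ht))).2.1
        rwa [hline, neg_neg] at this
      · have := (hrs _ (hseg q hq (-t) (hb t ht))).2.2.1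
        rwa [hline, neg_neg] at this
    have hq' : Φ q = f q.1 + (-q.2) • v := hline q.2
    have h0 : ρ (f q.1 + (0 : ℝ) • v) = 0 := by
      simpa using (hflat q hq).2.1
    change Φ q ∈ X ↔ _
    rw [hX', hq']
    constructor
    · intro h
      by_contra! hle
      rcases hle.lt_or_eq with hlt | heq
      · have := hmono 0 (-q.2) (by linarith) (by simp) (by simp)
        rw [h0] at this
        exact absurd h (not_lt.2 this.le)
      · rw [heq, neg_zero, h0] at h
        exact lt_irrefl _ h
    · intro h
      have := hmono (-q.2) 0 (by linarith) (by simp) (by simp)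
      rwa [h0] at this
  · exact (hΦd.toOpenPartialHomeomorph Φ).injOn (hrs q hq).2.2.2 (hrs q' hq').2.2.2 h
  · have := hΦd.map_nhds_eq_of_equiv
    rw [hΦy] at this
    rw [← this]
    exact mem_of_superset (image_mem_map (Metric.closedBall_mem_nhds _ hr'))
      fun x ⟨q, hq, h⟩ => ⟨q, hq, h⟩
  · have h := hflat q hq
    exact hf.boundarySign_mul_frameDet_pos hX hU hρ hXU (hrs q hq).1 h.1 h.2.2

end Straightening

/-! ### Boundary charts adapted to a submanifold of codimension one in the boundary -/

/-- Coordinates `κ` on the boundary of `X` near the point `h y`, where `h` parametrizes a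
submanifold of codimension one in the boundary. The submanifold is the hyperplane on which the
last coordinate vanishes. The coordinates extend to an open set `V` of the ambient space, on which
they are constant along the direction `v`, transversal to the boundary; `P` is the inverse of the
derivative of the ambient coordinates, `ε` the sign of its determinant, and `ρ` is a defining
function of the boundary. -/
structure BoundaryChart {a : ℕ} (X : Set (Euc (a + 1 + 1))) (h : Euc a → Euc (a + 1 + 1))
    (y : Euc a) where
  /-- the coordinates on the boundary, as functions on the ambient space -/
  κ : Euc (a + 1 + 1) → Euc a × ℝ
  V : Set (Euc (a + 1 + 1))
  ρ : Euc (a + 1 + 1) → ℝ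
  v : Euc (a + 1 + 1)
  P : Euc (a + 1 + 1) → ((Euc a × ℝ) × ℝ) ≃L[ℝ] Euc (a + 1 + 1)
  ε : ℤˣ
  isOpen_V : IsOpen V
  mem_V : h y ∈ V
  contDiffOn_ρ : ContDiffOn ℝ ∞ ρ V
  inter_V : X ∩ V = {x ∈ V | ρ x < 0}
  fderiv_ρ_pos : ∀ x ∈ V, 0 < fderiv ℝ ρ x v
  contDiffOn : ContDiffOn ℝ ∞ κ V
  fderiv_eq : ∀ x ∈ V, ∀ w, fderiv ℝ κ x w = ((P x).symm w).1
  P_inr : ∀ x ∈ V, P x (0, 1) = v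
  sign : ∀ x ∈ V, 0 < ((ε : ℤ) : ℝ) * flagDet (P x).toLinearEquiv.toLinearMap
  injOn : InjOn κ (V ∩ (closure X \ X))
  /-- the coordinates of the points of the submanifold -/
  flat : ∀ᶠ u in 𝓝 y, κ (h u) = (u, 0)
  /-- all values near `(y, 0)` are coordinates of boundary points near `h y` -/
  surj : ∀ V' ∈ 𝓝 (h y), ∀ᶠ w in 𝓝 (y, (0 : ℝ)), ∃ x ∈ V' ∩ (closure X \ X), κ x = w

theorem injective_of_flagDet_ne_zero {a : ℕ} {P : (Euc a × ℝ) × ℝ →ₗ[ℝ] Euc (a + 1 + 1)}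
    (hP : flagDet P ≠ 0) : Function.Injective P := by
  have h1 : Function.Injective (((splitFirst a).prodCongr (LinearEquiv.refl ℝ ℝ)).toLinearMap ∘ₗ
      (splitFirst (a + 1)).toLinearMap ∘ₗ P) := by
    rw [← LinearMap.ker_eq_bot]
    by_contra h
    exact hP (LinearMap.det_eq_zero_iff_ker_ne_bot.2 h)
  intro x y hxy
  refine h1 ?_
  simp [hxy]

theorem exists_unit_mul_pos {x : ℝ} (hx : x ≠ 0) : ∃ ε : ℤˣ, 0 < ((ε : ℤ) : ℝ) * x := by
  rcases lt_or_gt_of_ne hx with h | h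
  · exact ⟨-1, by simpa using h⟩
  · exact ⟨1, by simpa using h⟩

section FlagMap

variable {a b : ℕ} {h : Euc a → Euc b}

/-- Coordinates around the image of `h`, with two additional directions `n` and `v`. -/
def flagMap (h : Euc a → Euc b) (n v : Euc b) (q : (Euc a × ℝ) × ℝ) : Euc b :=
  h q.1.1 + q.1.2 • n + q.2 • v

theorem contDiffAt_flagMap {n v : Euc b} {q : (Euc a × ℝ) × ℝ} (hq : ContDiffAt ℝ ∞ h q.1.1) :
    ContDiffAt ℝ ∞ (flagMap h n v) q := by
  have h1 : ContDiffAt ℝ ∞ (fun q : (Euc a × ℝ) × ℝ => h q.1.1) q :=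
    hq.comp q (f := fun q : (Euc a × ℝ) × ℝ => q.1.1) (by fun_prop)
  exact (h1.add (by fun_prop)).add (by fun_prop)

theorem fderiv_flagMap {n v : Euc b} {q : (Euc a × ℝ) × ℝ} (hq : DifferentiableAt ℝ h q.1.1)
    (w : (Euc a × ℝ) × ℝ) : fderiv ℝ (flagMap h n v) q w =
      fderiv ℝ h q.1.1 w.1.1 + w.1.2 • n + w.2 • v := by
  have h1 : HasFDerivAt (fun q : (Euc a × ℝ) × ℝ => h q.1.1) ((fderiv ℝ h q.1.1).comp
      ((ContinuousLinearMap.fst ℝ (Euc a) ℝ).comp (ContinuousLinearMap.fst ℝ (Euc a × ℝ) ℝ)))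
      q := HasFDerivAt.comp q (f := fun q : (Euc a × ℝ) × ℝ => q.1.1) hq.hasFDerivAt
        (((ContinuousLinearMap.fst ℝ (Euc a) ℝ).comp
          (ContinuousLinearMap.fst ℝ (Euc a × ℝ) ℝ)).hasFDerivAt)
  have h2 : HasFDerivAt (fun q : (Euc a × ℝ) × ℝ => q.1.2 • n)
      (((ContinuousLinearMap.snd ℝ (Euc a) ℝ).comp
        (ContinuousLinearMap.fst ℝ (Euc a × ℝ) ℝ)).smulRight n) q :=
    (((ContinuousLinearMap.snd ℝ (Euc a) ℝ).comp
        (ContinuousLinearMap.fst ℝ (Euc a × ℝ) ℝ)).smulRight n).hasFDerivAt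
  have h3 : HasFDerivAt (fun q : (Euc a × ℝ) × ℝ => q.2 • v)
      ((ContinuousLinearMap.snd ℝ (Euc a × ℝ) ℝ).smulRight v) q :=
    ((ContinuousLinearMap.snd ℝ (Euc a × ℝ) ℝ).smulRight v).hasFDerivAt
  have h4 : HasFDerivAt (flagMap h n v) _ q := (h1.add h2).add h3
  rw [h4.fderiv]
  simp

end FlagMap

set_option maxHeartbeats 800000 in
/-- The coordinates are obtained by inverting `((u, s), r) ↦ h u + s n + r v`, where `v` is
transversal to the boundary and `n` is transversal to the span of `v` and the submanifold. -/
theorem IsBoundaryPiece.nonempty_boundaryChart {a : ℕ} {X : Set (Euc (a + 1 + 1))}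
    {h : Euc a → Euc (a + 1 + 1)} {Z : Set (Euc a)} (hX : IsReferenceDomain X)
    (hh : IsBoundaryPiece Z X h) {y : Euc a} (hy : y ∈ Z) : Nonempty (BoundaryChart X h y) := by
  obtain ⟨U, ρ, hU, hpU, hρ, hd, hXU⟩ := hX.smooth_boundary _ (hh.mapsTo hy)
  obtain ⟨v, hv⟩ := exists_fderiv_pos hd
  -- a direction that is transversal to the span of `v` and the submanifold
  obtain ⟨n, hn⟩ : ∃ n, n ∉ LinearMap.range (frameMap v (fderiv ℝ h y)) := by
    by_contra! hall
    have h1 : LinearMap.range (frameMap v (fderiv ℝ h y)) = ⊤ :=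
      Submodule.eq_top_iff'.2 hall
    have h2 := LinearMap.finrank_range_le (frameMap v (fderiv ℝ h y))
    rw [h1] at h2
    simp at h2
  set Φ : (Euc a × ℝ) × ℝ → Euc (a + 1 + 1) := flagMap h n v
  set q₀ : (Euc a × ℝ) × ℝ := ((y, 0), 0)
  have hΦ0 : Φ q₀ = h y := by simp [Φ, q₀, flagMap]
  have hΦs : ∀ q : (Euc a × ℝ) × ℝ, q.1.1 ∈ Z → ContDiffAt ℝ ∞ Φ q := fun q hq =>
    contDiffAt_flagMap (hh.contDiffAt hq)
  have hΦd : ∀ q : (Euc a × ℝ) × ℝ, q.1.1 ∈ Z → ∀ w, fderiv ℝ Φ q w =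
      fderiv ℝ h q.1.1 w.1.1 + w.1.2 • n + w.2 • v := fun q hq w =>
    fderiv_flagMap (hh.hasFDerivAt hq).differentiableAt w
  have hΦc : ContinuousAt Φ q₀ := (hΦs q₀ hy).continuousAt
  have hinj₀ : Function.Injective (fderiv ℝ Φ q₀).toLinearMap := by
    rw [← LinearMap.ker_eq_bot, LinearMap.ker_eq_bot']
    intro w hw
    have hw' : fderiv ℝ h y w.1.1 + w.1.2 • n + w.2 • v = 0 := by
      rw [← hΦd q₀ hy]
      exact hw
    have h1 : w.1.2 = 0 := by
      by_contra h0
      refine hn ⟨(-w.1.2⁻¹) • (w.1.1, w.2), ?_⟩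
      rw [map_smul, frameMap_apply]
      have : fderiv ℝ h y w.1.1 + w.2 • v = -(w.1.2 • n) := by
        rw [eq_neg_iff_add_eq_zero, ← hw']
        abel
      rw [this, smul_neg, neg_smul, neg_neg, smul_smul, inv_mul_cancel₀ h0, one_smul]
    rw [h1, zero_smul, add_zero] at hw'
    have h2 : w.2 = 0 := by
      have := congrArg (fderiv ℝ ρ (h y)) hw'
      simpa [hh.fderiv_comp_eq_zero hU hρ hXU hy hpU, hv.ne'] using this
    rw [h2, zero_smul, add_zero] at hw'
    exact Prod.ext (Prod.ext (hh.injective_fderiv y hy (hw'.trans (map_zero _).symm)) h1) h2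
  have hequiv : ∀ q, Function.Injective (fderiv ℝ Φ q).toLinearMap →
      ∃ P : ((Euc a × ℝ) × ℝ) ≃L[ℝ] Euc (a + 1 + 1),
        (P : (Euc a × ℝ) × ℝ →L[ℝ] Euc (a + 1 + 1)) = fderiv ℝ Φ q := by
    intro q hq
    refine ⟨(LinearEquiv.ofInjectiveOfFinrankEq _ hq (by simp)).toContinuousLinearEquiv, ?_⟩
    exact ContinuousLinearMap.ext fun x => rfl
  obtain ⟨P₀, hP₀⟩ := hequiv q₀ hinj₀
  have hΦd₀ : HasFDerivAt Φ (P₀ : (Euc a × ℝ) × ℝ →L[ℝ] Euc (a + 1 + 1)) q₀ := by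
    rw [hP₀]
    exact ((hΦs q₀ hy).differentiableAt (by simp)).hasFDerivAt
  obtain ⟨e, he, hq₀e⟩ : ∃ e : OpenPartialHomeomorph ((Euc a × ℝ) × ℝ) (Euc (a + 1 + 1)),
      (e : (Euc a × ℝ) × ℝ → Euc (a + 1 + 1)) = Φ ∧ q₀ ∈ e.source :=
    ⟨(hΦs q₀ hy).toOpenPartialHomeomorph Φ hΦd₀ (by simp), rfl,
      (hΦs q₀ hy).mem_toOpenPartialHomeomorph_source hΦd₀ (by simp)⟩
  -- the sign of the determinant of the derivative
  have hdet₀ : flagDet (fderiv ℝ Φ q₀).toLinearMap ≠ 0 := by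
    rw [← hP₀]
    exact flagDet_ne_zero P₀
  obtain ⟨ε, hε⟩ := exists_unit_mul_pos hdet₀
  have h1 : ∀ᶠ q in 𝓝 q₀, q.1.1 ∈ Z :=
    (continuous_fst.comp continuous_fst).continuousAt.eventually (hh.isOpen.mem_nhds hy)
  have h2 : ∀ᶠ q in 𝓝 q₀, Φ q ∈ U := hΦc.eventually (by rw [hΦ0]; exact hU.mem_nhds hpU)
  have h3 : ∀ᶠ q in 𝓝 q₀, 0 < fderiv ℝ ρ (Φ q) v := by
    have hpU' : Φ q₀ ∈ U := by rw [hΦ0]; exact hpU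
    refine ((continuousAt_fderiv_apply hU hρ hpU' v).comp hΦc).eventually (lt_mem_nhds ?_)
    simpa [hΦ0] using hv
  have h4 : ∀ᶠ q in 𝓝 q₀, 0 < ((ε : ℤ) : ℝ) * flagDet (fderiv ℝ Φ q).toLinearMap := by
    have hc : ContinuousAt (fderiv ℝ Φ) q₀ :=
      ((hΦs q₀ hy).fderiv_right (m := 0) (by simp)).continuousAt
    have hc' : ContinuousAt (fun q => ((ε : ℤ) : ℝ) * flagDet (fderiv ℝ Φ q).toLinearMap) q₀ :=
      continuousAt_const.mul
        (ContinuousAt.comp (f := fderiv ℝ Φ) continuous_flagDet.continuousAt hc)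
    exact hc'.eventually (lt_mem_nhds hε)
  have h5 : ∀ᶠ q in 𝓝 q₀, q ∈ e.source := e.open_source.mem_nhds hq₀e
  obtain ⟨r, hr, hrs⟩ := Metric.mem_nhds_iff.1 (h1.and (h2.and (h3.and (h4.and h5))))
  have hB : ∀ q ∈ Metric.ball q₀ r, q.1.1 ∈ Z ∧ Φ q ∈ U ∧ 0 < fderiv ℝ ρ (Φ q) v ∧
      0 < ((ε : ℤ) : ℝ) * flagDet (fderiv ℝ Φ q).toLinearMap ∧ q ∈ e.source := fun q hq => hrs hq
  have hball : ∀ (w : Euc a × ℝ) (t : ℝ), (w, t) ∈ Metric.ball q₀ r ↔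
      dist w (y, 0) < r ∧ |t| < r := by
    intro w t
    rw [Metric.mem_ball, Prod.dist_eq, max_lt_iff, Real.dist_eq, sub_zero]
  set V := e.symm.source ∩ e.symm ⁻¹' Metric.ball q₀ r
  have hVo : IsOpen V := e.symm.isOpen_inter_preimage Metric.isOpen_ball
  have hVmem : ∀ q ∈ Metric.ball q₀ r, Φ q ∈ V ∧ e.symm (Φ q) = q := by
    intro q hq
    have h6 : e.symm (Φ q) = q := by
      rw [← he]
      exact e.left_inv (hB q hq).2.2.2.2
    have h7 : Φ q ∈ e.target := by
      rw [← he]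
      exact e.map_source (hB q hq).2.2.2.2
    refine ⟨⟨h7, ?_⟩, h6⟩
    rw [mem_preimage, h6]
    exact hq
  have hVex : ∀ x ∈ V, e.symm x ∈ Metric.ball q₀ r ∧ Φ (e.symm x) = x := fun x hx =>
    ⟨hx.2, by rw [← he]; exact e.right_inv hx.1⟩
  have hVU : V ⊆ U := fun x hx => by
    rw [← (hVex x hx).2]
    exact (hB _ (hVex x hx).1).2.1
  have hP : ∀ x, ∃ P : ((Euc a × ℝ) × ℝ) ≃L[ℝ] Euc (a + 1 + 1), x ∈ V →
      (P : (Euc a × ℝ) × ℝ →L[ℝ] Euc (a + 1 + 1)) = fderiv ℝ Φ (e.symm x) := by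
    intro x
    by_cases hx : x ∈ V
    · obtain ⟨P, hP⟩ := hequiv (e.symm x) (injective_of_flagDet_ne_zero
        (fun h0 => by
          have := (hB _ (hVex x hx).1).2.2.2.1
          rw [h0, mul_zero] at this
          exact lt_irrefl _ this))
      exact ⟨P, fun _ => hP⟩
    · exact ⟨P₀, fun h => absurd h hx⟩
  choose P hP using hP
  have hPd : ∀ x ∈ V, HasFDerivAt e (P x : (Euc a × ℝ) × ℝ →L[ℝ] Euc (a + 1 + 1)) (e.symm x) := by
    intro x hx
    rw [hP x hx, he]
    exact ((hΦs _ (hB _ (hVex x hx).1).1).differentiableAt (by simp)).hasFDerivAt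
  have hesymm : ∀ x ∈ V, ContDiffAt ℝ ∞ e.symm x := fun x hx =>
    e.contDiffAt_symm hx.1 (hPd x hx) (by rw [he]; exact hΦs _ (hB _ (hVex x hx).1).1)
  have hesymm' : ∀ x ∈ V, HasFDerivAt e.symm ((P x).symm : Euc (a + 1 + 1) →L[ℝ] _) x :=
    fun x hx => e.hasFDerivAt_symm hx.1 (hPd x hx)
  have hρV : ContDiffOn ℝ ∞ ρ V := hρ.mono hVU
  have hXV : X ∩ V = {x ∈ V | ρ x < 0} := by
    ext x
    constructor
    · rintro ⟨hx, hxV⟩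
      have : x ∈ X ∩ U := ⟨hx, hVU hxV⟩
      rw [hXU] at this
      exact ⟨hxV, this.2⟩
    · rintro ⟨hxV, hx⟩
      have : x ∈ X ∩ U := by rw [hXU]; exact ⟨hVU hxV, hx⟩
      exact ⟨this.1, hxV⟩
  have hρpos : ∀ x ∈ V, 0 < fderiv ℝ ρ x v := fun x hx => by
    have := (hB _ (hVex x hx).1).2.2.1
    rwa [(hVex x hx).2] at this
  -- the defining function increases along the lines in direction `v`
  have hmono : ∀ (w : Euc a × ℝ) (t₀ t₁ : ℝ), dist w (y, 0) < r → |t₀| < r → |t₁| < r → t₀ < t₁ →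
      ρ (Φ (w, t₀)) < ρ (Φ (w, t₁)) := by
    intro w t₀ t₁ hw h0 h1 h01
    have hb : ∀ t ∈ Icc t₀ t₁, (w, t) ∈ Metric.ball q₀ r := by
      intro t ht
      rw [hball]
      rw [abs_lt] at h0 h1 ⊢
      exact ⟨hw, h0.1.trans_le ht.1, ht.2.trans_lt h1.2⟩
    exact strictMonoOn_line hU hρ h01 (fun t ht => (hB _ (hb t ht)).2.1)
      (fun t ht => (hB _ (hb t ht)).2.2.1)
  have hρ0 : ρ (Φ q₀) = 0 := by
    rw [hΦ0]
    exact eq_zero_of_mem_boundary hU hρ hXU hpU (hh.mapsTo hy)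
  refine ⟨{
    κ := fun x => (e.symm x).1
    V := V
    ρ := ρ
    v := v
    P := P
    ε := ε
    isOpen_V := hVo
    mem_V := by
      rw [← hΦ0]
      exact (hVmem q₀ (Metric.mem_ball_self hr)).1
    contDiffOn_ρ := hρV
    inter_V := hXV
    fderiv_ρ_pos := hρpos
    contDiffOn := fun x hx => (contDiffAt_fst.comp x (hesymm x hx)).contDiffWithinAt
    fderiv_eq := fun x hx w => ?_
    P_inr := fun x hx => ?_
    sign := fun x hx => ?_
    injOn := ?_
    flat := ?_
    surj := ?_ }⟩
  · have h6 : HasFDerivAt (fun x => (e.symm x).1) _ x :=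
      (ContinuousLinearMap.fst ℝ (Euc a × ℝ) ℝ).hasFDerivAt.comp x (hesymm' x hx)
    rw [h6.fderiv]
    rfl
  · have h6 : P x (0, 1) = (P x : (Euc a × ℝ) × ℝ →L[ℝ] Euc (a + 1 + 1)) (0, 1) := rfl
    rw [h6, hP x hx, hΦd _ (hB _ (hVex x hx).1).1]
    simp
  · have := (hB _ (hVex x hx).1).2.2.2.1
    rw [← hP x hx] at this
    exact this
  · rintro x ⟨hx, hxX⟩ x' ⟨hx', hxX'⟩ hxx'
    have hz := eq_zero_of_mem_boundary hVo hρV hXV hx hxX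
    have hz' := eq_zero_of_mem_boundary hVo hρV hXV hx' hxX'
    have hxx' : (e.symm x).1 = (e.symm x').1 := hxx'
    have hb : dist (e.symm x).1 (y, 0) < r ∧ |(e.symm x).2| < r :=
      (hball (e.symm x).1 (e.symm x).2).1 (hVex x hx).1
    have hb' : dist (e.symm x').1 (y, 0) < r ∧ |(e.symm x').2| < r :=
      (hball (e.symm x').1 (e.symm x').2).1 (hVex x' hx').1
    have e1 : x = Φ ((e.symm x).1, (e.symm x).2) := (hVex x hx).2.symm
    have e2 : x' = Φ ((e.symm x).1, (e.symm x').2) := by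
      rw [hxx']
      exact (hVex x' hx').2.symm
    rcases lt_trichotomy (e.symm x).2 (e.symm x').2 with hlt | heq | hgt
    · have := hmono (e.symm x).1 (e.symm x).2 (e.symm x').2 hb.1 hb.2 hb'.2 hlt
      rw [← e1, ← e2, hz, hz'] at this
      exact absurd this (lt_irrefl _)
    · rw [heq] at e1
      exact e1.trans e2.symm
    · have := hmono (e.symm x).1 (e.symm x').2 (e.symm x).2 hb.1 hb'.2 hb.2 hgt
      rw [← e1, ← e2, hz, hz'] at this
      exact absurd this (lt_irrefl _)
  · have hc : Continuous fun u : Euc a => ((u, (0 : ℝ)), (0 : ℝ)) := by fun_prop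
    have h6 : ∀ᶠ u in 𝓝 y, ((u, (0 : ℝ)), (0 : ℝ)) ∈ Metric.ball q₀ r :=
      hc.continuousAt.eventually (Metric.ball_mem_nhds q₀ hr)
    filter_upwards [h6] with u hu
    have h7 := (hVmem _ hu).2
    have h8 : Φ ((u, 0), 0) = h u := by simp [Φ, flagMap]
    rw [h8] at h7
    rw [h7]
  · intro V' hV'
    have hV'' : Φ ⁻¹' V' ∩ Metric.ball q₀ r ∈ 𝓝 q₀ := by
      refine inter_mem (hΦc ?_) (Metric.ball_mem_nhds q₀ hr)
      rw [hΦ0]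
      exact hV'
    obtain ⟨δ, hδ, hδs⟩ := Metric.mem_nhds_iff.1 hV''
    set η := δ / 2
    have hη : 0 < η := half_pos hδ
    have hηδ : η < δ := half_lt_self hδ
    have hq₀η : ∀ t, |t| ≤ η → ((y, (0 : ℝ)), t) ∈ Metric.ball q₀ δ := by
      intro t ht
      rw [Metric.mem_ball, Prod.dist_eq, dist_self, Real.dist_eq, sub_zero]
      exact max_lt hδ (ht.trans_lt hηδ)
    have hηr : ∀ t, |t| ≤ η → |t| < r := fun t ht =>
      ((hball _ _).1 (hδs (hq₀η t ht)).2).2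
    have hc : ∀ t, |t| ≤ η → ContinuousAt (fun w : Euc a × ℝ => ρ (Φ (w, t))) (y, 0) := by
      intro t ht
      have hb := (hδs (hq₀η t ht)).2
      have h6 : ContinuousAt Φ ((y, 0), t) := (hΦs _ (hB _ hb).1).continuousAt
      have h7 : ContinuousAt ρ (Φ ((y, 0), t)) :=
        hρ.continuousOn.continuousAt (hU.mem_nhds (hB _ hb).2.1)
      exact (ContinuousAt.comp (f := Φ) h7 h6).comp
        (f := fun w : Euc a × ℝ => (w, t)) (by fun_prop)
    have hy0 : dist (y, (0 : ℝ)) (y, 0) < r := by simpa using hr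
    have hp : 0 < ρ (Φ ((y, 0), η)) := by
      have := hmono (y, 0) 0 η hy0 (by simpa using hr) (hηr η (abs_of_pos hη).le) hη
      exact hρ0.symm.le.trans_lt this
    have hm : ρ (Φ ((y, 0), -η)) < 0 := by
      have := hmono (y, 0) (-η) 0 hy0 (hηr _ (by rw [abs_neg, abs_of_pos hη]))
        (by simpa using hr) (neg_neg_of_pos hη)
      exact this.trans_eq hρ0
    filter_upwards [(hc η (abs_of_pos hη).le).eventually (lt_mem_nhds hp),
      (hc (-η) (by rw [abs_neg, abs_of_pos hη])).eventually (gt_mem_nhds hm),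
      Metric.ball_mem_nhds _ hδ] with w hwp hwm hwδ
    have hwb : ∀ t, |t| ≤ η → (w, t) ∈ Metric.ball q₀ δ := by
      intro t ht
      rw [Metric.mem_ball, Prod.dist_eq, Real.dist_eq, sub_zero]
      exact max_lt hwδ (ht.trans_lt hηδ)
    have hct : ContinuousOn (fun t : ℝ => ρ (Φ (w, t))) (Icc (-η) η) := by
      intro t ht
      have hb := (hδs (hwb t (abs_le.2 ht))).2
      have h6 : ContinuousAt Φ (w, t) := (hΦs _ (hB _ hb).1).continuousAt
      have h7 : ContinuousAt ρ (Φ (w, t)) :=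
        hρ.continuousOn.continuousAt (hU.mem_nhds (hB _ hb).2.1)
      exact ((ContinuousAt.comp (f := Φ) h7 h6).comp
        (f := fun t : ℝ => (w, t)) (by fun_prop)).continuousWithinAt
    obtain ⟨t, ht, ht0⟩ := intermediate_value_Icc (by linarith) hct ⟨hwm.le, hwp.le⟩
    have hb := hδs (hwb t (abs_le.2 ht))
    have hVm := hVmem _ hb.2
    refine ⟨Φ (w, t), ⟨hb.1, ?_⟩, ?_⟩
    · exact mem_boundary_of_eq_zero hVo hρV hXV hVm.1 ht0 (hρpos _ hVm.1)
    · rw [hVm.2]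

/-! ### A hypersurface that contains the submanifold in its boundary -/

/-- Near the submanifold of a boundary chart, a hypersurface `g '' W` of the boundary of `X`, whose
own boundary contains the submanifold, covers exactly one of the two sides of the submanifold, and
this side is determined by the product of the two boundary orientations. -/
theorem BoundaryChart.exists_side {a : ℕ} {X : Set (Euc (a + 1 + 1))} {W : Set (Euc (a + 1))}
    {Z : Set (Euc a)} {h : Euc a → Euc (a + 1 + 1)} {g : Euc (a + 1) → Euc (a + 1 + 1)}
    {f : Euc a → Euc (a + 1)} {y : Euc a} (C : BoundaryChart X h y)
    (hX : IsReferenceDomain X) (hW : IsReferenceDomain W) (hg : IsBoundaryPiece W X g)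
    (hf : IsBoundaryPiece Z W f) (hgs : ContDiffOn ℝ ∞ g (closure W))
    (hginj : InjOn g (closure W)) (hgm : MapsTo g (closure W) (closure X \ X))
    (hcomp : EqOn (g ∘ f) h Z) (hy : y ∈ Z) :
    ∃ τ : ℤˣ, boundarySign X g W * boundarySign W f Z = -(C.ε * τ) ∧
      (∀ V' ∈ 𝓝 (h y), ∀ᶠ w in 𝓝 (y, (0 : ℝ)), 0 < ((τ : ℤ) : ℝ) * w.2 →
        ∃ x ∈ W, g x ∈ V' ∧ C.κ (g x) = w) ∧
      ∀ᶠ x in 𝓝[W] (f y), 0 < ((τ : ℤ) : ℝ) * (C.κ (g x)).2 := by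
  obtain ⟨v, r, hr, hrZ, hrW, hΦinj, hΦsurj, hΦsgn⟩ := hf.exists_collar hW hy
  set Φ : Euc a × ℝ → Euc (a + 1) := fun q => f q.1 - q.2 • v with hΦ
  have hΦ0 : ∀ u, Φ (u, 0) = f u := fun u => by simp [Φ]
  have hΦd : ∀ q ∈ Metric.closedBall (y, (0 : ℝ)) r, HasStrictFDerivAt Φ
      ((fderiv ℝ f q.1).coprod (ContinuousLinearMap.toSpanSingleton ℝ (-v))) q := fun q hq =>
    hasStrictFDerivAt_collar (hf.contDiffAt (hrZ q hq))
  set H : ℝ → Set (Euc a × ℝ) := fun r => Metric.closedBall (y, (0 : ℝ)) r ∩ {q | 0 ≤ q.2}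
  have hHmono : ∀ {r r'}, r ≤ r' → H r ⊆ H r' := fun h q hq =>
    ⟨Metric.closedBall_subset_closedBall h hq.1, hq.2⟩
  have hy0 : ∀ {r}, 0 ≤ r → (y, (0 : ℝ)) ∈ H r := fun h =>
    ⟨Metric.mem_closedBall_self h, le_refl (0 : ℝ)⟩
  have hΦW : MapsTo Φ (H r) (closure W) := by
    rintro q ⟨hq, hq2⟩
    rcases (show 0 ≤ q.2 from hq2).lt_or_eq with h0 | h0
    · exact subset_closure ((hrW q hq).2 h0)
    · have : q = (q.1, 0) := Prod.ext rfl h0.symm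
      rw [this, hΦ0]
      exact (hf.mapsTo (hrZ q hq)).1
  have hΦc : ContinuousOn Φ (H r) := fun q hq => (hΦd q hq.1).continuousAt.continuousWithinAt
  have hgΦc : ContinuousOn (fun q => g (Φ q)) (H r) := hgs.continuousOn.comp hΦc hΦW
  have hgΦ0 : g (Φ (y, 0)) = h y := by
    rw [hΦ0]
    exact hcomp hy
  -- the derivative of the coordinate change in the directions of the submanifold
  set M : Euc a × ℝ → (Euc a →L[ℝ] Euc a) := fun q =>
    (ContinuousLinearMap.fst ℝ (Euc a) ℝ).comp ((fderiv ℝ C.κ (g (Φ q))).comp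
      ((fderivWithin ℝ g (closure W) (Φ q)).comp (fderiv ℝ f q.1)))
  have hMc : ContinuousWithinAt M (H r) (y, 0) := by
    have h1 : ContinuousWithinAt (fun q => fderiv ℝ C.κ (g (Φ q))) (H r) (y, 0) := by
      have : ContinuousAt (fderiv ℝ C.κ) (g (Φ (y, 0))) := by
        rw [hgΦ0]
        exact ((C.contDiffOn.contDiffAt (C.isOpen_V.mem_nhds C.mem_V)).fderiv_right
          (m := 0) (by simp)).continuousAt
      exact ContinuousAt.comp_continuousWithinAt (f := fun q => g (Φ q)) this
        (hgΦc _ (hy0 hr.le))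
    have h2 : ContinuousWithinAt (fun q => fderivWithin ℝ g (closure W) (Φ q)) (H r) (y, 0) :=
      ((hgs.continuousOn_fderivWithin hW.uniqueDiffOn_closure (by simp)).comp hΦc hΦW) _
        (hy0 hr.le)
    have h3 : ContinuousWithinAt (fun q : Euc a × ℝ => fderiv ℝ f q.1) (H r) (y, 0) :=
      (ContinuousAt.comp (x := (y, (0 : ℝ))) (f := Prod.fst) (hf.continuousAt_fderiv hy)
        continuousAt_fst).continuousWithinAt
    exact continuousWithinAt_const.clm_comp (h1.clm_comp (h2.clm_comp h3))
  have hM0 : M (y, 0) = ContinuousLinearMap.id ℝ (Euc a) := by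
    have h1 : HasFDerivAt (g ∘ f) ((fderivWithin ℝ g (closure W) (f y)).comp (fderiv ℝ f y)) y := by
      refine HasFDerivWithinAt.comp_hasFDerivAt (t := closure W) y ?_ (hf.hasFDerivAt hy) ?_
      · exact (hgs.differentiableOn (by simp) _ (hf.mapsTo hy).1).hasFDerivWithinAt
      · filter_upwards [hf.isOpen.mem_nhds hy] with u hu using (hf.mapsTo hu).1
    have h2 : HasFDerivAt C.κ (fderiv ℝ C.κ (g (f y))) (g (f y)) := by
      have : g (f y) ∈ C.V := by
        rw [show g (f y) = h y from hcomp hy]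
        exact C.mem_V
      exact ((C.contDiffOn.contDiffAt (C.isOpen_V.mem_nhds this)).differentiableAt
        (by simp)).hasFDerivAt
    have h3 := (ContinuousLinearMap.fst ℝ (Euc a) ℝ).hasFDerivAt.comp y
      (HasFDerivAt.comp (g := C.κ) (f := g ∘ f) y h2 h1)
    have h4 : HasFDerivAt (fun u : Euc a => u) (ContinuousLinearMap.id ℝ (Euc a)) y :=
      hasFDerivAt_id y
    have h5 := h4.congr_of_eventuallyEq
      (f₁ := (ContinuousLinearMap.fst ℝ (Euc a) ℝ) ∘ (C.κ ∘ (g ∘ f))) (by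
        filter_upwards [C.flat, hf.isOpen.mem_nhds hy] with u hu huZ
        have : g (f u) = h u := hcomp huZ
        simp [this, hu])
    have h6 := h3.unique h5
    rw [← h6]
    simp only [M, hΦ0]
  obtain ⟨r₁, hr₁, hr₁r, hV, hM⟩ : ∃ r₁, 0 < r₁ ∧ r₁ ≤ r ∧ (∀ q ∈ H r₁, g (Φ q) ∈ C.V) ∧
      ∀ q ∈ H r₁, 0 < (M q).det := by
    have h1 : ∀ᶠ q in 𝓝[H r] (y, 0), g (Φ q) ∈ C.V := by
      refine (hgΦc _ (hy0 hr.le)).eventually (C.isOpen_V.mem_nhds ?_)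
      change g (Φ (y, 0)) ∈ C.V
      rw [hgΦ0]
      exact C.mem_V
    have h2 : ∀ᶠ q in 𝓝[H r] (y, 0), 0 < (M q).det := by
      have h3 : ContinuousWithinAt (fun q => (M q).det) (H r) (y, 0) :=
        ContinuousAt.comp_continuousWithinAt (f := M)
          ContinuousLinearMap.continuous_det.continuousAt hMc
      refine h3.eventually (lt_mem_nhds ?_)
      change 0 < (M (y, 0)).det
      rw [hM0]
      simp [ContinuousLinearMap.det]
    obtain ⟨ε, hε, hε'⟩ := Metric.mem_nhdsWithin_iff.1 (h1.and h2)
    refine ⟨min (ε / 2) r, lt_min (half_pos hε) hr, min_le_right _ _, ?_⟩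
    have h4 : ∀ q ∈ H (min (ε / 2) r), q ∈ Metric.ball (y, (0 : ℝ)) ε ∩ H r := fun q hq =>
      ⟨Metric.closedBall_subset_ball (lt_of_le_of_lt (min_le_left _ _) (half_lt_self hε)) hq.1,
        hHmono (min_le_right _ _) hq⟩
    exact ⟨fun q hq => (hε' (h4 q hq)).1, fun q hq => (hε' (h4 q hq)).2⟩
  -- the coordinate change
  set T : Euc a × ℝ → Euc a × ℝ := fun q => C.κ (g (Φ q))
  have hTc : ContinuousOn T (H r₁) :=
    C.contDiffOn.continuousOn.comp (hgΦc.mono (hHmono hr₁r)) hV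
  have hTinj : InjOn T (H r₁) := by
    intro q hq q' hq' hqq
    have hq1 := hΦW (hHmono hr₁r hq)
    have hq1' := hΦW (hHmono hr₁r hq')
    have h1 := C.injOn ⟨hV q hq, hgm hq1⟩ ⟨hV q' hq', hgm hq1'⟩ hqq
    exact hΦinj (hHmono hr₁r hq).1 (hHmono hr₁r hq').1 (hginj hq1 hq1' h1)
  obtain ⟨η, hη, hflat⟩ := Metric.mem_nhds_iff.1 C.flat
  set r₂ := min r₁ (η / 2)
  have hr₂ : 0 < r₂ := lt_min hr₁ (half_pos hη)
  have hr₂₁ : r₂ ≤ r₁ := min_le_left _ _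
  have hTflat : ∀ {s}, s ≤ r₂ → ∀ u, (u, (0 : ℝ)) ∈ Metric.closedBall (y, (0 : ℝ)) s →
      T (u, 0) = (u, 0) := by
    intro s hs u hu
    have h1 : (u, (0 : ℝ)) ∈ H r₁ :=
      hHmono hr₂₁ (hHmono hs ⟨hu, le_refl (0 : ℝ)⟩)
    have h2 : u ∈ Metric.ball y η := by
      rw [Metric.mem_closedBall, Prod.dist_eq] at hu
      exact ((le_max_left _ _).trans hu).trans_lt (hs.trans_lt
        ((min_le_right _ _).trans_lt (half_lt_self hη)))
    have h3 : g (f u) = h u := hcomp (hrZ _ (hHmono hr₁r h1).1)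
    have h4 : C.κ (h u) = (u, 0) := hflat h2
    change C.κ (g (Φ (u, 0))) = _
    rw [hΦ0, h3, h4]
  obtain ⟨τ, r₃, hr₃, hr₃₂, hτ⟩ := MixedDim.exists_side hr₂ (hTc.mono (hHmono hr₂₁))
    (hTinj.mono (hHmono hr₂₁)) (hTflat le_rfl)
  have hr₃₁ := hr₃₂.trans hr₂₁
  have hr₃r := hr₃₁.trans hr₁r
  -- the derivative of the coordinate change in the interior
  set T' : Euc a × ℝ → (Euc a × ℝ →L[ℝ] Euc a × ℝ) := fun q =>
    (fderiv ℝ C.κ (g (Φ q))).comp ((fderiv ℝ g (Φ q)).comp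
      ((fderiv ℝ f q.1).coprod (ContinuousLinearMap.toSpanSingleton ℝ (-v))))
  have hpos : ∀ q ∈ Metric.closedBall (y, (0 : ℝ)) r₁, 0 < q.2 → q ∈ H r₁ ∧ Φ q ∈ W :=
    fun q hq hq2 => ⟨⟨hq, hq2.le⟩,
      (hrW q (Metric.closedBall_subset_closedBall hr₁r hq)).2 hq2⟩
  have hTd : ∀ q ∈ Metric.closedBall (y, (0 : ℝ)) r₁, 0 < q.2 → HasStrictFDerivAt T (T' q) q := by
    intro q hq hq2
    obtain ⟨hqH, hqW⟩ := hpos q hq hq2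
    have h1 : HasStrictFDerivAt C.κ (fderiv ℝ C.κ (g (Φ q))) (g (Φ q)) :=
      (C.contDiffOn.contDiffAt (C.isOpen_V.mem_nhds (hV q hqH))).hasStrictFDerivAt (by simp)
    have h2 : HasStrictFDerivAt g (fderiv ℝ g (Φ q)) (Φ q) :=
      (hg.contDiffAt hqW).hasStrictFDerivAt (by simp)
    exact h1.comp q (h2.comp q (hΦd q (hHmono hr₁r hqH).1))
  have hprod : ∀ q ∈ Metric.closedBall (y, (0 : ℝ)) r₁, 0 < q.2 →
      frameDet C.v (fderiv ℝ g (Φ q)) * frameDet v (fderiv ℝ f q.1) =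
        -(flagDet (C.P (g (Φ q))).toLinearEquiv.toLinearMap *
          LinearMap.det (T' q).toLinearMap) := by
    intro q hq hq2
    obtain ⟨hqH, hqW⟩ := hpos q hq hq2
    refine frameDet_mul_frameDet _ _ _ _ _ (C.P_inr _ (hV q hqH)) _ fun p => ?_
    rw [← C.fderiv_eq _ (hV q hqH)]
    simp [T', sub_eq_add_neg]
  have hsgn : ∀ q ∈ Metric.closedBall (y, (0 : ℝ)) r₁, 0 < q.2 →
      0 < ((boundarySign X g W : ℤ) : ℝ) * frameDet C.v (fderiv ℝ g (Φ q)) := by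
    intro q hq hq2
    obtain ⟨hqH, hqW⟩ := hpos q hq hq2
    exact hg.boundarySign_mul_frameDet_pos hX C.isOpen_V C.contDiffOn_ρ C.inter_V hqW
      (hV q hqH) (C.fderiv_ρ_pos _ (hV q hqH))
  have hdet : ∀ q ∈ Metric.closedBall (y, (0 : ℝ)) r₁, 0 < q.2 →
      LinearMap.det (T' q).toLinearMap ≠ 0 := by
    intro q hq hq2 h0
    have h1 := hprod q hq hq2
    rw [h0, mul_zero, neg_zero, mul_eq_zero] at h1
    rcases h1 with h1 | h1
    · have := hsgn q hq hq2
      rw [h1, mul_zero] at this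
      exact lt_irrefl _ this
    · have := hΦsgn q (Metric.closedBall_subset_closedBall hr₁r hq)
      rw [h1, mul_zero] at this
      exact lt_irrefl _ this
  have hopen : ∀ q ∈ Metric.closedBall (y, (0 : ℝ)) r₁, 0 < q.2 → map T (𝓝 q) = 𝓝 (T q) := by
    intro q hq hq2
    let e : (Euc a × ℝ) ≃L[ℝ] (Euc a × ℝ) :=
      (LinearMap.equivOfDetNeZero _ (hdet q hq hq2)).toContinuousLinearEquiv
    have he : (e : Euc a × ℝ →L[ℝ] Euc a × ℝ) = T' q := by
      exact ContinuousLinearMap.ext fun x => rfl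
    have h1 := hTd q hq hq2
    rw [← he] at h1
    exact h1.map_nhds_eq_of_equiv
  have hM' : ∀ q ∈ Metric.closedBall (y, (0 : ℝ)) r₁, 0 < q.2 → 0 < LinearMap.det
      (LinearMap.fst ℝ (Euc a) ℝ ∘ₗ (T' q).toLinearMap ∘ₗ LinearMap.inl ℝ (Euc a) ℝ) := by
    intro q hq hq2
    obtain ⟨hqH, hqW⟩ := hpos q hq hq2
    have h1 : LinearMap.fst ℝ (Euc a) ℝ ∘ₗ (T' q).toLinearMap ∘ₗ LinearMap.inl ℝ (Euc a) ℝ =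
        (M q).toLinearMap := by
      refine LinearMap.ext fun u => ?_
      simp [T', M, hW.fderivWithin_closure g hqW]
    rw [h1]
    exact hM q hqH
  have hball : ∀ {s}, s ≤ r₃ → Metric.closedBall (y, (0 : ℝ)) s ⊆
      Metric.closedBall (y, (0 : ℝ)) r₁ := fun hs =>
    Metric.closedBall_subset_closedBall (hs.trans hr₃₁)
  refine ⟨τ, ?_, fun V' hV' => ?_, ?_⟩
  · obtain ⟨q, hq, hq2, hqdet⟩ := exists_det_pos hr₃ (hTc.mono (hHmono hr₃₁))
      (hTinj.mono (hHmono hr₃₁)) (hTflat hr₃₂)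
      (fun q hq hq2 => (hTd q (hball le_rfl hq) hq2).hasFDerivAt)
      (fun q hq hq2 => hopen q (hball le_rfl hq) hq2)
      (fun q hq hq2 => hdet q (hball le_rfl hq) hq2)
      (fun q hq hq2 => hM' q (hball le_rfl hq) hq2) hτ
    have hq1 := hball le_rfl hq
    have h1 := hprod q hq1 hq2
    have h2 := mul_pos (hsgn q hq1 hq2) (hΦsgn q (Metric.closedBall_subset_closedBall hr₁r hq1))
    have h3 := mul_pos (C.sign _ (hV q (hpos q hq1 hq2).1)) hqdet
    set D := flagDet (C.P (g (Φ q))).toLinearEquiv.toLinearMap * LinearMap.det (T' q).toLinearMap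
    have h4 : 0 < -(((boundarySign X g W : ℤ) : ℝ) * ((boundarySign W f Z : ℤ) : ℝ)) * D := by
      have : -(((boundarySign X g W : ℤ) : ℝ) * ((boundarySign W f Z : ℤ) : ℝ)) * D =
          ((boundarySign X g W : ℤ) : ℝ) * ((boundarySign W f Z : ℤ) : ℝ) * -D := by ring
      rw [this, ← h1]
      linarith [h2]
    have h5 : 0 < (((C.ε : ℤ) : ℝ) * ((τ : ℤ) : ℝ)) * D := by
      have : (((C.ε : ℤ) : ℝ) * ((τ : ℤ) : ℝ)) * D = ((C.ε : ℤ) : ℝ) *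
          flagDet (C.P (g (Φ q))).toLinearEquiv.toLinearMap *
          (((τ : ℤ) : ℝ) * LinearMap.det (T' q).toLinearMap) := by
        simp only [D]
        ring
      rw [this]
      exact h3
    generalize boundarySign X g W = s₁ at h4 ⊢
    generalize boundarySign W f Z = s₂ at h4 ⊢
    generalize C.ε = s₃ at h5 ⊢
    have key : ∀ s s' : ℤˣ, 0 < -((s : ℤ) : ℝ) * D → 0 < ((s' : ℤ) : ℝ) * D → s = -s' := by
      intro s s' h h'
      rcases Int.units_eq_one_or s with rfl | rfl <;>
        rcases Int.units_eq_one_or s' with rfl | rfl <;> simp at h h' ⊢ <;> linarith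
    exact key (s₁ * s₂) (s₃ * τ) (by push_cast; exact h4) (by push_cast; exact h5)
  · have h1 : ∀ᶠ q in 𝓝[H r] (y, 0), g (Φ q) ∈ V' := by
      refine (hgΦc _ (hy0 hr.le)).eventually (p := fun x => x ∈ V') ?_
      change V' ∈ 𝓝 (g (Φ (y, 0)))
      rw [hgΦ0]
      exact hV'
    obtain ⟨ε, hε, hε'⟩ := Metric.mem_nhdsWithin_iff.1 h1
    set s := min (ε / 2) r₃
    have hs : 0 < s := lt_min (half_pos hε) hr₃
    have hs₃ : s ≤ r₃ := min_le_right _ _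
    obtain ⟨δ, hδ, hcov⟩ := exists_halfBall_subset_image hs (hTc.mono (hHmono (hs₃.trans hr₃₁)))
      (hTinj.mono (hHmono (hs₃.trans hr₃₁))) (hTflat (hs₃.trans hr₃₂))
      (fun q hq hq2 => hopen q (hball hs₃ hq) hq2)
      (fun q hq hq2 => hτ q (Metric.closedBall_subset_closedBall hs₃ hq) hq2)
    filter_upwards [Metric.ball_mem_nhds _ hδ] with w hw hw2
    obtain ⟨q, hq, hq2, hqw⟩ := hcov w hw hw2
    have hq' := Metric.ball_subset_closedBall hq
    obtain ⟨hqH, hqW⟩ := hpos q (hball hs₃ hq') hq2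
    refine ⟨Φ q, hqW, hε' ⟨?_, hHmono hr₁r hqH⟩, hqw⟩
    exact Metric.closedBall_subset_ball
      (lt_of_le_of_lt (min_le_left _ _) (half_lt_self hε)) hq'
  · filter_upwards [nhdsWithin_le_nhds (hΦsurj r₃ hr₃), self_mem_nhdsWithin] with x hx hxW
    obtain ⟨q, hq, rfl⟩ := hx
    exact hτ q hq ((hrW q (Metric.closedBall_subset_closedBall hr₃r hq)).1 hxW)

/-! ### Cancellation of the orientations along a submanifold of codimension two -/

theorem BoundaryChart.exists_side_of_eq {a b : ℕ} (hb : b = a + 1) {X : Set (Euc (a + 1 + 1))}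
    {W : Set (Euc b)} {Z : Set (Euc a)} {h : Euc a → Euc (a + 1 + 1)}
    {g : Euc b → Euc (a + 1 + 1)} {f : Euc a → Euc b} {y : Euc a} (C : BoundaryChart X h y)
    (hX : IsReferenceDomain X) (hW : IsReferenceDomain W) (hg : IsBoundaryPiece W X g)
    (hf : IsBoundaryPiece Z W f) (hgs : ContDiffOn ℝ ∞ g (closure W))
    (hginj : InjOn g (closure W)) (hgm : MapsTo g (closure W) (closure X \ X))
    (hcomp : EqOn (g ∘ f) h Z) (hy : y ∈ Z) :
    ∃ τ : ℤˣ, boundarySign X g W * boundarySign W f Z = -(C.ε * τ) ∧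
      (∀ V' ∈ 𝓝 (h y), ∀ᶠ w in 𝓝 (y, (0 : ℝ)), 0 < ((τ : ℤ) : ℝ) * w.2 →
        ∃ x ∈ W, g x ∈ V' ∧ C.κ (g x) = w) ∧
      ∀ᶠ x in 𝓝[W] (f y), 0 < ((τ : ℤ) : ℝ) * (C.κ (g x)).2 := by
  subst hb
  exact C.exists_side hX hW hg hf hgs hginj hgm hcomp hy

theorem exists_side_of_eventually {E : Type*} [NormedAddCommGroup E] [NormedSpace ℝ E] {y : E}
    (τ : ℤˣ) {p : E × ℝ → Prop} (hp : ∀ᶠ w in 𝓝 (y, (0 : ℝ)), p w) :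
    ∃ w, p w ∧ 0 < ((τ : ℤ) : ℝ) * w.2 := by
  have hc : Continuous fun t : ℝ => (y, ((τ : ℤ) : ℝ) * t) := by fun_prop
  have h1 : ∀ᶠ t in 𝓝[>] (0 : ℝ), p (y, ((τ : ℤ) : ℝ) * t) := by
    refine nhdsWithin_le_nhds (hc.continuousAt.eventually ?_)
    simpa using hp
  obtain ⟨t, ht, ht0⟩ := (h1.and self_mem_nhdsWithin).exists
  refine ⟨_, ht, ?_⟩
  rw [← mul_assoc, units_coe_mul_self, one_mul]
  exact ht0

/-- Injective maps of compact sets reflect closeness. -/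
theorem eventually_of_injOn {E E' : Type*} [TopologicalSpace E] [TopologicalSpace E'] [T2Space E']
    {g : E → E'} {W : Set E} (hW : IsCompact (closure W)) (hg : ContinuousOn g (closure W))
    (hinj : InjOn g (closure W)) {p : E} (hp : p ∈ closure W) {P : E → Prop}
    (hP : ∀ᶠ x in 𝓝[W] p, P x) : ∀ᶠ z in 𝓝 (g p), ∀ x ∈ W, g x = z → P x := by
  obtain ⟨U, hU, hpU, hUP⟩ := mem_nhdsWithin.1 hP
  have hK : IsCompact (closure W \ U) := hW.diff hU
  have hc : IsClosed (g '' (closure W \ U)) :=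
    (hK.image_of_continuousOn (hg.mono sdiff_subset)).isClosed
  have hmem : g p ∈ (g '' (closure W \ U))ᶜ := by
    rintro ⟨x, hx, hxp⟩
    rw [hinj hx.1 hp hxp] at hx
    exact hx.2 hpU
  filter_upwards [hc.isOpen_compl.mem_nhds hmem] with z hz x hx hxz
  refine hUP ⟨?_, hx⟩
  by_contra h
  exact hz ⟨x, ⟨subset_closure hx, h⟩, hxz⟩

theorem dimH_image_le_of_contDiffAt {a : ℕ} {E : Type*} [NormedAddCommGroup E] [NormedSpace ℝ E]
    {f : Euc a → E} {s : Set (Euc a)} (hf : ∀ x ∈ s, ContDiffAt ℝ ∞ f x) :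
    dimH (f '' s) ≤ a := by
  have h1 : dimH (f '' s) ≤ dimH s := by
    refine dimH_image_le_of_locally_lipschitzOn fun x hx => ?_
    obtain ⟨K, t, ht, h⟩ := ((hf x hx).of_le (by simp)).exists_lipschitzOnWith
    exact ⟨K, t, nhdsWithin_le_nhds ht, h⟩
  have h2 : dimH (univ : Set (Euc a)) = a := by
    rw [Real.dimH_univ_eq_finrank]
    simp
  exact h1.trans (h2 ▸ dimH_mono (subset_univ s))

/-- Let `h '' Z` be a submanifold of codimension one in the boundary of `X`. If the boundary is
partitioned near the point `h y` by finitely many submanifolds `g j '' W j`, then `h '' Z` inherits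
opposite orientations from the hypersurfaces of the partition whose boundary contains it: there
is exactly one such hypersurface on each side, since the pieces of lower dimension cannot cover
an open subset of the boundary. -/
theorem sum_boundarySign_eq_zero {a c : ℕ} (hc : c = a + 1 + 1) {X : Set (Euc c)}
    {Z : Set (Euc a)} {h : Euc a → Euc c} (hX : IsReferenceDomain X) (hh : IsBoundaryPiece Z X h)
    {y : Euc a} (hy : y ∈ Z) {ι : Type*} [Finite ι] {e : ι → ℕ} {W : ∀ j, Set (Euc (e j))}
    {g : ∀ j, Euc (e j) → Euc c} (hW : ∀ j, IsReferenceDomain (W j))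
    (hg : ∀ j, IsBoundaryPiece (W j) X (g j)) (hgs : ∀ j, ContDiffOn ℝ ∞ (g j) (closure (W j)))
    (hginj : ∀ j, InjOn (g j) (closure (W j)))
    (hgm : ∀ j, MapsTo (g j) (closure (W j)) (closure X \ X))
    (hdisj : Pairwise fun i j => Disjoint (g i '' W i) (g j '' W j))
    (hcov : ∀ᶠ x in 𝓝 (h y), x ∈ closure X \ X → ∃ j, x ∈ g j '' W j)
    (S : Finset ι) (hS : ∀ j, j ∈ S ↔ e j = a + 1 ∧ h y ∈ g j '' closure (W j))
    (f : ∀ j, Euc a → Euc (e j)) (hf : ∀ j ∈ S, IsBoundaryPiece Z (W j) (f j))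
    (hfg : ∀ j ∈ S, EqOn (g j ∘ f j) h Z) :
    ∑ j ∈ S, ((boundarySign X (g j) (W j) * boundarySign (W j) (f j) Z : ℤˣ) : ℤ) = 0 := by
  classical
  subst hc
  obtain ⟨C⟩ := hh.nonempty_boundaryChart hX hy
  have hex : ∀ j, ∃ τ : ℤˣ, j ∈ S →
      boundarySign X (g j) (W j) * boundarySign (W j) (f j) Z = -(C.ε * τ) ∧
      (∀ V' ∈ 𝓝 (h y), ∀ᶠ w in 𝓝 (y, (0 : ℝ)), 0 < ((τ : ℤ) : ℝ) * w.2 →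
        ∃ x ∈ W j, g j x ∈ V' ∧ C.κ (g j x) = w) ∧
      ∀ᶠ x in 𝓝[W j] (f j y), 0 < ((τ : ℤ) : ℝ) * (C.κ (g j x)).2 := by
    intro j
    by_cases hj : j ∈ S
    · obtain ⟨τ, hτ⟩ := C.exists_side_of_eq ((hS j).1 hj).1 hX (hW j) (hg j) (hf j hj) (hgs j)
        (hginj j) (hgm j) (hfg j hj) hy
      exact ⟨τ, fun _ => hτ⟩
    · exact ⟨1, fun h => absurd h hj⟩
  choose τ hτ using hex
  -- different hypersurfaces lie on different sides
  have huniq : ∀ j ∈ S, ∀ j' ∈ S, τ j = τ j' → j = j' := by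
    intro j hj j' hj' hjj
    have hV := C.isOpen_V.mem_nhds C.mem_V
    obtain ⟨w, ⟨hw1, hw2⟩, hw0⟩ := exists_side_of_eventually (τ j)
      (((hτ j hj).2.1 _ hV).and ((hτ j' hj').2.1 _ hV))
    obtain ⟨x, hx, hxV, hxw⟩ := hw1 hw0
    obtain ⟨x', hx', hxV', hxw'⟩ := hw2 (by rw [← hjj]; exact hw0)
    have h1 := C.injOn ⟨hxV, hgm j (subset_closure hx)⟩ ⟨hxV', hgm j' (subset_closure hx')⟩
      (hxw.trans hxw'.symm)
    by_contra hne
    exact Set.disjoint_left.1 (hdisj hne) ⟨x, hx, h1⟩ ⟨x', hx', rfl⟩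
  -- every side is covered
  have hexist : ∀ ς : ℤˣ, ∃ j ∈ S, τ j = ς := by
    intro ς
    by_contra! hno
    have h1 : ∀ᶠ x in 𝓝 (h y), ∀ j, e j = a + 1 → j ∉ S → x ∉ g j '' closure (W j) := by
      rw [eventually_all]
      intro j
      by_cases hj : e j = a + 1 ∧ j ∉ S
      · have hcl : IsClosed (g j '' closure (W j)) :=
          ((hW j).isCompact_closure.image_of_continuousOn (hgs j).continuousOn).isClosed
        have : h y ∈ (g j '' closure (W j))ᶜ := fun hmem => hj.2 ((hS j).2 ⟨hj.1, hmem⟩)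
        filter_upwards [hcl.isOpen_compl.mem_nhds this] with x hx _ _ using hx
      · exact Eventually.of_forall fun x h1 h2 => absurd ⟨h1, h2⟩ hj
    have h2 : ∀ᶠ x in 𝓝 (h y), ∀ j, j ∈ S → ∀ x' ∈ W j, g j x' = x →
        0 < ((τ j : ℤ) : ℝ) * (C.κ (g j x')).2 := by
      rw [eventually_all]
      intro j
      by_cases hj : j ∈ S
      · have hgf : g j (f j y) = h y := hfg j hj hy
        have h3 := eventually_of_injOn (hW j).isCompact_closure (hgs j).continuousOn (hginj j)
          ((hf j hj).mapsTo hy).1 (hτ j hj).2.2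
        rw [hgf] at h3
        filter_upwards [h3] with x hx _ using hx
      · exact Eventually.of_forall fun x h1 => absurd h1 hj
    have h3 : ∀ᶠ x in 𝓝 (h y), x ∈ C.V := C.isOpen_V.mem_nhds C.mem_V
    have h4 := C.surj _ (hcov.and (h1.and (h2.and h3)))
    obtain ⟨G, hG, hGo, hyG⟩ := mem_nhds_iff.1 h4
    set B := G ∩ {w | 0 < ((ς : ℤ) : ℝ) * w.2}
    have hBo : IsOpen B :=
      hGo.inter (isOpen_lt continuous_const (by fun_prop))
    have hBne : B.Nonempty := by
      obtain ⟨w, hw, hw0⟩ := exists_side_of_eventually ς (hGo.mem_nhds hyG)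
      exact ⟨w, hw, hw0⟩
    -- the side is covered by pieces of lower dimension
    set R : Set (Euc a × ℝ) := ⋃ j ∈ {j : ι | e j ≤ a},
      (fun x => C.κ (g j x)) '' {x ∈ W j | g j x ∈ C.V}
    have hBR : B ⊆ R := by
      rintro w ⟨hwG, hw0⟩
      obtain ⟨x, ⟨hx, hxX⟩, hxw⟩ := hG hwG
      obtain ⟨hx1, hx2, hx3, hxV⟩ := hx
      obtain ⟨j, x', hx', hxx'⟩ := hx1 hxX
      refine mem_biUnion (x := j) ?_ ⟨x', ⟨hx', by rw [hxx']; exact hxV⟩, by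
        rw [← hxw, ← hxx']⟩
      have hlt := (hg j).dim_lt hX hx'
      have hne : e j ≠ a + 1 := by
        intro hej
        by_cases hj : j ∈ S
        · have h5 := hx3 j hj x' hx' hxx'
          rw [hxx', hxw] at h5
          have hw0 : 0 < ((ς : ℤ) : ℝ) * w.2 := hw0
          refine hno j hj ?_
          rcases Int.units_eq_one_or (τ j) with h6 | h6 <;>
            rcases Int.units_eq_one_or ς with h7 | h7 <;> rw [h6] at h5 ⊢ <;>
            rw [h7] at hw0 ⊢ <;> simp at h5 hw0 <;> linarith
        · exact hx2 j hej hj ⟨x', subset_closure hx', hxx'⟩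
      change e j ≤ a
      omega
    have hdim : dimH R < Module.finrank ℝ (Euc a × ℝ) := by
      have h5 : dimH R ≤ a := by
        rw [dimH_bUnion (Set.to_countable _)]
        refine iSup₂_le fun j hj => ?_
        refine (dimH_image_le_of_contDiffAt fun x hx => ?_).trans (Nat.cast_le.2 hj)
        exact (C.contDiffOn.contDiffAt (C.isOpen_V.mem_nhds hx.2)).comp x
          ((hg j).contDiffAt hx.1)
      refine h5.trans_lt ?_
      simp only [Module.finrank_prod, finrank_euclideanSpace, Fintype.card_fin,
        Module.finrank_self]
      exact_mod_cast Nat.lt_succ_self a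
    obtain ⟨w, hw, hwR⟩ := (dense_compl_of_dimH_lt_finrank hdim).inter_open_nonempty B hBo hBne
    exact hwR (hBR hw)
  obtain ⟨j₁, hj₁, h₁⟩ := hexist 1
  obtain ⟨j₂, hj₂, h₂⟩ := hexist (-1)
  have hne : j₁ ≠ j₂ := by
    rintro rfl
    rw [h₁] at h₂
    exact absurd h₂ (by decide)
  have hSeq : S = {j₁, j₂} := by
    ext j
    rw [Finset.mem_insert, Finset.mem_singleton]
    constructor
    · intro hj
      rcases Int.units_eq_one_or (τ j) with h | h
      · exact Or.inl (huniq j hj j₁ hj₁ (h.trans h₁.symm))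
      · exact Or.inr (huniq j hj j₂ hj₂ (h.trans h₂.symm))
    · rintro (rfl | rfl) <;> assumption
  rw [hSeq, Finset.sum_pair hne, (hτ j₁ hj₁).1, (hτ j₂ hj₂).1, h₁, h₂]
  simp

/-! ### The maps of a conforming forest -/

theorem boundarySign_congr {a b : ℕ} {X : Set (Euc b)} {f f' : Euc a → Euc b} {Z : Set (Euc a)}
    (hZ : IsOpen Z) (h : EqOn f f' Z) : boundarySign X f Z = boundarySign X f' Z := by
  have key : ∀ x ∈ Z, IsPositiveAt X f x ↔ IsPositiveAt X f' x := by
    intro x hx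
    have h1 : f =ᶠ[𝓝 x] f' := h.eventuallyEq_of_mem (hZ.mem_nhds hx)
    unfold IsPositiveAt
    rw [h1.fderiv_eq, h hx]
  unfold boundarySign
  congr 1
  exact propext (exists_congr fun x => and_congr_right fun hx => key x hx)

namespace ConformingForest

variable {n : ℕ} {I N : Type*} [PartialOrder N] (F : ConformingForest n I N)

theorem tree_root (i : I) : F.tree (F.root i) = i := (F.le_root_iff _ _).1 le_rfl

theorem le_root_tree (j : N) : j ≤ F.root (F.tree j) := (F.le_root_iff _ _).2 rfl

theorem tree_eq_of_le {j l : N} (h : j ≤ l) : F.tree j = F.tree l :=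
  (F.le_root_iff _ _).1 (h.trans (F.le_root_tree l))

open Classical in
/-- The map `φ_{l,j}` between the reference domains of `Ω a` and `Ω b`, where `a = s j` and
`b = s l`; it is zero if `a` or `b` are other indices. -/
def nodeMap (l j : N) (a b : I) : Euc (F.dim a) → Euc (F.dim b) :=
  if h : F.s j = a ∧ F.s l = b then h.1 ▸ h.2 ▸ F.map l j else 0

theorem nodeMap_s (l j : N) : F.nodeMap l j (F.s j) (F.s l) = F.map l j := by
  simp [nodeMap]

section NodeMap

variable {F} {l j : N} {a b : I}

theorem nodeMap_self (ha : F.s j = a) : EqOn (F.nodeMap j j a a) id (closure (F.X a)) := by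
  subst ha
  rw [nodeMap_s]
  exact F.map_self j

theorem contDiffOn_nodeMap (ha : F.s j = a) (hb : F.s l = b) (h : j ≤ l) :
    ContDiffOn ℝ ∞ (F.nodeMap l j a b) (closure (F.X a)) := by
  subst ha hb
  rw [nodeMap_s]
  exact F.map_smooth l j h

theorem injOn_nodeMap (ha : F.s j = a) (hb : F.s l = b) (h : j ≤ l) :
    InjOn (F.nodeMap l j a b) (closure (F.X a)) := by
  subst ha hb
  rw [nodeMap_s]
  exact F.map_injOn l j h

theorem injective_fderiv_nodeMap (ha : F.s j = a) (hb : F.s l = b) (h : j ≤ l) :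
    ∀ x ∈ F.X a, Function.Injective (fderiv ℝ (F.nodeMap l j a b) x) := by
  subst ha hb
  rw [nodeMap_s]
  exact F.map_immersion l j h

theorem nodeMap_comp {m : N} {c : I} (ha : F.s j = a) (hb : F.s l = b) (hc : F.s m = c)
    (h : j ≤ l) (h' : l ≤ m) :
    EqOn (F.nodeMap m j a c) (F.nodeMap m l b c ∘ F.nodeMap l j a b) (closure (F.X a)) := by
  subst ha hb hc
  simp only [nodeMap_s]
  exact F.map_comp m l j h h'

theorem chart_comp_nodeMap (ha : F.s j = a) (hb : F.s l = b) (h : j ≤ l) :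
    EqOn (F.chart a) (F.chart b ∘ F.nodeMap l j a b) (closure (F.X a)) := by
  subst ha hb
  rw [nodeMap_s]
  exact F.chart_comp l j h

theorem eq_of_nodeMap_eq {j' : N} {a' : I} (ha : F.s j = a) (ha' : F.s j' = a') (hb : F.s l = b)
    (h : j ≤ l) (h' : j' ≤ l) {x : Euc (F.dim a)} {x' : Euc (F.dim a')} (hx : x ∈ F.X a)
    (hx' : x' ∈ F.X a') (hxx' : F.nodeMap l j a b x = F.nodeMap l j' a' b x') : j = j' := by
  subst ha ha' hb
  rw [nodeMap_s, nodeMap_s] at hxx'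
  by_contra hne
  exact Set.disjoint_left.1 (F.map_disjoint l j j' h h' hne) ⟨x, hx, hxx'⟩ ⟨x', hx', rfl⟩

theorem nodeMap_mem (ha : F.s j = a) (hb : F.s l = b) (h : j ≤ l) {x : Euc (F.dim a)}
    (hx : x ∈ F.X a) : F.nodeMap l j a b x ∈ closure (F.X b) := by
  subst ha hb
  rw [nodeMap_s]
  have : F.map l j x ∈ ⋃ j ∈ {j | j ≤ l}, F.map l j '' F.X (F.s j) :=
    mem_biUnion (x := j) h ⟨x, hx, rfl⟩
  rw [F.map_cover] at this
  exact this.1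

theorem exists_nodeMap_eq (hb : F.s l = b) {z : Euc (F.dim b)} (hz : z ∈ closure (F.X b))
    (hzD : F.chart b z ∉ frontier F.Y \ F.neumann) :
    ∃ j ≤ l, ∃ x ∈ F.X (F.s j), F.nodeMap l j (F.s j) b x = z := by
  subst hb
  have : z ∈ ⋃ j ∈ {j | j ≤ l}, F.map l j '' F.X (F.s j) := by
    rw [F.map_cover]
    exact ⟨hz, hzD⟩
  obtain ⟨j, hj, x, hx, hxz⟩ := mem_iUnion₂.1 this
  exact ⟨j, hj, x, hx, by rw [nodeMap_s, hxz]⟩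

theorem mapsTo_nodeMap (ha : F.s j = a) (hb : F.s l = b) (h : j ≤ l) :
    MapsTo (F.nodeMap l j a b) (closure (F.X a)) (closure (F.X b)) := by
  have h1 : MapsTo (F.nodeMap l j a b) (F.X a) (closure (F.X b)) :=
    fun x hx => nodeMap_mem ha hb h hx
  have := h1.closure_of_continuousOn (contDiffOn_nodeMap ha hb h).continuousOn
  rwa [closure_closure] at this

theorem mapsTo_nodeMap_boundary (ha : F.s j = a) (hb : F.s l = b) (h : j < l) :
    MapsTo (F.nodeMap l j a b) (closure (F.X a)) (closure (F.X b) \ F.X b) := by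
  have h1 : MapsTo (F.nodeMap l j a b) (F.X a) (closure (F.X b) \ F.X b) := by
    refine fun x hx => ⟨nodeMap_mem ha hb h.le hx, fun hx' => h.ne ?_⟩
    refine eq_of_nodeMap_eq ha hb hb h.le le_rfl hx hx' ?_
    exact (nodeMap_self hb (subset_closure hx')).symm
  have h2 := h1.closure_of_continuousOn (contDiffOn_nodeMap ha hb h.le).continuousOn
  have h3 : IsClosed (closure (F.X b) \ F.X b) :=
    isClosed_closure.sdiff (F.isReferenceDomain b).isOpen
  rwa [h3.closure_eq] at h2

theorem isBoundaryPiece_nodeMap (ha : F.s j = a) (hb : F.s l = b) (h : j < l) :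
    IsBoundaryPiece (F.X a) (F.X b) (F.nodeMap l j a b) where
  isOpen := (F.isReferenceDomain a).isOpen
  isPreconnected := (F.isReferenceDomain a).isConnected.isPreconnected
  contDiffOn := (contDiffOn_nodeMap ha hb h.le).mono subset_closure
  injective_fderiv := injective_fderiv_nodeMap ha hb h.le
  mapsTo := (mapsTo_nodeMap_boundary ha hb h).mono_left subset_closure

theorem relOrientation_eq (ha : F.s l = a) (hb : F.tree l = b) : F.relOrientation l =
    F.orientation a * F.orientation b *
      boundarySign (F.X b) (F.nodeMap (F.root b) l a b) (F.X a) := by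
  have key : ∀ c (hc : F.s (F.root (F.tree l)) = c), F.relOrientation l =
      F.orientation (F.s l) * F.orientation (F.tree l) *
        boundarySign (F.X c) (F.nodeMap (F.root (F.tree l)) l (F.s l) c) (F.X (F.s l)) := by
    rintro c rfl
    rw [nodeMap_s]
    rfl
  subst ha hb
  exact key _ (F.s_root _)

end NodeMap

theorem chart_notMem_dirichlet {a : I} {x : Euc (F.dim a)} (hx : x ∈ F.X a) :
    F.chart a x ∉ frontier F.Y \ F.neumann := by
  rintro ⟨h1, h2⟩
  have h3 : F.chart a x ∈ F.Y ∪ F.neumann := by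
    rw [← F.chart_cover]
    exact mem_iUnion.2 ⟨a, x, hx, rfl⟩
  rcases h3 with h3 | h3
  · rw [F.isOpen_Y.frontier_eq] at h1
    exact h1.2 h3
  · exact h2 h3

theorem chart_eq_chart {a b : I} {x : Euc (F.dim a)} {z : Euc (F.dim b)} (hx : x ∈ F.X a)
    (hz : z ∈ F.X b) (h : F.chart a x = F.chart b z) : a = b ∧ HEq x z := by
  have hab : a = b := by
    by_contra hne
    exact Set.disjoint_left.1 (F.chart_disjoint hne) ⟨x, hx, h⟩ ⟨z, hz, rfl⟩
  subst hab
  have := (F.chart_embedding a).injective (a₁ := ⟨x, hx⟩) (a₂ := ⟨z, hz⟩) h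
  exact ⟨rfl, heq_of_eq (congrArg Subtype.val this)⟩

/-- Two nodes that represent the same submanifold have the same descendants: a subset of the
boundary of `Ω b` that is parametrized by a descendant `l` of one of the nodes is also parametrized
by a descendant of the other one, with the same map. Here the partition of the boundary selects a
descendant of the second node for every point, and this choice is locally constant. -/
theorem exists_nodeMap_eqOn [Finite N] {m m' l : N} {b i : I} (hm : F.s m = b) (hm' : F.s m' = b)
    (hl : F.s l = i) (h : l ≤ m) : ∃ l', l' ≤ m' ∧ F.s l' = i ∧
      EqOn (F.nodeMap m l i b) (F.nodeMap m' l' i b) (closure (F.X i)) := by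
  have hpt : ∀ x ∈ F.X i, ∃ l', l' ≤ m' ∧ F.s l' = i ∧
      F.nodeMap m l i b x = F.nodeMap m' l' i b x := by
    intro x hx
    have hc : F.chart i x = F.chart b (F.nodeMap m l i b x) :=
      chart_comp_nodeMap hl hm h (subset_closure hx)
    obtain ⟨l', hl', x', hx', hxx'⟩ := exists_nodeMap_eq hm' (nodeMap_mem hl hm h hx)
      (by rw [← hc]; exact F.chart_notMem_dirichlet hx)
    have hc' : F.chart (F.s l') x' = F.chart b (F.nodeMap m' l' (F.s l') b x') :=
      chart_comp_nodeMap rfl hm' hl' (subset_closure hx')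
    obtain ⟨hi, hx⟩ := F.chart_eq_chart hx hx' (by rw [hc, hc', hxx'])
    subst hi
    rw [eq_of_heq hx] at hxx' ⊢
    exact ⟨l', hl', rfl, hxx'.symm⟩
  -- the sets on which the maps agree are closed
  set E : N → Set (Euc (F.dim i)) := fun l' =>
    {x ∈ closure (F.X i) | F.nodeMap m l i b x = F.nodeMap m' l' i b x}
  have hE : ∀ l', l' ≤ m' → F.s l' = i → IsClosed (E l') := by
    intro l' hl' hs
    have h1 := ((contDiffOn_nodeMap hl hm h).continuousOn.prodMk
      (contDiffOn_nodeMap hs hm' hl').continuousOn).preimage_isClosed_of_isClosed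
        isClosed_closure isClosed_diagonal
    exact h1
  obtain ⟨x₀, hx₀⟩ := (F.isReferenceDomain i).isConnected.nonempty
  obtain ⟨l', hl', hs, he⟩ := hpt x₀ hx₀
  refine ⟨l', hl', hs, ?_⟩
  set E' := ⋃ l'' ∈ {l'' : N | l'' ≤ m' ∧ F.s l'' = i ∧ l'' ≠ l'}, E l''
  have hE' : IsClosed E' :=
    (Set.toFinite _).isClosed_biUnion fun l'' hl'' => hE l'' hl''.1 hl''.2.1
  have hsub : F.X i ⊆ E l' ∪ E' := by
    intro x hx
    obtain ⟨l'', h1, h2, h3⟩ := hpt x hx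
    by_cases h4 : l'' = l'
    · subst h4
      exact Or.inl ⟨subset_closure hx, h3⟩
    · exact Or.inr (mem_biUnion (x := l'') ⟨h1, h2, h4⟩ ⟨subset_closure hx, h3⟩)
  have hdisj : ¬ (F.X i ∩ E').Nonempty := by
    intro hne
    obtain ⟨x, hx, hx1, hx2⟩ := isPreconnected_closed_iff.1
      (F.isReferenceDomain i).isConnected.isPreconnected _ _ (hE l' hl' hs) hE' hsub
      ⟨x₀, hx₀, subset_closure hx₀, he⟩ hne
    obtain ⟨l'', hl'', hx3⟩ := mem_iUnion₂.1 hx2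
    exact hl''.2.2 (eq_of_nodeMap_eq hl''.2.1 hs hm' hl''.1 hl' hx hx
      (hx3.2.symm.trans hx1.2))
  have hX : F.X i ⊆ E l' := fun x hx =>
    (hsub hx).resolve_right fun h => hdisj ⟨x, hx, h⟩
  have hcl : closure (F.X i) ⊆ E l' := (hE l' hl' hs).closure_subset_iff.2 hX
  exact fun x hx => (hcl hx).2

/-- The cancellation of the orientations along a node `j` of codimension two. -/
theorem sum_boundarySign_nodeMap_eq_zero [Fintype N] {j : N} {i p : I} (hi : F.s j = i)
    (hp : F.tree j = p) (hdim : F.dim p = F.dim i + 1 + 1) (S : Finset N)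
    (hS : ∀ m, m ∈ S ↔ j ≤ m ∧ F.dim (F.s m) = F.dim i + 1) :
    ∑ m ∈ S, ((boundarySign (F.X p) (F.nodeMap (F.root p) m (F.s m) p) (F.X (F.s m)) *
      boundarySign (F.X (F.s m)) (F.nodeMap m j i (F.s m)) (F.X i) : ℤˣ) : ℤ) = 0 := by
  classical
  have hr := F.s_root p
  have hjp : j ≤ F.root p := (F.le_root_iff _ _).2 hp
  have hjp' : j < F.root p := by
    refine lt_of_le_of_ne hjp ?_
    rintro rfl
    rw [hr] at hi
    subst hi
    omega
  have hSp : ∀ m ∈ S, m < F.root p := by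
    intro m hm
    have hm' := (hS m).1 hm
    refine lt_of_le_of_ne ((F.le_root_iff _ _).2 ((F.tree_eq_of_le hm'.1).symm.trans hp)) ?_
    rintro rfl
    rw [hr] at hm'
    omega
  have hSj : ∀ m ∈ S, j < m := by
    intro m hm
    have hm' := (hS m).1 hm
    refine lt_of_le_of_ne hm'.1 ?_
    rintro rfl
    rw [hi] at hm'
    omega
  obtain ⟨y, hy⟩ := (F.isReferenceDomain i).isConnected.nonempty
  have hycl := subset_closure hy
  have hchart := chart_comp_nodeMap hi hr hjp hycl
  have key := sum_boundarySign_eq_zero (ι := {m // m < F.root p}) hdim (F.isReferenceDomain p)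
    (isBoundaryPiece_nodeMap hi hr hjp') hy (e := fun m => F.dim (F.s m))
    (W := fun m => F.X (F.s m)) (g := fun m => F.nodeMap (F.root p) m (F.s m) p)
    (fun m => F.isReferenceDomain _) (fun m => isBoundaryPiece_nodeMap rfl hr m.2)
    (fun m => contDiffOn_nodeMap rfl hr m.2.le) (fun m => injOn_nodeMap rfl hr m.2.le)
    (fun m => mapsTo_nodeMap_boundary rfl hr m.2) ?_ ?_ (S.subtype _) ?_
    (fun m => F.nodeMap m j i (F.s m)) ?_ ?_
  · rw [Finset.sum_subtype_of_mem (p := fun m => m < F.root p) (fun m =>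
      ((boundarySign (F.X p) (F.nodeMap (F.root p) m (F.s m) p) (F.X (F.s m)) *
      boundarySign (F.X (F.s m)) (F.nodeMap m j i (F.s m)) (F.X i) : ℤˣ) : ℤ)) hSp] at key
    exact key
  · intro m m' hne
    rw [Set.disjoint_left]
    rintro _ ⟨x, hx, rfl⟩ ⟨x', hx', hxx'⟩
    exact hne (Subtype.ext (eq_of_nodeMap_eq rfl rfl hr m.2.le m'.2.le hx hx' hxx'.symm))
  · -- near a point of a node, the boundary does not meet the Dirichlet part
    have h1 : ContinuousWithinAt (F.chart p) (closure (F.X p)) (F.nodeMap (F.root p) j i p y) :=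
      (F.chart_smooth p).continuousOn _ (mapsTo_nodeMap hi hr hjp hycl)
    have h2 := h1.eventually (F.isClosed_dirichlet.isOpen_compl.mem_nhds (by
      have := F.chart_notMem_dirichlet hy
      rw [hchart] at this
      exact this))
    rw [eventually_nhdsWithin_iff] at h2
    filter_upwards [h2] with x hx hxX
    obtain ⟨m, hm, z, hz, hzx⟩ := exists_nodeMap_eq hr hxX.1 (hx hxX.1)
    refine ⟨⟨m, lt_of_le_of_ne hm ?_⟩, z, hz, hzx⟩
    rintro rfl
    have : ∀ c, F.s (F.root p) = c → ∀ z ∈ F.X c, F.nodeMap (F.root p) (F.root p) c p z = x →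
        False := by
      rintro c hc z hz hzx
      rw [hr] at hc
      subst hc
      rw [nodeMap_self hr (subset_closure hz)] at hzx
      exact hxX.2 (hzx ▸ hz)
    exact this _ rfl z hz hzx
  · -- a node whose closure contains a point of `j` is an ancestor of `j`
    rintro ⟨m, hm⟩
    rw [Finset.mem_subtype, hS]
    constructor
    · rintro ⟨hjm, hd⟩
      exact ⟨hd, F.nodeMap m j i (F.s m) y, mapsTo_nodeMap hi rfl hjm hycl,
        (nodeMap_comp hi rfl hr hjm hm.le hycl).symm⟩
    · rintro ⟨hd, z, hz, hzy⟩
      refine ⟨?_, hd⟩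
      have h1 := chart_comp_nodeMap rfl hr hm.le hz
      obtain ⟨l, hl, x, hx, hxz⟩ := exists_nodeMap_eq rfl hz (by
        have h2 := F.chart_notMem_dirichlet hy
        rw [hchart, Function.comp_apply, ← hzy] at h2
        rw [h1]
        exact h2)
      have h3 : F.nodeMap (F.root p) l (F.s l) p x = F.nodeMap (F.root p) j i p y := by
        rw [nodeMap_comp rfl rfl hr hl hm.le (subset_closure hx), Function.comp_apply, hxz, hzy]
      rw [eq_of_nodeMap_eq hi rfl hr hjp (hl.trans hm.le) hy hx h3.symm]
      exact hl
  · rintro ⟨m, hm⟩ hmS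
    rw [Finset.mem_subtype] at hmS
    exact isBoundaryPiece_nodeMap hi rfl (hSj m hmS)
  · rintro ⟨m, hm⟩ hmS
    rw [Finset.mem_subtype] at hmS
    exact ((nodeMap_comp hi rfl hr (hSj m hmS).le hm.le).mono subset_closure).symm

end ConformingForest

/-! ### Forms on the roots -/

namespace ConformingForest

variable {n : ℕ} {I N : Type*} [PartialOrder N] (F : ConformingForest n I N)

/-- Families of forms of all degrees on the submanifolds `Ω i`. -/
abbrev RootForms : Type _ := ∀ (i : I) (q : ℕ), Form (F.dim i) q

section CastForm

variable {F} {i i' : I} {q : ℕ}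

theorem castForm_smul (h : i = i') (c : ℝ) (α : Form (F.dim i) q) :
    F.castForm h (c • α) = c • F.castForm h α := by
  subst h
  rfl

theorem castForm_pullback {l j : N} {b : I} (h : F.s j = i) (α : Form (F.dim b) q) :
    F.castForm h (pullback (F.X (F.s j)) (F.nodeMap l j (F.s j) b) α) =
      pullback (F.X i) (F.nodeMap l j i b) α := by
  subst h
  rfl

theorem trace_eq_pullback {l j : N} {b : I} (h : F.s l = b) (α : Form (F.dim (F.s l)) q) :
    F.trace l j α =
      pullback (F.X (F.s j)) (F.nodeMap l j (F.s j) b) (F.castForm h α) := by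
  subst h
  rw [nodeMap_s]
  rfl

theorem contDiffOn_castForm (h : i = i') {α : Form (F.dim i) q}
    (hα : ContDiffOn ℝ ∞ α (closure (F.X i))) :
    ContDiffOn ℝ ∞ (F.castForm h α) (closure (F.X i')) := by
  subst h
  exact hα

theorem castForm_apply_eq_zero (h : i = i') {α : Form (F.dim i) q}
    (hα : ∀ x ∉ closure (F.X i), α x = 0) : ∀ x ∉ closure (F.X i'), F.castForm h α x = 0 := by
  subst h
  exact hα

theorem castForm_zero (h : i = i') : F.castForm h (0 : Form (F.dim i) q) = 0 := by
  subst h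
  rfl

end CastForm

/-- The forms on the roots. -/
def rootForms (a : F.Forms) : F.RootForms := fun i q => F.castForm (F.s_root i) (a (F.root i) q)

/-- The forms on all nodes that are, up to the signs `σ`, the traces of the forms `β` on the
roots. -/
def spread (σ : N → ℤˣ) (β : F.RootForms) : F.Forms := fun j q =>
  (((σ j : ℤˣ) : ℤ) : ℝ) • pullback (F.X (F.s j))
    (F.nodeMap (F.root (F.tree j)) j (F.s j) (F.tree j)) (β (F.tree j) q)

/-- The forms on the roots of mixed-dimensional `k`-forms: the degree on `Ω i` is
`k - (n - d_i)`. -/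
structure IsRootForm (k : ℕ) (β : F.RootForms) : Prop where
  degree : ∀ i q, q + n ≠ k + F.dim i → β i q = 0
  contDiffOn : ∀ i q, ContDiffOn ℝ ∞ (β i q) (closure (F.X i))
  support : ∀ i q, ∀ x ∉ closure (F.X i), β i q x = 0

/-- The exterior derivative on every root. -/
def rootDeriv (β : F.RootForms) : F.RootForms
  | _, 0 => 0
  | i, q + 1 => extD (F.X i) (β i q)

open Classical in
/-- The signed sum of the traces on `Ω i` from all submanifolds of dimension one higher. -/
def traceSum [Fintype N] (β : F.RootForms) : F.RootForms := fun i q =>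
  ∑ l : N with F.s l = i ∧ F.dim (F.tree l) = F.dim i + 1,
    (((F.relOrientation l : ℤˣ) : ℤ) : ℝ) •
      pullback (F.X i) (F.nodeMap (F.root (F.tree l)) l i (F.tree l)) (β (F.tree l) q)

variable {F}

theorem rootForms_spread {σ : N → ℤˣ} (hσ : ∀ i, σ (F.root i) = 1) {β : F.RootForms}
    (hβ : ∀ i q, ∀ x ∉ closure (F.X i), β i q x = 0) : F.rootForms (F.spread σ β) = β := by
  funext i q
  have key : ∀ t, t = i → pullback (F.X i) (F.nodeMap (F.root t) (F.root i) i t) (β t q) =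
      β i q := by
    rintro t rfl
    exact pullback_id (F.isReferenceDomain t) (hβ t q) (nodeMap_self (F.s_root t))
  rw [rootForms, spread, hσ, castForm_smul, castForm_pullback, key _ (F.tree_root i)]
  simp

theorem spread_rootForms {σ : N → ℤˣ} {k : ℕ} {a : F.Forms} (ha : a ∈ F.smoothForms σ k) :
    F.spread σ (F.rootForms a) = a := by
  funext j q
  rw [ha.2.2.2 j q, trace_eq_pullback (F.s_root (F.tree j))]
  rfl

theorem isRootForm_rootForms {σ : N → ℤˣ} {k : ℕ} {a : F.Forms} (ha : a ∈ F.smoothForms σ k) :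
    F.IsRootForm k (F.rootForms a) where
  degree := fun i q h => by
    rw [rootForms, ha.1 (F.root i) q (by rwa [F.tree_root i]), castForm_zero]
  contDiffOn := fun i q => contDiffOn_castForm _ (ha.2.1 _ q)
  support := fun i q => castForm_apply_eq_zero _ (ha.2.2.1 _ q)

theorem contDiffOn_smul_pullback_root {l : N} {i : I} {q : ℕ} {β : F.RootForms} (hl : F.s l = i)
    (hβ : ∀ i q, ContDiffOn ℝ ∞ (β i q) (closure (F.X i))) (c : ℝ) : ContDiffOn ℝ ∞
      (c • pullback (F.X i) (F.nodeMap (F.root (F.tree l)) l i (F.tree l)) (β (F.tree l) q))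
      (closure (F.X i)) := by
  have h : ContDiffOn ℝ ∞
      (pullback (F.X i) (F.nodeMap (F.root (F.tree l)) l i (F.tree l)) (β (F.tree l) q))
      (closure (F.X i)) :=
    contDiffOn_pullback (F.isReferenceDomain _)
      (contDiffOn_nodeMap hl (F.s_root _) (F.le_root_tree l)) (hβ _ q)
      (mapsTo_nodeMap hl (F.s_root _) (F.le_root_tree l))
  exact contDiffOn_const.smul h

theorem spread_mem_smoothForms {σ : N → ℤˣ} (hσ : ∀ i, σ (F.root i) = 1) {k : ℕ}
    {β : F.RootForms} (hβ : F.IsRootForm k β) : F.spread σ β ∈ F.smoothForms σ k := by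
  refine ⟨fun j q h => ?_, fun j q => ?_, fun j q x hx => ?_, fun j q => ?_⟩
  · rw [spread, hβ.degree _ q h, pullback_zero, smul_zero]
  · exact contDiffOn_smul_pullback_root rfl hβ.contDiffOn _
  · rw [spread, Pi.smul_apply, pullback_apply_of_notMem hx, smul_zero]
  · have h := congrFun (congrFun (rootForms_spread hσ hβ.support) (F.tree j)) q
    rw [trace_eq_pullback (F.s_root (F.tree j))]
    rw [rootForms] at h
    rw [h]
    rfl

/-- On the roots, the jump operator is `traceSum`, since the square of the sign `σ l` is `1`. -/
theorem castForm_rootJump [Fintype N] {σ : N → ℤˣ} {k : ℕ} {a : F.Forms}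
    (ha : a ∈ F.smoothForms σ k) (i : I) (q : ℕ) :
    F.castForm (F.s_root i) (F.rootJump σ k a (F.root i) q) =
      (-1 : ℝ) ^ (n + k) • F.traceSum (F.rootForms a) i q := by
  classical
  have key : ∀ (r : N) (h : F.s r = i), F.castForm h (F.rootJump σ k a r q) =
      (-1 : ℝ) ^ (n + k) • F.traceSum (F.rootForms a) i q := by
    rintro r rfl
    change F.rootJump σ k a r q = _
    rw [rootJump, traceSum, Finset.sum_filter]
    congr 1
    refine Finset.sum_congr rfl fun l _ => ?_
    by_cases h : F.s l = F.s r ∧ F.dim (F.tree l) = F.dim (F.s r) + 1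
    · rw [dif_pos h, if_pos h]
      have h1 := congrFun (congrFun (spread_rootForms ha) l) q
      rw [← h1, spread, castForm_smul, castForm_pullback, smul_smul]
      congr 1
      have h2 := units_coe_mul_self (σ l)
      push_cast
      rw [mul_assoc, h2, mul_one]
    · rw [dif_neg h, if_neg h]
  exact key _ _

/-- The mixed-dimensional exterior derivative is determined by the forms on the roots. -/
theorem mixedDeriv_eq_spread [Fintype N] {σ : N → ℤˣ} {k : ℕ} {a : F.Forms}
    (ha : a ∈ F.smoothForms σ k) : F.mixedDeriv σ k a =
      F.spread σ (F.rootDeriv (F.rootForms a) + (-1 : ℝ) ^ (n + k) • F.traceSum (F.rootForms a)) := by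
  funext j q
  have hβ := isRootForm_rootForms ha
  have h1 : F.jump σ k a j q = F.spread σ ((-1 : ℝ) ^ (n + k) • F.traceSum (F.rootForms a)) j q := by
    rw [jump, trace_eq_pullback (F.s_root (F.tree j)), castForm_rootJump ha]
    rfl
  have h2 : F.fixedDeriv a j q = F.spread σ (F.rootDeriv (F.rootForms a)) j q := by
    cases q with
    | zero =>
      rw [spread, rootDeriv, pullback_zero, smul_zero]
      rfl
    | succ q =>
      change extD (F.X (F.s j)) (a j q) = _
      have h3 := congrFun (congrFun (spread_rootForms ha) j) q
      rw [← h3, spread, spread, rootDeriv, extD_smul (F.isReferenceDomain _),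
        extD_pullback (F.isReferenceDomain _)
          (contDiffOn_nodeMap rfl (F.s_root _) (F.le_root_tree j)) (hβ.contDiffOn _ q)
          (mapsTo_nodeMap rfl (F.s_root _) (F.le_root_tree j))]
  change F.fixedDeriv a j q + F.jump σ k a j q = _
  rw [h1, h2, spread, spread, spread, ← smul_add, ← pullback_add]
  rfl

theorem traceSum_add [Fintype N] (β β' : F.RootForms) :
    F.traceSum (β + β') = F.traceSum β + F.traceSum β' := by
  funext i q
  simp only [traceSum, Pi.add_apply]
  rw [← Finset.sum_add_distrib]
  exact Finset.sum_congr rfl fun l _ => by rw [pullback_add, smul_add]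

theorem traceSum_smul [Fintype N] (c : ℝ) (β : F.RootForms) :
    F.traceSum (c • β) = c • F.traceSum β := by
  funext i q
  simp only [traceSum, Pi.smul_apply]
  rw [Finset.smul_sum]
  exact Finset.sum_congr rfl fun l _ => by rw [pullback_smul, smul_comm]

section

variable {β : F.RootForms}

theorem contDiffOn_traceSum [Fintype N]
    (hβ : ∀ i q, ContDiffOn ℝ ∞ (β i q) (closure (F.X i))) (i : I) (q : ℕ) :
    ContDiffOn ℝ ∞ (F.traceSum β i q) (closure (F.X i)) := by
  classical
  have h : ContDiffOn ℝ ∞ (fun x => ∑ l : N with F.s l = i ∧ F.dim (F.tree l) = F.dim i + 1,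
    ((((F.relOrientation l : ℤˣ) : ℤ) : ℝ) •
      pullback (F.X i) (F.nodeMap (F.root (F.tree l)) l i (F.tree l)) (β (F.tree l) q)) x)
      (closure (F.X i)) := ContDiffOn.sum fun l hl =>
        contDiffOn_smul_pullback_root (Finset.mem_filter.1 hl).2.1 hβ _
  refine h.congr fun x _ => ?_
  rw [traceSum, Finset.sum_apply]

/-- The exterior derivative commutes with traces. -/
theorem traceSum_rootDeriv [Fintype N] (hβ : ∀ i q, ContDiffOn ℝ ∞ (β i q) (closure (F.X i))) :
    F.traceSum (F.rootDeriv β) = F.rootDeriv (F.traceSum β) := by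
  classical
  funext i q
  cases q with
  | zero =>
    rw [traceSum, rootDeriv]
    refine Finset.sum_eq_zero fun l _ => ?_
    rw [rootDeriv, pullback_zero, smul_zero]
  | succ q =>
    rw [rootDeriv, traceSum, traceSum, extD_sum (F.isReferenceDomain i)]
    · refine Finset.sum_congr rfl fun l hl => ?_
      have hl := (Finset.mem_filter.1 hl).2.1
      rw [extD_smul (F.isReferenceDomain i), extD_pullback (F.isReferenceDomain _)
        (contDiffOn_nodeMap hl (F.s_root _) (F.le_root_tree l)) (hβ _ q)
        (mapsTo_nodeMap hl (F.s_root _) (F.le_root_tree l)), rootDeriv]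
    · intro l hl
      exact contDiffOn_smul_pullback_root (Finset.mem_filter.1 hl).2.1 hβ _

end

theorem isRootForm_rootDeriv {k : ℕ} {β : F.RootForms} (hβ : F.IsRootForm k β) :
    F.IsRootForm (k + 1) (F.rootDeriv β) where
  degree := fun i q h => by
    cases q with
    | zero => rfl
    | succ q => rw [rootDeriv, hβ.degree i q (by omega), extD_zero (F.isReferenceDomain i)]
  contDiffOn := fun i q => by
    cases q with
    | zero => exact contDiffOn_const
    | succ q => exact contDiffOn_extD (F.isReferenceDomain i) (hβ.contDiffOn i q)
  support := fun i q x hx => by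
    cases q with
    | zero => rfl
    | succ q => exact extD_apply_of_notMem hx _

theorem isRootForm_traceSum [Fintype N] {k : ℕ} {β : F.RootForms} (hβ : F.IsRootForm k β) :
    F.IsRootForm (k + 1) (F.traceSum β) where
  degree := fun i q h => by
    classical
    refine Finset.sum_eq_zero fun l hl => ?_
    have hl := (Finset.mem_filter.1 hl).2
    rw [hβ.degree _ q (by omega), pullback_zero, smul_zero]
  contDiffOn := contDiffOn_traceSum hβ.contDiffOn
  support := fun i q x hx => by
    classical
    rw [traceSum, Finset.sum_apply]
    refine Finset.sum_eq_zero fun l _ => ?_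
    rw [Pi.smul_apply, pullback_apply_of_notMem hx, smul_zero]

theorem isRootForm_add_smul {k : ℕ} {β β' : F.RootForms} (hβ : F.IsRootForm k β)
    (hβ' : F.IsRootForm k β') (c : ℝ) : F.IsRootForm k (β + c • β') where
  degree := fun i q h => by simp [hβ.degree i q h, hβ'.degree i q h]
  contDiffOn := fun i q => (hβ.contDiffOn i q).add ((hβ'.contDiffOn i q).const_smul c)
  support := fun i q x hx => by simp [hβ.support i q x hx, hβ'.support i q x hx]

theorem rootDeriv_add {β β' : F.RootForms}
    (hβ : ∀ i q, ContDiffOn ℝ ∞ (β i q) (closure (F.X i)))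
    (hβ' : ∀ i q, ContDiffOn ℝ ∞ (β' i q) (closure (F.X i))) :
    F.rootDeriv (β + β') = F.rootDeriv β + F.rootDeriv β' := by
  funext i q
  cases q with
  | zero => exact (add_zero (0 : Form (F.dim i) 0)).symm
  | succ q => exact extD_add (F.isReferenceDomain i) (hβ i q) (hβ' i q)

theorem rootDeriv_smul (c : ℝ) (β : F.RootForms) :
    F.rootDeriv (c • β) = c • F.rootDeriv β := by
  funext i q
  cases q with
  | zero => exact (smul_zero c).symm
  | succ q => exact extD_smul (F.isReferenceDomain i) c _

theorem rootDeriv_rootDeriv {β : F.RootForms}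
    (hβ : ∀ i q, ContDiffOn ℝ ∞ (β i q) (closure (F.X i))) :
    F.rootDeriv (F.rootDeriv β) = 0 := by
  funext i q
  match q with
  | 0 => rfl
  | 1 => exact extD_zero (F.isReferenceDomain i)
  | q + 2 => exact extD_extD (F.isReferenceDomain i) (hβ i q)

end ConformingForest

/-! ### Iterated jumps -/

namespace ConformingForest

variable {n : ℕ} {I N : Type*} [PartialOrder N] {F : ConformingForest n I N}

/-- The contribution of the chain of nodes `l`, `m`, where `m` represents the root of the tree of
`l`, to the iterated jump is the contribution of the corresponding chain `j ≤ m` in the tree of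
`m`. In the product of the relative orientations, the orientation of the intermediate submanifold
cancels. -/
theorem smul_pullback_eq_of_eqOn {l m j : N} {i : I} {q : ℕ} (hl : F.s l = i)
    (hlm : F.tree l = F.s m) (hj : F.s j = i) (hjm : j ≤ m)
    (h : EqOn (F.nodeMap (F.root (F.s m)) l i (F.s m)) (F.nodeMap m j i (F.s m)) (closure (F.X i)))
    (β : F.RootForms) :
    (((F.relOrientation l * F.relOrientation m : ℤˣ) : ℤ) : ℝ) • pullback (F.X i)
      (F.nodeMap (F.root (F.tree m)) m (F.tree l) (F.tree m) ∘
        F.nodeMap (F.root (F.tree l)) l i (F.tree l)) (β (F.tree m) q) =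
    ((((F.orientation i * F.orientation (F.tree j) : ℤˣ) : ℤ) : ℝ) *
      (((boundarySign (F.X (F.tree j)) (F.nodeMap (F.root (F.tree j)) m (F.s m) (F.tree j))
          (F.X (F.s m)) *
        boundarySign (F.X (F.s m)) (F.nodeMap m j i (F.s m)) (F.X i) : ℤˣ) : ℤ) : ℝ)) •
      pullback (F.X i) (F.nodeMap (F.root (F.tree j)) j i (F.tree j)) (β (F.tree j) q) := by
  have ht : F.tree j = F.tree m := F.tree_eq_of_le hjm
  rw [relOrientation_eq hl hlm, relOrientation_eq (F := F) (l := m) rfl rfl, hlm, ht,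
    boundarySign_congr (F.isReferenceDomain i).isOpen (h.mono subset_closure)]
  congr 1
  · rw [← Int.cast_mul, ← Units.val_mul]
    congr 2
    have h1 : F.orientation (F.s m) * F.orientation (F.s m) = 1 := Int.units_mul_self _
    calc _ = F.orientation (F.s m) * F.orientation (F.s m) * _ := by
          rw [show ∀ a b c d e : ℤˣ, a * b * c * (b * d * e) = b * b * (a * d * (e * c)) from
            fun a b c d e => by
              rw [mul_comm a b]
              simp only [mul_left_comm, mul_comm]]
      _ = _ := by rw [h1, one_mul]
  · refine pullback_congr (fun x hx => ?_) _
    rw [Function.comp_apply, h hx]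
    exact (nodeMap_comp hj rfl (F.s_root _) hjm (F.le_root_tree m) hx).symm

/-- The iterated jump vanishes: it is a sum over chains `j ≤ m` of nodes of codimensions two and
one, and for every `j` the orientations cancel. -/
theorem traceSum_traceSum [Fintype N] (β : F.RootForms) : F.traceSum (F.traceSum β) = 0 := by
  classical
  funext i q
  set t : N → N → Form (F.dim i) q := fun l m =>
    (((F.relOrientation l * F.relOrientation m : ℤˣ) : ℤ) : ℝ) • pullback (F.X i)
      (F.nodeMap (F.root (F.tree m)) m (F.tree l) (F.tree m) ∘
        F.nodeMap (F.root (F.tree l)) l i (F.tree l)) (β (F.tree m) q)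
  set c : N → N → ℤ := fun j m =>
    ((boundarySign (F.X (F.tree j)) (F.nodeMap (F.root (F.tree j)) m (F.s m) (F.tree j))
        (F.X (F.s m)) *
      boundarySign (F.X (F.s m)) (F.nodeMap m j i (F.s m)) (F.X i) : ℤˣ) : ℤ)
  set u : N → N → Form (F.dim i) q := fun j m =>
    ((((F.orientation i * F.orientation (F.tree j) : ℤˣ) : ℤ) : ℝ) * ((c j m : ℤ) : ℝ)) •
      pullback (F.X i) (F.nodeMap (F.root (F.tree j)) j i (F.tree j)) (β (F.tree j) q)
  have h1 : F.traceSum (F.traceSum β) i q =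
      ∑ l : N with F.s l = i ∧ F.dim (F.tree l) = F.dim i + 1,
        ∑ m : N with F.s m = F.tree l ∧ F.dim (F.tree m) = F.dim (F.tree l) + 1, t l m := by
    rw [traceSum]
    refine Finset.sum_congr rfl fun l hl => ?_
    have hl := (Finset.mem_filter.1 hl).2.1
    rw [traceSum, pullback_sum, Finset.smul_sum]
    refine Finset.sum_congr rfl fun m hm => ?_
    have hm := (Finset.mem_filter.1 hm).2.1
    rw [pullback_smul, pullback_comp (F.isReferenceDomain i)
      (contDiffOn_nodeMap hl (F.s_root _) (F.le_root_tree l))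
      (contDiffOn_nodeMap hm (F.s_root _) (F.le_root_tree m))
      (mapsTo_nodeMap hl (F.s_root _) (F.le_root_tree l)), smul_smul]
    congr 1
    push_cast
    rfl
  have h2 : F.traceSum (F.traceSum β) i q =
      ∑ m : N with F.dim (F.s m) = F.dim i + 1 ∧ F.dim (F.tree m) = F.dim i + 1 + 1,
        ∑ l : N with F.s l = i ∧ F.tree l = F.s m, t l m := by
    rw [h1]
    refine Finset.sum_comm' fun l m => ?_
    simp only [Finset.mem_filter, Finset.mem_univ, true_and]
    constructor
    · rintro ⟨⟨h1, h2⟩, h3, h4⟩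
      exact ⟨⟨h1, h3.symm⟩, by rw [h3, h2], by rw [h4, h2]⟩
    · rintro ⟨⟨h1, h2⟩, h3, h4⟩
      exact ⟨⟨h1, by rw [h2, h3]⟩, h2.symm, by rw [h2, h3, h4]⟩
  -- the nodes `l` in the tree of `s m` correspond to the descendants `j` of `m`
  have h3 : ∀ m, ∑ l : N with F.s l = i ∧ F.tree l = F.s m, t l m =
      ∑ j : N with F.s j = i ∧ j ≤ m, u j m := by
    intro m
    have hex : ∀ l ∈ ({l : N | F.s l = i ∧ F.tree l = F.s m} : Finset N), ∃ j, j ≤ m ∧ F.s j = i ∧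
        EqOn (F.nodeMap (F.root (F.s m)) l i (F.s m)) (F.nodeMap m j i (F.s m))
          (closure (F.X i)) := by
      intro l hl
      have hl := (Finset.mem_filter.1 hl).2
      exact F.exists_nodeMap_eqOn (F.s_root _) rfl hl.1 ((F.le_root_iff _ _).2 hl.2)
    choose φ hφm hφi hφ using hex
    obtain ⟨x, hx⟩ := (F.isReferenceDomain i).isConnected.nonempty
    have hxc := subset_closure hx
    refine Finset.sum_bij φ (fun l hl => ?_) (fun l hl l' hl' h => ?_) (fun j hj => ?_)
      (fun l hl => ?_)
    · exact Finset.mem_filter.2 ⟨Finset.mem_univ _, hφi l hl, hφm l hl⟩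
    · have h4 := (Finset.mem_filter.1 hl).2
      have h4' := (Finset.mem_filter.1 hl').2
      refine eq_of_nodeMap_eq h4.1 h4'.1 (F.s_root (F.s m)) ((F.le_root_iff _ _).2 h4.2)
        ((F.le_root_iff _ _).2 h4'.2) hx hx ?_
      rw [hφ l hl hxc, hφ l' hl' hxc, h]
    · have hj := (Finset.mem_filter.1 hj).2
      obtain ⟨l, hl, hli, hlj⟩ := F.exists_nodeMap_eqOn (m' := F.root (F.s m)) rfl
        (F.s_root _) hj.1 hj.2
      have hl' : l ∈ ({l : N | F.s l = i ∧ F.tree l = F.s m} : Finset N) :=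
        Finset.mem_filter.2 ⟨Finset.mem_univ _, hli, (F.le_root_iff _ _).1 hl⟩
      refine ⟨l, hl', ?_⟩
      refine eq_of_nodeMap_eq (hφi l hl') hj.1 rfl (hφm l hl') hj.2 hx hx ?_
      rw [← hφ l hl' hxc, hlj hxc]
    · have h4 := (Finset.mem_filter.1 hl).2
      exact smul_pullback_eq_of_eqOn h4.1 h4.2 (hφi l hl) (hφm l hl) (hφ l hl) β
  rw [h2, Finset.sum_congr rfl fun m _ => h3 m]
  -- in the sum over the chains `j ≤ m`, the trace only depends on `j`
  have h4 : ∑ m : N with F.dim (F.s m) = F.dim i + 1 ∧ F.dim (F.tree m) = F.dim i + 1 + 1,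
      ∑ j : N with F.s j = i ∧ j ≤ m, u j m =
      ∑ j : N with F.s j = i ∧ F.dim (F.tree j) = F.dim i + 1 + 1,
        ∑ m : N with j ≤ m ∧ F.dim (F.s m) = F.dim i + 1, u j m := by
    refine Finset.sum_comm' fun m j => ?_
    simp only [Finset.mem_filter, Finset.mem_univ, true_and]
    constructor
    · rintro ⟨⟨h1, h2⟩, h3, h4⟩
      exact ⟨⟨h4, h1⟩, h3, by rw [F.tree_eq_of_le h4, h2]⟩
    · rintro ⟨⟨h1, h2⟩, h3, h4⟩
      exact ⟨⟨h2, by rw [← F.tree_eq_of_le h1, h4]⟩, h3, h1⟩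
  rw [h4]
  refine Finset.sum_eq_zero fun j hj => ?_
  have hj := (Finset.mem_filter.1 hj).2
  have h5 : ∑ m : N with j ≤ m ∧ F.dim (F.s m) = F.dim i + 1, c j m = 0 :=
    F.sum_boundarySign_nodeMap_eq_zero hj.1 rfl hj.2 _ fun m => by simp
  rw [← Finset.sum_smul, ← Finset.mul_sum, ← Int.cast_sum, h5, Int.cast_zero, mul_zero, zero_smul]

/-! ### The mixed-dimensional exterior derivative -/

/-- The mixed-dimensional exterior derivative of `k`-forms, on the roots. -/
def rootMixedDeriv [Fintype N] (k : ℕ) (β : F.RootForms) : F.RootForms :=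
  F.rootDeriv β + (-1 : ℝ) ^ (n + k) • F.traceSum β

theorem isRootForm_rootMixedDeriv [Fintype N] {k : ℕ} {β : F.RootForms} (hβ : F.IsRootForm k β) :
    F.IsRootForm (k + 1) (rootMixedDeriv k β) :=
  isRootForm_add_smul (isRootForm_rootDeriv hβ) (isRootForm_traceSum hβ) _

/-- The exterior derivative and the jump operator are differentials, and they anticommute because
of the sign in the definition of the jump operator. -/
theorem rootMixedDeriv_rootMixedDeriv [Fintype N] {k : ℕ} {β : F.RootForms}
    (hβ : F.IsRootForm k β) : rootMixedDeriv (k + 1) (rootMixedDeriv k β) = 0 := by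
  have hs := hβ.contDiffOn
  have hs' : ∀ i q, ContDiffOn ℝ ∞ (((-1 : ℝ) ^ (n + k) • F.traceSum β) i q) (closure (F.X i)) :=
    fun i q => contDiffOn_const (c := (-1 : ℝ) ^ (n + k)).smul (contDiffOn_traceSum hs i q)
  rw [rootMixedDeriv, rootMixedDeriv,
    rootDeriv_add (isRootForm_rootDeriv hβ).contDiffOn hs',
    rootDeriv_rootDeriv hs, rootDeriv_smul, traceSum_add, traceSum_smul, traceSum_traceSum,
    traceSum_rootDeriv hs, ← add_assoc n k 1, pow_succ]
  module

theorem castForm_add {i i' : I} {q : ℕ} (h : i = i') (α α' : Form (F.dim i) q) :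
    F.castForm h (α + α') = F.castForm h α + F.castForm h α' := by
  subst h
  rfl

theorem rootForms_add (a b : F.Forms) :
    F.rootForms (a + b) = F.rootForms a + F.rootForms b := by
  funext i q
  exact castForm_add _ _ _

theorem rootForms_smul (c : ℝ) (a : F.Forms) : F.rootForms (c • a) = c • F.rootForms a := by
  funext i q
  exact castForm_smul _ _ _

theorem spread_add (σ : N → ℤˣ) (β β' : F.RootForms) :
    F.spread σ (β + β') = F.spread σ β + F.spread σ β' := by
  funext j q
  simp only [spread, Pi.add_apply, pullback_add, smul_add]

theorem spread_smul (σ : N → ℤˣ) (c : ℝ) (β : F.RootForms) :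
    F.spread σ (c • β) = c • F.spread σ β := by
  funext j q
  simp only [spread, Pi.smul_apply, pullback_smul]
  rw [smul_comm]

theorem rootMixedDeriv_add [Fintype N] {k : ℕ} {β β' : F.RootForms} (hβ : F.IsRootForm k β)
    (hβ' : F.IsRootForm k β') :
    rootMixedDeriv k (β + β') = rootMixedDeriv k β + rootMixedDeriv k β' := by
  rw [rootMixedDeriv, rootMixedDeriv, rootMixedDeriv, rootDeriv_add hβ.contDiffOn hβ'.contDiffOn,
    traceSum_add]
  module

theorem rootMixedDeriv_smul [Fintype N] {k : ℕ} (c : ℝ) (β : F.RootForms) :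
    rootMixedDeriv k (c • β) = c • rootMixedDeriv k β := by
  rw [rootMixedDeriv, rootMixedDeriv, rootDeriv_smul, traceSum_smul]
  module

end ConformingForest

end MixedDim

end

open MixedDim MixedDim.ConformingForest

theorem mainTheorem9 {n : ℕ} {I N : Type*} [PartialOrder N] [Fintype N]
    (F : MixedDim.ConformingForest n I N)
    (σ : N → ℤˣ) (hσ : ∀ i, σ (F.root i) = 1) :
    ∃ D : ∀ k : ℕ, F.smoothForms σ k →ₗ[ℝ] F.smoothForms σ (k + 1),
      (∀ (k : ℕ) (a : F.smoothForms σ k), (D k a : F.Forms) = F.mixedDeriv σ k a) ∧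
      (∀ k : ℕ, D (k + 1) ∘ₗ D k = 0) := by
  have hd : ∀ (k : ℕ) (a : F.smoothForms σ k),
      F.mixedDeriv σ k a = F.spread σ (rootMixedDeriv k (F.rootForms a)) :=
    fun k a => mixedDeriv_eq_spread a.2
  refine ⟨fun k =>
    { toFun := fun a => ⟨F.mixedDeriv σ k a, by
        rw [hd]
        exact spread_mem_smoothForms hσ (isRootForm_rootMixedDeriv (isRootForm_rootForms a.2))⟩
      map_add' := fun a b => Subtype.ext ?_
      map_smul' := fun c a => Subtype.ext ?_ }, fun k a => rfl, fun k => ?_⟩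
  · change F.mixedDeriv σ k (a + b : F.smoothForms σ k) =
      F.mixedDeriv σ k a + F.mixedDeriv σ k b
    rw [hd, hd, hd, Submodule.coe_add, rootForms_add, rootMixedDeriv_add
      (isRootForm_rootForms a.2) (isRootForm_rootForms b.2), spread_add]
  · change F.mixedDeriv σ k (c • a : F.smoothForms σ k) = c • F.mixedDeriv σ k a
    rw [hd, hd, Submodule.coe_smul, rootForms_smul, rootMixedDeriv_smul, spread_smul]
  · refine LinearMap.ext fun a => Subtype.ext ?_
    have ha := isRootForm_rootForms a.2
    have hb := spread_mem_smoothForms hσ (isRootForm_rootMixedDeriv ha)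
    change F.mixedDeriv σ (k + 1) (F.mixedDeriv σ k a) = 0
    rw [hd, hd (k + 1) ⟨_, hb⟩, rootForms_spread hσ (isRootForm_rootMixedDeriv ha).support,
      rootMixedDeriv_rootMixedDeriv ha]
    funext j q
    change _ • pullback _ _ (0 : Form _ q) = 0
    rw [pullback_zero, smul_zero]
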